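/- **Conventions.** All spaces are $\Delta$-generated spaces (the category $\mathbf{Top}$ of spaces that are colimits of simplices, with products and mapping spaces being $\Delta$-kelleyfied). * $\mathcal G$ is the category enriched over $\mathbf{Top}$ with objects the reals $\ell>0$ and $\mathcal G(\ell,\ell')$ the space of nondecreasing homeomorphisms $[0,\ell]\to[0,\ell']$ (with the $\Delta$-kelleyfication of the compact-open topology). For $\phi_i\in\mathcal G(\ell_i,\ell'_i)$, $i=1,2$, let $\phi_1\otimes\phi_2\in\mathcal G(\ell_1+\ell_2,\ell'_1+\ell'_2)$ be the map given by $\phi_1$ on $[0,\ell_1]$ and by a translate of $\phi_2$ on $[\ell_1,\ell_1+\ell_2]$. * A $\mathcal G$-space is an enriched functor $D:\mathcal G^{op}\to\mathbf{Top}$; the tensor product of $\mathcal G$-spaces is the enriched coend $D\otimes E=\int^{(\ell_1,\ell_2)}\mathcal G(-,\ell_1+\ell_2)\times D(\ell_1)\times E(\ell_2)$, and $\mathbb F_\ell U=\mathcal G(-,\ell)\times U$. A Moore flow $X$ is a small semicategory (category without identities) enriched over $\mathcal G$-spaces with $\otimes$: a set of states $X^0$, $\mathcal G$-spaces $\mathbb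 P_{\alpha,\beta}X$, and an associative composition law $\mathbb P_{\alpha,\beta}X\otimes\mathbb P_{\beta,\gamma}X\to\mathbb P_{\alpha,\gamma}X$. A map of Moore flows is an enriched semifunctor. * A multipointed $d$-space is a space $|X|$ with a set of states $X^0\subset|X|$ and a set of continuous maps $[0,1]\to|X|$ (the execution paths) from state to state, closed under normalized composition and reparametrization by $\mathcal G(1,1)$. Its Moore flow $\mathbb M^{\mathcal G}X$ has the states $X^0$, and $\mathbb P^\ell_{\alpha,\beta}\mathbb M^{\mathcal G}X$ is the space of paths $[0,\ell]\to|X|$, $t\mapsto\gamma(t/\ell)$, for $\gamma$ an execution path from $\alpha$ to $\beta$; the composition law is the Moore composition (concatenation) of paths. * Let $\square$ be the box category, generated by the coface maps of the cubes $[n]=\{0,1\}^n$; a precubical set is a functor $\square^{op}\to\mathbf{Set}$, and $\square[n]$ is the one represented by $[n]$. The regular $n$-cube $|\square[n]|^t_{reg}$ is the multipointed $d$-space $[0,1]^n$ with states $\{0,1\}^n$ and execution paths the continuous maps $\gamma:[0,1]\to[0,1]^n$ that are nondecreasing in each coordinate, regular (constant on no interval $[s,t]$ with $s<t$), and go from a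 vertex $a$ to a vertex $b$ with $a<b$ for the product order. For a precubical set $K$ let $$[K]_{reg}=\varinjlim_{\square[n]\to K}\mathbb M^{\mathcal G}|\square[n]|^t_{reg},$$ the colimit of Moore flows over the category of cubes of $K$. **The Moore flow $\|K\|^{\mathcal G}$.** For $n\ge1$ let $N_n$ be the space of continuous maps $\gamma:[0,n]\to[0,1]^n$ from $0_n=(0,\dots,0)$ to $1_n=(1,\dots,1)$ such that $t\mapsto\gamma(nt)$ is an execution path of $|\square[n]|^t_{reg}$ and that are natural, i.e. $\sum_i|\gamma_i(t)-\gamma_i(0)|=t$ for all $t$ (with the $\Delta$-kelleyfication of the compact-open topology). For a finite nonempty sequence $\underline n=(n_1,\dots,n_p)$ of positive integers let $\square[\underline n]=\square[n_1]*\dots*\square[n_p]$ be obtained by identifying the final state $1_{n_i}$ of $\square[n_i]$ with the initial state $0_{n_{i+1}}$ of $\square[n_{i+1}]$. A partition $A\sqcup B=\{1,\dots,m_1+m_2\}$ with $|A|=m_1>0$ and $|B|=m_2>0$ determines a map $\phi_{A,B}:\square[m_1]*\square[m_2]\to\square[m_1+m_2]$ that takes $\mathrm{id}_{[m_1]}$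 to the face where the coordinates in $B$ are $0$ and $\mathrm{id}_{[m_2]}$ to the face where the coordinates in $A$ are $1$; let $\delta_{i,A,B}=\mathrm{id}*\dots*\phi_{A,B}*\dots*\mathrm{id}$ ($\phi_{A,B}$ in position $i$). For $\alpha,\beta\in K_0$ and $n\ge1$, the category $\mathrm{Ch}_{\alpha,\beta}(K,n)$ has as objects the maps $\square[\underline n]\to K$ with $n_1+\dots+n_p=n$ that take the initial state of $\square[n_1]$ to $\alpha$ and the final state of $\square[n_p]$ to $\beta$, and as morphisms the maps over $K$ that are composites of maps $\delta_{i,A,B}$. The functor $\mathcal D^{\mathcal G}_{\alpha,\beta}(K,n)$ from $\mathrm{Ch}_{\alpha,\beta}(K,n)$ to $\mathcal G$-spaces takes $\square[\underline n]\to K$ to $\mathbb F_{n_1}N_{n_1}\otimes\dots\otimes\mathbb F_{n_p}N_{n_p}$, and $\phi_{A,B}$ to the composite $$\mathbb F_{m_1}N_{m_1}\otimes\mathbb F_{m_2}N_{m_2}\cong\mathbb F_{m_1+m_2}(N_{m_1}\times N_{m_2})\to\mathbb F_{m_1+m_2}N_{m_1+m_2},$$ the last map being the Moore composition of the images of the two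 natural paths in the two faces above. The Moore flow $\|K\|^{\mathcal G}$ has the set of states $K_0$, the $\mathcal G$-spaces of execution paths $$\mathbb P_{\alpha,\beta}\|K\|^{\mathcal G}=\coprod_{n\ge1}\varinjlim\mathcal D^{\mathcal G}_{\alpha,\beta}(K,n),$$ and the composition law induced by the concatenation $\square[\underline m]*\square[\underline n]\to K$ of cube chains. It is functorial in $K$ by composition of chains with maps $K\to L$. **Theorem.** The colimits $[K]_{reg}$ exist, and there is an isomorphism of Moore flows $$[K]_{reg}\cong\|K\|^{\mathcal G}$$ for all precubical sets $K$, natural in $K$. -/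

import Mathlib

open CategoryTheory Topology Opposite

namespace MooreFlows

noncomputable section

/-! ### Spaces -/

/-- The test spaces `ℝⁿ`; a space is `Δ`-generated when it is generated by them. -/
abbrev Eucl (n : ℕ) : Type := Fin n → ℝ

/-- Continuity of a map for the `Δ`-kelleyfication of the topology of its source. -/
abbrev DCont {X Y : Type} [TopologicalSpace X] [TopologicalSpace Y] (f : X → Y) : Prop :=
  ContinuousGeneratedBy Eucl f

/-- The `Δ`-kelleyfication of a topology. -/
abbrev kD {X : Type} (t : TopologicalSpace X) : TopologicalSpace X :=
  @TopologicalSpace.generatedBy _ Eucl _ X t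

section DCont

variable {X Y Z W : Type} [TopologicalSpace X] [TopologicalSpace Y] [TopologicalSpace Z]
  [TopologicalSpace W]

theorem dgen_kD {X : Type} (t : TopologicalSpace X) : @DeltaGeneratedSpace X (kD t) :=
  inferInstanceAs (IsGeneratedBy Eucl (WithGeneratedByTopology Eucl X))

theorem kD_le {X : Type} (t : TopologicalSpace X) : kD t ≤ t :=
  TopologicalSpace.generatedBy_le

theorem continuous_kD_dom {f : X → Y} : Continuous[kD ‹_›, ‹_›] f ↔ DCont f := by
  exact WithGeneratedByTopology.continuous_from_iff (X := Eucl) f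

theorem DCont.continuous [DeltaGeneratedSpace X] {f : X → Y} (h : DCont f) : Continuous f :=
  (IsGeneratedBy.continuous_iff Eucl f).2 h

theorem DCont.mk {f : X → Y} (h : Continuous f) : DCont f := h.continuousGeneratedBy

theorem DCont.comp' {g : Y → Z} {f : X → Y} (hg : DCont g) (hf : DCont f) :
    DCont fun x => g (f x) := ContinuousGeneratedBy.comp hg hf

theorem DCont.prodMk {f : X → Y} {g : X → Z} (hf : DCont f) (hg : DCont g) :
    DCont fun x => (f x, g x) := fun _ p => (hf p).prodMk (hg p)

theorem DCont.fst {f : X → Y × Z} (hf : DCont f) : DCont fun x => (f x).1 :=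
  fun _ p => continuous_fst.comp (hf p)

theorem DCont.snd {f : X → Y × Z} (hf : DCont f) : DCont fun x => (f x).2 :=
  fun _ p => continuous_snd.comp (hf p)

/-- A map into a kelleyfied space is `Δ`-continuous as soon as it is so before kelleyfication. -/
theorem DCont.rng_kD {f : X → Y} (hf : DCont f) : @DCont X Y _ (kD ‹_›) f := by
  intro n p
  have := (IsGeneratedBy.equiv_symm_comp_continuous_iff (X := Eucl) (f ∘ p)).2 (hf p)
  exact this

end DCont

/-- The `Δ`-kelleyfication of a space. -/
structure KD (X : Type) [TopologicalSpace X] : Type where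
  val : X

namespace KD

variable {X Y : Type} [TopologicalSpace X] [TopologicalSpace Y]

instance : TopologicalSpace (KD X) := kD (TopologicalSpace.induced val inferInstance)

instance : DeltaGeneratedSpace (KD X) := dgen_kD _

theorem val_dcont : DCont (val : KD X → X) :=
  DCont.mk (continuous_le_dom (kD_le _) continuous_induced_dom)

theorem mk_dcont : DCont (mk : X → KD X) :=
  @DCont.rng_kD X (KD X) _ (TopologicalSpace.induced val inferInstance) mk
    (@DCont.mk _ _ _ (TopologicalSpace.induced val inferInstance) _
      (continuous_induced_rng.2 continuous_id))

end KD

section DCont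

variable {X Y Z W : Type} [TopologicalSpace X] [TopologicalSpace Y] [TopologicalSpace Z]
  [TopologicalSpace W]

instance dgen_prod (i j : ℕ) : IsGeneratedBy Eucl (Eucl i × Eucl j) :=
  (Homeomorph.isQuotientMap (Fin.appendHomeomorph i j).symm).isGeneratedBy

/-- Products with a fixed space preserve final topologies of `Δ`-generated spaces. -/
theorem DCont.prod_final {ι : Type} {S : ι → Type} [∀ i, TopologicalSpace (S i)]
    {q : ∀ i, S i → Y}
    (hq : ‹TopologicalSpace Y› = ⨆ i, TopologicalSpace.coinduced (q i) inferInstance)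
    (hs : ∀ y, ∃ i s, q i s = y)
    [∀ i, DeltaGeneratedSpace (S i)] {f : Z → Y → W}
    (h : ∀ i, DCont fun p : Z × S i => f p.1 (q i p.2)) :
    DCont fun p : Z × Y => f p.1 p.2 := by
  have hz : ∀ y, DCont fun z => f z y := by
    intro y
    obtain ⟨i, s, rfl⟩ := hs y
    exact (h i).comp' (DCont.mk (f := fun z => (z, s)) (by fun_prop))
  let g : Y → ContinuousMapGeneratedBy Eucl Z W := fun y => ⟨fun z => f z y, hz y⟩
  have hg : Continuous g := by
    rw [hq, continuous_iSup_dom]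
    intro i
    rw [continuous_coinduced_dom]
    exact DCont.continuous (ContinuousMapGeneratedBy.curryEquiv
      (⟨_, h i⟩ : ContinuousMapGeneratedBy Eucl (Z × S i) W)).prop
  exact (ContinuousMapGeneratedBy.curryEquiv.symm
    (⟨g, DCont.mk hg⟩ : ContinuousMapGeneratedBy Eucl Y _)).prop

end DCont

/-! ### Intervals, Moore composition and the reparametrization category -/

/-- Lengths: the objects of the reparametrization category. -/
abbrev Len : Type := {l : ℝ // 0 < l}

/-- The interval `[0, l]`. -/
abbrev Itv (l : Len) : Type := Set.Icc (0 : ℝ) l.1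

namespace Itv

variable {a b : Len}

def bot (a : Len) : Itv a := ⟨0, le_rfl, a.2.le⟩

def top (a : Len) : Itv a := ⟨a.1, a.2.le, le_rfl⟩

/-- `[0, a] ⊆ [0, a + b]`. -/
def inl (b : Len) (t : Itv a) : Itv (a + b) :=
  ⟨t.1, t.2.1, t.2.2.trans (le_add_of_nonneg_right b.2.le)⟩

/-- The translation `[0, b] → [a, a + b]`. -/
def inr (a : Len) (t : Itv b) : Itv (a + b) :=
  ⟨a.1 + t.1, add_nonneg a.2.le t.2.1, add_le_add_right t.2.2 a.1⟩

theorem inl_top : inl b (top a) = inr a (bot b) := Subtype.ext (add_zero _).symm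

theorem cases (t : Itv (a + b)) : (∃ s, t = inl b s) ∨ ∃ s, t = inr a s := by
  rcases le_total t.1 a.1 with h | h
  · exact Or.inl ⟨⟨t.1, t.2.1, h⟩, rfl⟩
  · refine Or.inr ⟨⟨t.1 - a.1, sub_nonneg.2 h, ?_⟩, Subtype.ext (by simp [inr])⟩
    have : t.1 ≤ a.1 + b.1 := t.2.2
    linarith

end Itv

/-- The Moore composition of maps `f` on `[0, a]` and `g` on `[0, b]`, defined on `[0, a + b]`:
it is `f t` for `t ≤ a` and `g (t - a)` for `t ≥ a`. -/
def glue {a b : Len} {X : Type*} (f : Itv a → X) (g : Itv b → X) (t : Itv (a + b)) : X :=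
  if t.1 ≤ a.1 then f (Set.projIcc 0 a.1 a.2.le t.1)
  else g (Set.projIcc 0 b.1 b.2.le (t.1 - a.1))

section glue

variable {a b c : Len} {X Y : Type*} {f : Itv a → X} {g : Itv b → X}

theorem glue_inl (t : Itv a) : glue f g (Itv.inl b t) = f t := by
  simp [glue, Itv.inl, t.2.2, Set.projIcc_of_mem a.2.le t.2]

theorem glue_inr (h : f (Itv.top a) = g (Itv.bot b)) (t : Itv b) :
    glue f g (Itv.inr a t) = g t := by
  rcases eq_or_lt_of_le t.2.1 with h0 | h0
  · have ht : t = Itv.bot b := Subtype.ext h0.symm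
    rw [ht, ← Itv.inl_top, glue_inl, h]
  · have hn : ¬ (a.1 + t.1 ≤ a.1) := by linarith
    simp [glue, Itv.inr, hn, Set.projIcc_of_mem b.2.le t.2]

theorem glue_bot : glue f g (Itv.bot _) = f (Itv.bot _) := glue_inl (Itv.bot a)

theorem glue_top (h : f (Itv.top a) = g (Itv.bot b)) :
    glue f g (Itv.top _) = g (Itv.top _) := glue_inr h (Itv.top b)

theorem comp_glue (k : X → Y) (t : Itv (a + b)) :
    k (glue f g t) = glue (fun t => k (f t)) (fun t => k (g t)) t := by
  unfold glue; split <;> rfl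

theorem glue_strictMono [PartialOrder X] (h : f (Itv.top a) = g (Itv.bot b))
    (hf : StrictMono f) (hg : StrictMono g) : StrictMono (glue f g) := by
  intro s t hst
  rcases Itv.cases s with ⟨s, rfl⟩ | ⟨s, rfl⟩ <;> rcases Itv.cases t with ⟨t, rfl⟩ | ⟨t, rfl⟩
  · rw [glue_inl, glue_inl]; exact hf hst
  · rw [glue_inl, glue_inr h]
    have h1 : f s ≤ f (Itv.top a) := hf.monotone s.2.2
    have h2 : g (Itv.bot b) ≤ g t := hg.monotone t.2.1
    rcases eq_or_lt_of_le s.2.2 with h3 | h3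
    · have : s = Itv.top a := Subtype.ext h3
      subst this
      rw [h]
      rw [Itv.inl_top] at hst
      exact hg (lt_of_add_lt_add_left (a := a.1) hst)
    · exact ((hf (show s < Itv.top a from h3)).trans_eq h).trans_le h2
  · exfalso
    have h1 : a.1 + s.1 < t.1 := hst
    have h2 := s.2.1
    have h3 := t.2.2
    linarith
  · rw [glue_inr h, glue_inr h]
    exact hg (lt_of_add_lt_add_left (a := a.1) hst)

theorem glue_continuous {P : Type*} [TopologicalSpace P] [TopologicalSpace X]
    {f : P → Itv a → X} {g : P → Itv b → X}
    (h : ∀ p, f p (Itv.top a) = g p (Itv.bot b))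
    (hf : Continuous fun p : P × Itv a => f p.1 p.2)
    (hg : Continuous fun p : P × Itv b => g p.1 p.2) :
    Continuous fun p : P × Itv (a + b) => glue (f p.1) (g p.1) p.2 := by
  unfold glue
  refine Continuous.if_le ?_ ?_ (by fun_prop) continuous_const ?_
  · exact hf.comp (continuous_fst.prodMk
      ((continuous_projIcc (h := a.2.le)).comp (by fun_prop)))
  · exact hg.comp (continuous_fst.prodMk
      ((continuous_projIcc (h := b.2.le)).comp (by fun_prop)))
  · intro p hp
    rw [hp, sub_self, Set.projIcc_right, Set.projIcc_left]
    exact h p.1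

end glue

/-- `𝒢(a, b)`: the nondecreasing homeomorphisms from `[0, a]` to `[0, b]`, i.e. the order
isomorphisms. -/
structure Rep (a b : Len) : Type where
  iso : Itv a ≃o Itv b

namespace Rep

variable {a b c d a' b' c' : Len}

instance : CoeFun (Rep a b) fun _ => Itv a → Itv b := ⟨fun φ => φ.iso⟩

@[ext] theorem ext {φ ψ : Rep a b} (h : ∀ t, φ t = ψ t) : φ = ψ := by
  cases φ; cases ψ; congr; exact OrderIso.ext (funext h)

theorem continuous (φ : Rep a b) : Continuous φ := φ.iso.continuous

def toCM (φ : Rep a b) : C(Itv a, Itv b) := ⟨φ, φ.continuous⟩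

/-- The `Δ`-kelleyfication of the compact-open topology. -/
instance : TopologicalSpace (Rep a b) :=
  kD (TopologicalSpace.induced toCM inferInstance)

instance : DeltaGeneratedSpace (Rep a b) := dgen_kD _

@[simp] theorem apply_bot (φ : Rep a b) : φ (Itv.bot a) = Itv.bot b := by
  refine le_antisymm ?_ (φ _).2.1
  obtain ⟨t, ht⟩ := φ.iso.surjective (Itv.bot b)
  rw [← ht]
  exact φ.iso.monotone t.2.1

@[simp] theorem apply_top (φ : Rep a b) : φ (Itv.top a) = Itv.top b := by
  refine le_antisymm (φ _).2.2 ?_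
  obtain ⟨t, ht⟩ := φ.iso.surjective (Itv.top b)
  rw [← ht]
  exact φ.iso.monotone t.2.2

protected def id (a : Len) : Rep a a := ⟨OrderIso.refl _⟩

/-- The composite `ψ φ`. -/
def comp (ψ : Rep b c) (φ : Rep a b) : Rep a c := ⟨φ.iso.trans ψ.iso⟩

protected def symm (φ : Rep a b) : Rep b a := ⟨φ.iso.symm⟩

/-- The identity of `[0, a]` when `a = b`. -/
def ofEq (h : a = b) : Rep a b := h ▸ Rep.id a

@[simp] theorem id_apply (t : Itv a) : Rep.id a t = t := rfl
@[simp] theorem comp_apply (ψ : Rep b c) (φ : Rep a b) (t : Itv a) : ψ.comp φ t = ψ (φ t) := rfl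
@[simp] theorem symm_apply (φ : Rep a b) (t : Itv a) : φ.symm (φ t) = t :=
  φ.iso.symm_apply_apply t
@[simp] theorem apply_symm (φ : Rep a b) (t : Itv b) : φ (φ.symm t) = t :=
  φ.iso.apply_symm_apply t
@[simp] theorem ofEq_val (h : a = b) (t : Itv a) : (ofEq h t).1 = t.1 := by subst h; rfl
theorem ofEq_self (h : a = a) : ofEq h = Rep.id a := rfl
@[simp] theorem ofEq_comp_ofEq (h : a = b) (h' : b = c) :
    (ofEq h').comp (ofEq h) = ofEq (h.trans h') := by subst h; subst h'; rfl
@[simp] theorem id_comp (φ : Rep a b) : (Rep.id b).comp φ = φ := rfl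
@[simp] theorem comp_id (φ : Rep a b) : φ.comp (Rep.id a) = φ := rfl
theorem comp_assoc (χ : Rep c d) (ψ : Rep b c) (φ : Rep a b) :
    (χ.comp ψ).comp φ = χ.comp (ψ.comp φ) := rfl

theorem sum_strictMono (φ : Rep a a') (ψ : Rep b b') :
    StrictMono (glue (fun t => Itv.inl b' (φ t)) fun t => Itv.inr a' (ψ t)) := by
  refine glue_strictMono (by simp [Itv.inl_top]) (fun _ _ h => φ.iso.strictMono h) fun s t h => ?_
  exact add_lt_add_right (show (ψ s).1 < (ψ t).1 from ψ.iso.strictMono h) a'.1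

/-- The tensor product `φ ⊗ ψ` of `𝒢`, which applies `φ` on `[0, a]` and `ψ` on `[a, a + b]`. -/
def sum (φ : Rep a a') (ψ : Rep b b') : Rep (a + b) (a' + b') :=
  ⟨(sum_strictMono φ ψ).orderIsoOfRightInverse _
    (glue (fun t => Itv.inl b (φ.symm t)) fun t => Itv.inr a (ψ.symm t)) (by
      intro t
      have h : Itv.inl b' (φ (Itv.top a)) = Itv.inr a' (ψ (Itv.bot b)) := by simp [Itv.inl_top]
      have h' : Itv.inl b (φ.symm (Itv.top a')) = Itv.inr a (ψ.symm (Itv.bot b')) := by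
        simp [Itv.inl_top]
      rcases Itv.cases t with ⟨t, rfl⟩ | ⟨t, rfl⟩
      · rw [glue_inl, glue_inl, apply_symm]
      · rw [glue_inr h', glue_inr h, apply_symm])⟩

theorem sum_def (φ : Rep a a') (ψ : Rep b b') (t : Itv (a + b)) :
    φ.sum ψ t = glue (fun t => Itv.inl b' (φ t)) (fun t => Itv.inr a' (ψ t)) t := rfl

@[simp] theorem sum_inl (φ : Rep a a') (ψ : Rep b b') (t : Itv a) :
    φ.sum ψ (Itv.inl b t) = Itv.inl b' (φ t) := by rw [sum_def, glue_inl]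

@[simp] theorem sum_inr (φ : Rep a a') (ψ : Rep b b') (t : Itv b) :
    φ.sum ψ (Itv.inr a t) = Itv.inr a' (ψ t) := by
  rw [sum_def, glue_inr (by simp [Itv.inl_top])]

@[simp] theorem sum_id : (Rep.id a).sum (Rep.id b) = Rep.id (a + b) := by
  ext1 t
  rcases Itv.cases t with ⟨t, rfl⟩ | ⟨t, rfl⟩ <;> simp

theorem sum_comp {a'' b'' : Len} (φ' : Rep a' a'') (φ : Rep a a') (ψ' : Rep b' b'')
    (ψ : Rep b b') : (φ'.comp φ).sum (ψ'.comp ψ) = (φ'.sum ψ').comp (φ.sum ψ) := by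
  ext1 t
  rcases Itv.cases t with ⟨t, rfl⟩ | ⟨t, rfl⟩ <;> simp

theorem assoc_aux (t : Itv (a + b + c)) : (∃ s, t = Itv.inl c (Itv.inl b s)) ∨
    (∃ s, t = Itv.inl c (Itv.inr a s)) ∨ ∃ s, t = Itv.inr (a + b) s := by
  rcases Itv.cases t with ⟨t, rfl⟩ | ⟨t, rfl⟩
  · rcases Itv.cases t with ⟨t, rfl⟩ | ⟨t, rfl⟩
    · exact Or.inl ⟨t, rfl⟩
    · exact Or.inr (Or.inl ⟨t, rfl⟩)
  · exact Or.inr (Or.inr ⟨t, rfl⟩)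

/-- The identity, viewed from `(a + b) + c` to `a + (b + c)`. -/
def assoc (a b c : Len) : Rep (a + b + c) (a + (b + c)) := ofEq (add_assoc a b c)

def assoc' (a b c : Len) : Rep (a + (b + c)) (a + b + c) := ofEq (add_assoc a b c).symm

@[simp] theorem assoc_ll (t : Itv a) :
    assoc a b c (Itv.inl c (Itv.inl b t)) = Itv.inl (b + c) t := Subtype.ext (ofEq_val _ _)
@[simp] theorem assoc_lr (t : Itv b) :
    assoc a b c (Itv.inl c (Itv.inr a t)) = Itv.inr a (Itv.inl c t) := Subtype.ext (ofEq_val _ _)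
@[simp] theorem assoc_r (t : Itv c) :
    assoc a b c (Itv.inr (a + b) t) = Itv.inr a (Itv.inr b t) :=
  Subtype.ext ((ofEq_val _ _).trans (add_assoc _ _ _))
@[simp] theorem assoc_assoc' : (assoc a b c).comp (assoc' a b c) = Rep.id _ := by
  simp [assoc, assoc', ofEq_self]
@[simp] theorem assoc'_assoc : (assoc' a b c).comp (assoc a b c) = Rep.id _ := by
  simp [assoc, assoc', ofEq_self]

theorem assoc_sum (φ : Rep a a') (ψ : Rep b b') (χ : Rep c c') :
    (assoc a' b' c').comp ((φ.sum ψ).sum χ) = (φ.sum (ψ.sum χ)).comp (assoc a b c) := by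
  ext1 t
  rcases assoc_aux t with ⟨t, rfl⟩ | ⟨t, rfl⟩ | ⟨t, rfl⟩ <;> simp

theorem assoc'_sum (φ : Rep a a') (ψ : Rep b b') (χ : Rep c c') :
    (assoc' a' b' c').comp (φ.sum (ψ.sum χ)) = ((φ.sum ψ).sum χ).comp (assoc' a b c) := by
  have h := congrArg (fun θ => ((assoc' a' b' c').comp θ).comp (assoc' a b c)) (assoc_sum φ ψ χ)
  simp only [comp_assoc, assoc_assoc', comp_id] at h
  rw [← h, ← comp_assoc, ← comp_assoc, assoc'_assoc]; rfl

/-- A family of reparametrizations is `Δ`-continuous iff it is jointly continuous on plots. -/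
theorem continuous_iff {n : ℕ} {f : Eucl n → Rep a b} :
    Continuous f ↔ Continuous fun p : Eucl n × Itv a => f p.1 p.2 := by
  constructor
  · intro h
    have h1 : Continuous fun x => (f x).toCM :=
      continuous_induced_rng.1 (continuous_le_rng (kD_le _) h)
    exact ContinuousMap.continuous_uncurry_of_continuous ⟨_, h1⟩
  · intro h
    have h1 : Continuous fun x => (f x).toCM := (ContinuousMap.curry ⟨_, h⟩).continuous
    let _ : TopologicalSpace (Rep a b) := TopologicalSpace.induced toCM inferInstance
    have h2 : DCont f := DCont.mk (continuous_induced_rng.2 h1)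
    exact h2.rng_kD (ContinuousMap.id _)

theorem dcont_comp : DCont fun p : Rep b c × Rep a b => p.1.comp p.2 := by
  intro n p
  refine continuous_iff.2 ?_
  have h1 := continuous_iff.1 (continuous_fst.comp p.continuous)
  have h2 := continuous_iff.1 (continuous_snd.comp p.continuous)
  exact h1.comp (continuous_fst.prodMk h2)

theorem dcont_sum : DCont fun p : Rep a a' × Rep b b' => p.1.sum p.2 := by
  intro n p
  refine continuous_iff.2 ?_
  have h1 := continuous_iff.1 (continuous_fst.comp p.continuous)
  have h2 := continuous_iff.1 (continuous_snd.comp p.continuous)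
  refine glue_continuous (f := fun x t => Itv.inl b' ((p x).1 t))
    (g := fun x t => Itv.inr a' ((p x).2 t)) (fun x => by simp [Itv.inl_top]) ?_ ?_
  · exact (Continuous.subtype_mk (continuous_subtype_val.comp h1) _)
  · exact (Continuous.subtype_mk (continuous_const.add (continuous_subtype_val.comp h2)) _)

end Rep

/-! ### `𝒢`-spaces -/

/-- A `𝒢`-space: an enriched presheaf on `𝒢` with values in `Δ`-generated spaces. The enrichment,
continuity of `𝒢(a, b) → TOP(D(b), D(a))`, is stated in its adjoint form, where the binary product
is the one of `Δ`-generated spaces. -/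
structure GSpace where
  obj : Len → Type
  top : ∀ l, TopologicalSpace (obj l)
  dgen : ∀ l, DeltaGeneratedSpace (obj l)
  act : ∀ {a b : Len}, Rep a b → obj b → obj a
  act_id : ∀ {a : Len} (x : obj a), act (Rep.id a) x = x
  act_comp : ∀ {a b c : Len} (ψ : Rep b c) (φ : Rep a b) (x : obj c),
    act (ψ.comp φ) x = act φ (act ψ x)
  act_dcont : ∀ a b : Len, DCont fun p : Rep a b × obj b => act p.1 p.2

attribute [instance] GSpace.top GSpace.dgen

namespace GSpace

/-- Maps of `𝒢`-spaces. -/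
@[ext] structure Hom (D E : GSpace) where
  app : ∀ l, D.obj l → E.obj l
  continuous : ∀ l, Continuous (app l)
  naturality : ∀ {a b : Len} (φ : Rep a b) (x : D.obj b),
    app a (D.act φ x) = E.act φ (app b x)

instance : Category GSpace where
  Hom := Hom
  id D := ⟨fun _ x => x, fun _ => continuous_id, fun _ _ => rfl⟩
  comp f g := ⟨fun l x => g.app l (f.app l x), fun l => (g.continuous l).comp (f.continuous l),
    fun φ x => by rw [f.naturality, g.naturality]⟩

variable {D E F H D' E' : GSpace}

@[ext] theorem hom_ext {f g : D ⟶ E} (h : ∀ l x, f.app l x = g.app l x) : f = g :=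
  Hom.ext (funext fun l => funext (h l))

@[simp] theorem id_app (l : Len) (x : D.obj l) : Hom.app (𝟙 D) l x = x := rfl
@[simp] theorem comp_app (f : D ⟶ E) (g : E ⟶ F) (l : Len) (x : D.obj l) :
    Hom.app (f ≫ g) l x = g.app l (f.app l x) := rfl

theorem act_act (D : GSpace) {a b c : Len} (ψ : Rep b c) (φ : Rep a b) (x : D.obj c) :
    D.act φ (D.act ψ x) = D.act (ψ.comp φ) x := (D.act_comp _ _ _).symm

theorem act_dcont_right (D : GSpace) {a b : Len} (φ : Rep a b) : DCont (D.act φ) :=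
  (D.act_dcont a b).comp' (DCont.mk (f := fun x => (φ, x)) (by fun_prop))

theorem Hom.dcont (f : D ⟶ E) (l : Len) : DCont (f.app l) := DCont.mk (f.continuous l)

/-- The `𝒢`-space `𝒢(-, l) × U`. -/
def free (l : Len) (U : Type) [TopologicalSpace U] : GSpace where
  obj a := KD (Rep a l × U)
  top _ := inferInstance
  dgen _ := inferInstance
  act φ x := KD.mk (x.val.1.comp φ, x.val.2)
  act_id _ := rfl
  act_comp _ _ _ := rfl
  act_dcont a b := by
    have hv : DCont fun p : Rep a b × KD (Rep b l × U) => p.2.val :=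
      KD.val_dcont.comp' (DCont.mk continuous_snd)
    exact KD.mk_dcont.comp'
      ((Rep.dcont_comp.comp' (hv.fst.prodMk (DCont.mk continuous_fst))).prodMk hv.snd)

/-! #### The tensor product -/

/-- Representatives of the points of the coend `∫^(a, b) 𝒢(l, a + b) × D(a) × E(b)`. -/
abbrev TPre (D E : GSpace) (l : Len) : Type :=
  Σ p : Len × Len, Rep l (p.1 + p.2) × D.obj p.1 × E.obj p.2

/-- The identifications defining the coend. -/
inductive TRel (D E : GSpace) (l : Len) : TPre D E l → TPre D E l → Prop
  | mk {a b a' b' : Len} (φ : Rep l (a + b)) (α : Rep a a') (β : Rep b b') (x : D.obj a')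
      (y : E.obj b') :
      TRel D E l ⟨(a, b), φ, D.act α x, E.act β y⟩ ⟨(a', b'), (α.sum β).comp φ, x, y⟩

/-- The underlying set of the coend. -/
def TObj (D E : GSpace) (l : Len) : Type := Quot (TRel D E l)

/-- The point of the coend represented by `(φ, x, y)`. -/
def TObj.mk {l : Len} (p : Len × Len) (z : Rep l (p.1 + p.2) × D.obj p.1 × E.obj p.2) :
    TObj D E l := Quot.mk _ ⟨p, z⟩

/-- The final topology for the maps from the spaces `𝒢(l, a + b) × D(a) × E(b)`. -/
instance TObj.top (D E : GSpace) (l : Len) : TopologicalSpace (TObj D E l) :=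
  ⨆ p : Len × Len, TopologicalSpace.coinduced (fun z : KD _ => TObj.mk p z.val) inferInstance

instance TObj.dgen (D E : GSpace) (l : Len) : DeltaGeneratedSpace (TObj D E l) :=
  IsGeneratedBy.iSup fun _ => IsGeneratedBy.coinduced _

theorem TObj.mk_dcont {l : Len} (p : Len × Len) :
    DCont (TObj.mk (D := D) (E := E) (l := l) p) := by
  have h : Continuous fun z : KD (Rep l (p.1 + p.2) × D.obj p.1 × E.obj p.2) =>
      TObj.mk (D := D) (E := E) (l := l) p z.val :=
    continuous_iff_coinduced_le.2 (le_iSup (fun p : Len × Len => TopologicalSpace.coinduced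
      (fun z : KD (Rep l (p.1 + p.2) × D.obj p.1 × E.obj p.2) => TObj.mk p z.val) inferInstance) p)
  exact (DCont.mk h).comp' KD.mk_dcont

theorem TObj.continuous_dom {l : Len} {Y : Type} [TopologicalSpace Y] {f : TObj D E l → Y}
    (h : ∀ p, DCont fun z => f (TObj.mk p z)) : Continuous f :=
  continuous_iSup_dom.2 fun p => continuous_coinduced_dom.2
    (DCont.continuous ((h p).comp' KD.val_dcont))

theorem TObj.prod_dcont {l : Len} {Y Z : Type} [TopologicalSpace Y] [TopologicalSpace Z]
    {f : Z → TObj D E l → Y}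
    (h : ∀ p, DCont fun w : Z × Rep l (p.1 + p.2) × D.obj p.1 × E.obj p.2 =>
      f w.1 (TObj.mk p w.2)) : DCont fun w : Z × TObj D E l => f w.1 w.2 := by
  refine DCont.prod_final (q := fun (p : Len × Len)
    (z : KD (Rep l (p.1 + p.2) × D.obj p.1 × E.obj p.2)) => TObj.mk p z.val) rfl ?_ fun p => ?_
  · intro y
    obtain ⟨⟨p, z⟩, rfl⟩ := Quot.exists_rep y
    exact ⟨p, KD.mk z, rfl⟩
  · exact (h p).comp' ((DCont.mk continuous_fst).prodMk
      (KD.val_dcont.comp' (DCont.mk continuous_snd)))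

/-- The action of `𝒢` on the coend. -/
def TObj.act {a b : Len} (φ : Rep a b) : TObj D E b → TObj D E a :=
  Quot.lift (fun z => TObj.mk z.1 (z.2.1.comp φ, z.2.2)) (by
    rintro _ _ ⟨ψ, α, β, x, y⟩
    exact Quot.sound (TRel.mk (ψ.comp φ) α β x y))

theorem TObj.act_dcont (a b : Len) :
    DCont fun p : Rep a b × TObj D E b => TObj.act p.1 p.2 := by
  refine TObj.prod_dcont fun p => ?_
  exact (TObj.mk_dcont p).comp' ((Rep.dcont_comp.comp' (DCont.mk (f := fun w :
    Rep a b × Rep b (p.1 + p.2) × D.obj p.1 × E.obj p.2 => (w.2.1, w.1)) (by fun_prop))).prodMk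
    (DCont.mk (continuous_snd.comp continuous_snd)))

/-- The tensor product `D ⊗ E`, the coend `∫^(a, b) 𝒢(-, a + b) × D(a) × E(b)`. -/
def tensor (D E : GSpace) : GSpace where
  obj := TObj D E
  top := TObj.top D E
  dgen := TObj.dgen D E
  act := TObj.act
  act_id x := by
    obtain ⟨z, rfl⟩ := Quot.exists_rep x
    rfl
  act_comp ψ φ x := by
    obtain ⟨z, rfl⟩ := Quot.exists_rep x
    rfl
  act_dcont := TObj.act_dcont

/-- The point `x ⊗ y` of `D ⊗ E`, represented by the identity of `a + b`. -/
def tmk {a b : Len} (x : D.obj a) (y : E.obj b) : (tensor D E).obj (a + b) :=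
  TObj.mk (a, b) (Rep.id _, x, y)

theorem tmk_act {a b a' b' : Len} (α : Rep a a') (β : Rep b b') (x : D.obj a') (y : E.obj b') :
    tmk (D.act α x) (E.act β y) = (tensor D E).act (α.sum β) (tmk x y) :=
  Quot.sound (TRel.mk (Rep.id _) α β x y)

theorem tensor_ind {l : Len} (u : (tensor D E).obj l) :
    ∃ (a b : Len) (φ : Rep l (a + b)) (x : D.obj a) (y : E.obj b),
      u = (tensor D E).act φ (tmk x y) := by
  obtain ⟨⟨p, φ, x, y⟩, rfl⟩ := Quot.exists_rep u
  exact ⟨p.1, p.2, φ, x, y, rfl⟩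

theorem tmk_dcont (a b : Len) : DCont fun p : D.obj a × E.obj b => tmk p.1 p.2 :=
  (TObj.mk_dcont (a, b)).comp' (DCont.mk (f := fun p : D.obj a × E.obj b => (Rep.id _, p.1, p.2))
    (by fun_prop))

theorem tensor_hom_ext {f g : tensor D E ⟶ F}
    (h : ∀ (a b : Len) (x : D.obj a) (y : E.obj b),
      f.app _ (tmk x y) = g.app _ (tmk x y)) : f = g := by
  ext l u
  obtain ⟨a, b, φ, x, y, rfl⟩ := tensor_ind u
  rw [f.naturality, g.naturality, h]

/-- Families of maps `D(a) × E(b) → F(a + b)` that correspond to the maps `D ⊗ E ⟶ F`. -/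
structure Bil (D E F : GSpace) where
  fn : ∀ {a b : Len}, D.obj a → E.obj b → F.obj (a + b)
  dcont : ∀ a b : Len, DCont fun p : D.obj a × E.obj b => fn p.1 p.2
  map_act : ∀ {a b a' b' : Len} (α : Rep a a') (β : Rep b b') (x : D.obj a') (y : E.obj b'),
    fn (D.act α x) (E.act β y) = F.act (α.sum β) (fn x y)

/-- The map out of `D ⊗ E` given by the universal property of the coend. -/
def lift (t : Bil D E F) : tensor D E ⟶ F where
  app l := Quot.lift (fun z => F.act z.2.1 (t.fn z.2.2.1 z.2.2.2)) (by
    rintro _ _ ⟨φ, α, β, x, y⟩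
    dsimp only
    rw [t.map_act, F.act_act])
  continuous l := TObj.continuous_dom fun p => (F.act_dcont l (p.1 + p.2)).comp'
    ((DCont.mk (f := fun z : Rep l (p.1 + p.2) × D.obj p.1 × E.obj p.2 => z.1)
      (by fun_prop)).prodMk ((t.dcont p.1 p.2).comp' (DCont.mk continuous_snd)))
  naturality φ u := by
    obtain ⟨z, rfl⟩ := Quot.exists_rep u
    exact F.act_comp _ _ _

@[simp] theorem lift_tmk (t : Bil D E F) {a b : Len} (x : D.obj a) (y : E.obj b) :
    (lift t).app _ (tmk x y) = t.fn x y := F.act_id _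

/-- The functoriality of the tensor product. -/
def tensorMap (f : D ⟶ D') (g : E ⟶ E') : tensor D E ⟶ tensor D' E' :=
  lift
    { fn := fun x y => tmk (f.app _ x) (g.app _ y)
      dcont := fun a b => (tmk_dcont a b).comp' (((f.dcont a).comp' (DCont.mk (by fun_prop))).prodMk
        ((g.dcont b).comp' (DCont.mk (by fun_prop))))
      map_act := fun α β x y => by rw [f.naturality, g.naturality, tmk_act] }

@[simp] theorem tensorMap_tmk (f : D ⟶ D') (g : E ⟶ E') {a b : Len} (x : D.obj a) (y : E.obj b) :
    (tensorMap f g).app _ (tmk x y) = tmk (f.app _ x) (g.app _ y) := lift_tmk _ _ _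

theorem tensorMap_comp {D'' E'' : GSpace} (f : D ⟶ D') (g : E ⟶ E') (f' : D' ⟶ D'')
    (g' : E' ⟶ E'') : tensorMap (f ≫ f') (g ≫ g') = tensorMap f g ≫ tensorMap f' g' :=
  tensor_hom_ext fun a b x y => by simp

theorem tensorMap_id : tensorMap (𝟙 D) (𝟙 E) = 𝟙 (tensor D E) :=
  tensor_hom_ext fun a b x y => by simp

section trilinear

/-- Families of maps `D(a) × E(b) × F(c) → H(a + b + c)` that correspond to the maps
`(D ⊗ E) ⊗ F ⟶ H`. -/
structure TriL (D E F H : GSpace) where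
  fn : ∀ {a b c : Len}, D.obj a → E.obj b → F.obj c → H.obj (a + b + c)
  dcont : ∀ a b c : Len, DCont fun p : D.obj a × E.obj b × F.obj c => fn p.1 p.2.1 p.2.2
  map_act : ∀ {a b c a' b' c' : Len} (α : Rep a a') (β : Rep b b') (χ : Rep c c') (x : D.obj a')
    (y : E.obj b') (z : F.obj c'), fn (D.act α x) (E.act β y) (F.act χ z) =
      H.act ((α.sum β).sum χ) (fn x y z)

def TriL.ext (t : TriL D E F H) {l c : Len} (z : F.obj c) : TObj D E l → H.obj (l + c) :=
  Quot.lift (fun w => H.act (w.2.1.sum (Rep.id c)) (t.fn w.2.2.1 w.2.2.2 z)) (by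
    rintro _ _ ⟨φ, α, β, x, y⟩
    dsimp only
    have := t.map_act α β (Rep.id c) x y z
    rw [F.act_id] at this
    rw [this, H.act_act, ← Rep.sum_comp, Rep.id_comp])

theorem TriL.ext_dcont (t : TriL D E F H) (l c : Len) :
    DCont fun w : F.obj c × TObj D E l => t.ext w.1 w.2 := by
  refine TObj.prod_dcont fun p => ?_
  refine (H.act_dcont (l + c) (p.1 + p.2 + c)).comp' (DCont.prodMk ?_ ?_)
  · exact Rep.dcont_sum.comp' (DCont.mk (f := fun w : F.obj c ×
      Rep l (p.1 + p.2) × D.obj p.1 × E.obj p.2 => (w.2.1, Rep.id c)) (by fun_prop))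
  · exact (t.dcont p.1 p.2 c).comp' (DCont.mk (f := fun w : F.obj c ×
      Rep l (p.1 + p.2) × D.obj p.1 × E.obj p.2 => (w.2.2.1, w.2.2.2, w.1)) (by fun_prop))

/-- Maps out of `(D ⊗ E) ⊗ F`. -/
def liftL (t : TriL D E F H) : tensor (tensor D E) F ⟶ H :=
  lift
    { fn := fun u z => t.ext z u
      dcont := fun l c => (t.ext_dcont l c).comp' (DCont.mk continuous_swap)
      map_act := fun {l c l' c'} θ χ u z => by
        obtain ⟨⟨p, φ, x, y⟩, rfl⟩ := Quot.exists_rep u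
        show H.act ((φ.comp θ).sum (Rep.id c)) (t.fn x y (F.act χ z)) =
          H.act (θ.sum χ) (H.act (φ.sum (Rep.id c')) (t.fn x y z))
        have := t.map_act (Rep.id p.1) (Rep.id p.2) χ x y z
        rw [D.act_id, E.act_id, Rep.sum_id] at this
        rw [this, H.act_act, H.act_act, ← Rep.sum_comp, ← Rep.sum_comp]
        rfl }

@[simp] theorem liftL_tmk (t : TriL D E F H) {a b c : Len} (x : D.obj a) (y : E.obj b)
    (z : F.obj c) : (liftL t).app _ (tmk (tmk x y) z) = t.fn x y z := by
  refine (lift_tmk _ _ _).trans ?_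
  show H.act ((Rep.id (a + b)).sum (Rep.id c)) (t.fn x y z) = _
  rw [Rep.sum_id, H.act_id]

/-- Families of maps `D(a) × E(b) × F(c) → H(a + (b + c))` that correspond to the maps
`D ⊗ (E ⊗ F) ⟶ H`. -/
structure TriR (D E F H : GSpace) where
  fn : ∀ {a b c : Len}, D.obj a → E.obj b → F.obj c → H.obj (a + (b + c))
  dcont : ∀ a b c : Len, DCont fun p : D.obj a × E.obj b × F.obj c => fn p.1 p.2.1 p.2.2
  map_act : ∀ {a b c a' b' c' : Len} (α : Rep a a') (β : Rep b b') (χ : Rep c c') (x : D.obj a')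
    (y : E.obj b') (z : F.obj c'), fn (D.act α x) (E.act β y) (F.act χ z) =
      H.act (α.sum (β.sum χ)) (fn x y z)

def TriR.ext (t : TriR D E F H) {a l : Len} (x : D.obj a) : TObj E F l → H.obj (a + l) :=
  Quot.lift (fun w => H.act ((Rep.id a).sum w.2.1) (t.fn x w.2.2.1 w.2.2.2)) (by
    rintro _ _ ⟨φ, α, β, y, z⟩
    dsimp only
    have := t.map_act (Rep.id a) α β x y z
    rw [D.act_id] at this
    rw [this, H.act_act, ← Rep.sum_comp, Rep.id_comp])

theorem TriR.ext_dcont (t : TriR D E F H) (a l : Len) :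
    DCont fun w : D.obj a × TObj E F l => t.ext w.1 w.2 := by
  refine TObj.prod_dcont fun p => ?_
  refine (H.act_dcont (a + l) (a + (p.1 + p.2))).comp' (DCont.prodMk ?_ ?_)
  · exact Rep.dcont_sum.comp' (DCont.mk (f := fun w : D.obj a ×
      Rep l (p.1 + p.2) × E.obj p.1 × F.obj p.2 => (Rep.id a, w.2.1)) (by fun_prop))
  · exact (t.dcont a p.1 p.2).comp' (DCont.mk (f := fun w : D.obj a ×
      Rep l (p.1 + p.2) × E.obj p.1 × F.obj p.2 => (w.1, w.2.2.1, w.2.2.2)) (by fun_prop))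

/-- Maps out of `D ⊗ (E ⊗ F)`. -/
def liftR (t : TriR D E F H) : tensor D (tensor E F) ⟶ H :=
  lift
    { fn := fun x u => t.ext x u
      dcont := fun a l => t.ext_dcont a l
      map_act := fun {a l a' l'} α θ x u => by
        obtain ⟨⟨p, φ, y, z⟩, rfl⟩ := Quot.exists_rep u
        show H.act ((Rep.id a).sum (φ.comp θ)) (t.fn (D.act α x) y z) =
          H.act (α.sum θ) (H.act ((Rep.id a').sum φ) (t.fn x y z))
        have := t.map_act α (Rep.id p.1) (Rep.id p.2) x y z
        rw [E.act_id, F.act_id, Rep.sum_id] at this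
        rw [this, H.act_act, H.act_act, ← Rep.sum_comp, ← Rep.sum_comp]
        rfl }

@[simp] theorem liftR_tmk (t : TriR D E F H) {a b c : Len} (x : D.obj a) (y : E.obj b)
    (z : F.obj c) : (liftR t).app _ (tmk x (tmk y z)) = t.fn x y z := by
  refine (lift_tmk _ _ _).trans ?_
  show H.act ((Rep.id a).sum (Rep.id (b + c))) (t.fn x y z) = _
  rw [Rep.sum_id, H.act_id]

end trilinear

theorem tensorL_hom_ext {f g : tensor (tensor D E) F ⟶ H}
    (h : ∀ (a b c : Len) (x : D.obj a) (y : E.obj b) (z : F.obj c),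
      f.app _ (tmk (tmk x y) z) = g.app _ (tmk (tmk x y) z)) : f = g := by
  refine tensor_hom_ext fun l c u z => ?_
  obtain ⟨a, b, φ, x, y, rfl⟩ := tensor_ind u
  rw [← F.act_id z, tmk_act, f.naturality, g.naturality, h]

theorem tensorR_hom_ext {f g : tensor D (tensor E F) ⟶ H}
    (h : ∀ (a b c : Len) (x : D.obj a) (y : E.obj b) (z : F.obj c),
      f.app _ (tmk x (tmk y z)) = g.app _ (tmk x (tmk y z))) : f = g := by
  refine tensor_hom_ext fun a l x u => ?_
  obtain ⟨b, c, φ, y, z, rfl⟩ := tensor_ind u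
  rw [← D.act_id x, tmk_act, f.naturality, g.naturality, h]

/-- The associator of the semimonoidal category of `𝒢`-spaces. -/
def assoc (D E F : GSpace) : tensor (tensor D E) F ≅ tensor D (tensor E F) where
  hom := liftL
    { fn := fun x y z => (tensor D (tensor E F)).act (Rep.assoc _ _ _) (tmk x (tmk y z))
      dcont := fun a b c => (GSpace.act_dcont_right _ _).comp' ((tmk_dcont _ _).comp'
        ((DCont.mk continuous_fst).prodMk ((tmk_dcont _ _).comp' (DCont.mk continuous_snd))))
      map_act := fun α β χ x y z => by
        rw [tmk_act, tmk_act, act_act, act_act, Rep.assoc_sum] }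
  inv := liftR
    { fn := fun x y z => (tensor (tensor D E) F).act (Rep.assoc' _ _ _) (tmk (tmk x y) z)
      dcont := fun a b c => (GSpace.act_dcont_right _ _).comp' ((tmk_dcont _ _).comp' (DCont.prodMk
        ((tmk_dcont _ _).comp' (DCont.mk (f := fun p : D.obj a × E.obj b × F.obj c => (p.1, p.2.1))
          (by fun_prop))) (DCont.mk (by fun_prop))))
      map_act := fun α β χ x y z => by
        rw [tmk_act, tmk_act, act_act, act_act, Rep.assoc'_sum] }
  hom_inv_id := tensorL_hom_ext fun a b c x y z => by
    rw [comp_app, liftL_tmk, Hom.naturality, liftR_tmk, act_act, Rep.assoc'_assoc, act_id, id_app]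
  inv_hom_id := tensorR_hom_ext fun a b c x y z => by
    rw [comp_app, liftR_tmk, Hom.naturality, liftL_tmk, act_act, Rep.assoc_assoc', act_id, id_app]

@[simp] theorem assoc_hom_tmk {a b c : Len} (x : D.obj a) (y : E.obj b) (z : F.obj c) :
    (assoc D E F).hom.app _ (tmk (tmk x y) z) =
      (tensor D (tensor E F)).act (Rep.assoc _ _ _) (tmk x (tmk y z)) := liftL_tmk _ _ _ _

@[simp] theorem assoc_inv_tmk {a b c : Len} (x : D.obj a) (y : E.obj b) (z : F.obj c) :
    (assoc D E F).inv.app _ (tmk x (tmk y z)) =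
      (tensor (tensor D E) F).act (Rep.assoc' _ _ _) (tmk (tmk x y) z) := liftR_tmk _ _ _ _

/-! #### Colimits, which are computed objectwise -/

section colimits

variable {J : Type} [SmallCategory J] (Φ : J ⥤ GSpace)

/-- The underlying set of the colimit. -/
def CObj (l : Len) : Type :=
  Quot fun x y : Σ j, (Φ.obj j).obj l => ∃ f : x.1 ⟶ y.1, y.2 = (Φ.map f).app l x.2

variable {Φ} in
def CObj.mk {l : Len} (j : J) (x : (Φ.obj j).obj l) : CObj Φ l := Quot.mk _ ⟨j, x⟩

/-- The final topology. -/
instance CObj.top (l : Len) : TopologicalSpace (CObj Φ l) :=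
  ⨆ j : J, TopologicalSpace.coinduced (CObj.mk j) inferInstance

variable {Φ} in
theorem CObj.mk_continuous {l : Len} (j : J) : Continuous (CObj.mk (Φ := Φ) (l := l) j) :=
  continuous_iSup_rng (i := j) continuous_coinduced_rng

variable {Φ} in
theorem CObj.prod_dcont {l : Len} {Y Z : Type} [TopologicalSpace Y] [TopologicalSpace Z]
    {f : Z → CObj Φ l → Y} (h : ∀ j, DCont fun w : Z × (Φ.obj j).obj l => f w.1 (CObj.mk j w.2)) :
    DCont fun w : Z × CObj Φ l => f w.1 w.2 :=
  DCont.prod_final rfl (fun y => by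
    obtain ⟨⟨j, x⟩, rfl⟩ := Quot.exists_rep y
    exact ⟨j, x, rfl⟩) h

variable {Φ} in
def CObj.act {a b : Len} (φ : Rep a b) : CObj Φ b → CObj Φ a :=
  Quot.lift (fun x => CObj.mk x.1 ((Φ.obj x.1).act φ x.2)) (by
    rintro ⟨i, x⟩ ⟨j, y⟩ ⟨f, h⟩
    dsimp only at f h
    subst h
    exact Quot.sound ⟨f, ((Φ.map f).naturality _ _).symm⟩)

variable {Φ} in
theorem CObj.act_dcont (a b : Len) : DCont fun p : Rep a b × CObj Φ b => CObj.act p.1 p.2 :=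
  CObj.prod_dcont fun j => (DCont.mk (CObj.mk_continuous j)).comp' (GSpace.act_dcont _ a b)

/-- The colimit of a small diagram of `𝒢`-spaces. -/
def colim : GSpace where
  obj := CObj Φ
  top := CObj.top Φ
  dgen l := IsGeneratedBy.iSup fun j => IsGeneratedBy.coinduced _
  act := CObj.act
  act_id x := by
    obtain ⟨x, rfl⟩ := Quot.exists_rep x
    exact congrArg (CObj.mk x.1) (GSpace.act_id _ _)
  act_comp ψ φ x := by
    obtain ⟨x, rfl⟩ := Quot.exists_rep x
    exact congrArg (CObj.mk x.1) (GSpace.act_comp _ _ _ _)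
  act_dcont := CObj.act_dcont

/-- The canonical cocone. -/
def colimCocone : Limits.Cocone Φ where
  pt := colim Φ
  ι := 
    { app := fun j => Hom.mk (fun _ => CObj.mk j) (fun _ => CObj.mk_continuous j) fun _ _ => rfl
      naturality := fun i j f => by
        ext l x
        exact (Quot.sound ⟨f, rfl⟩).symm }

/-- It is a colimit cocone. -/
def colimIsColimit : Limits.IsColimit (colimCocone Φ) where
  desc s :=
    { app := fun l => Quot.lift (fun x => (s.ι.app x.1).app l x.2) (by
        rintro ⟨i, x⟩ ⟨j, y⟩ ⟨f, h⟩
        dsimp only at f h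
        subst h
        exact (congrArg (fun g => Hom.app g l x) (s.w f)).symm)
      continuous := fun l => continuous_iSup_dom.2 fun j => continuous_coinduced_dom.2
        ((s.ι.app j).continuous l)
      naturality := fun φ x => by
        obtain ⟨x, rfl⟩ := Quot.exists_rep x
        exact (s.ι.app x.1).naturality _ _ }
  fac s j := rfl
  uniq s m hm := by
    ext l x
    obtain ⟨x, rfl⟩ := Quot.exists_rep x
    exact congrArg (fun g => Hom.app g l x.2) (hm x.1)

end colimits

theorem sigma_dcont {ι : Type} {D : ι → GSpace} {l : Len} {Y Z : Type} [TopologicalSpace Y]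
    [TopologicalSpace Z] {f : Z → (Σ i, (D i).obj l) → Y}
    (h : ∀ i, DCont fun w : Z × (D i).obj l => f w.1 ⟨i, w.2⟩) :
    DCont fun w : Z × (Σ i, (D i).obj l) => f w.1 w.2 :=
  DCont.prod_final (q := fun i (x : (D i).obj l) => Sigma.mk i x) rfl (fun y => ⟨y.1, y.2, rfl⟩) h

/-- The coproduct of a family of `𝒢`-spaces. -/
def sigma {ι : Type} (D : ι → GSpace) : GSpace where
  obj l := Σ i, (D i).obj l
  top _ := inferInstance
  dgen _ := inferInstance
  act φ x := ⟨x.1, (D x.1).act φ x.2⟩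
  act_id x := congrArg (Sigma.mk x.1) ((D x.1).act_id x.2)
  act_comp ψ φ x := congrArg (Sigma.mk x.1) ((D x.1).act_comp ψ φ x.2)
  act_dcont a b := sigma_dcont (f := fun φ x => (⟨x.1, (D x.1).act φ x.2⟩ : Σ i, (D i).obj a))
    fun i => (DCont.mk continuous_sigmaMk).comp' ((D i).act_dcont a b)

end GSpace

/-! ### Moore flows -/

open GSpace in
/-- A Moore flow: a small semicategory enriched over `𝒢`-spaces with their tensor product. -/
structure MooreFlow : Type 1 where
  state : Type
  P : state → state → GSpace
  comp : ∀ α β γ, tensor (P α β) (P β γ) ⟶ P α γ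
  assoc : ∀ α β γ δ, tensorMap (comp α β γ) (𝟙 (P γ δ)) ≫ comp α γ δ =
    (GSpace.assoc _ _ _).hom ≫ tensorMap (𝟙 (P α β)) (comp β γ δ) ≫ comp α β δ

namespace MooreFlow

open GSpace

/-- Maps of Moore flows. -/
structure Hom (X Y : MooreFlow) : Type where
  st : X.state → Y.state
  P : ∀ α β, X.P α β ⟶ Y.P (st α) (st β)
  map_comp : ∀ α β γ, X.comp α β γ ≫ P α γ = tensorMap (P α β) (P β γ) ≫ Y.comp _ _ _

instance : Category MooreFlow where
  Hom := Hom
  id X := ⟨fun α => α, fun _ _ => 𝟙 _, fun _ _ _ => by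
    rw [tensorMap_id, Category.id_comp, Category.comp_id]⟩
  comp f g := ⟨fun α => g.st (f.st α), fun α β => f.P α β ≫ g.P _ _, fun α β γ => by
    rw [← Category.assoc, f.map_comp, Category.assoc, g.map_comp, ← Category.assoc,
      ← tensorMap_comp]⟩

end MooreFlow

/-! ### Spaces of paths -/

section paths

variable {X : Type} [TopologicalSpace X] {a b : Len}

/-- A family of paths is continuous for the kelleyfied compact-open topology iff it is jointly
continuous on plots. -/
theorem path_continuous_iff {p : C(Itv a, X) → Prop} {n : ℕ}
    {f : Eucl n → KD {γ : C(Itv a, X) // p γ}} :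
    Continuous f ↔ Continuous fun w : Eucl n × Itv a => (f w.1).val.1 w.2 := by
  constructor
  · intro h
    have h1 : Continuous fun x => (f x).val :=
      KD.val_dcont.comp' (DCont.mk h) (ContinuousMap.id _)
    exact ContinuousMap.continuous_uncurry_of_continuous ⟨_, continuous_subtype_val.comp h1⟩
  · intro h
    have h1 : Continuous fun x => (f x).val :=
      continuous_induced_rng.2 (ContinuousMap.curry ⟨_, h⟩).continuous
    exact KD.mk_dcont.comp' (DCont.mk h1) (ContinuousMap.id _)

/-- The Moore composition of two paths. -/
def mooreComp (γ : C(Itv a, X)) (γ' : C(Itv b, X)) (h : γ (Itv.top a) = γ' (Itv.bot b)) :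
    C(Itv (a + b), X) :=
  ⟨glue γ γ', (glue_continuous (P := Unit) (f := fun _ => γ) (g := fun _ => γ') (fun _ => h)
    (γ.continuous.comp continuous_snd) (γ'.continuous.comp continuous_snd)).comp
      (continuous_const.prodMk continuous_id : Continuous fun t => ((), t))⟩

/-- The homeomorphism `μ_l : [0, l] → [0, 1]`, `t ↦ t / l`. -/
def mu (l : Len) : Rep l 1 :=
  ⟨StrictMono.orderIsoOfRightInverse
    (fun t => (⟨t.1 / l.1, div_nonneg t.2.1 l.2.le, (div_le_one l.2).2 t.2.2⟩ : Itv 1))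
    (fun s t h => div_lt_div_of_pos_right (show s.1 < t.1 from h) l.2)
    (fun t => ⟨t.1 * l.1, mul_nonneg t.2.1 l.2.le, mul_le_of_le_one_left l.2.le t.2.2⟩)
    (fun t => Subtype.ext (mul_div_cancel_right₀ t.1 l.2.ne'))⟩

/-- The normalized composition: it is `γ (2 t)` for `t ≤ 1 / 2` and `γ' (2 t - 1)` for
`t ≥ 1 / 2`. -/
def normComp (γ γ' : C(Itv 1, X)) (h : γ (Itv.top 1) = γ' (Itv.bot 1)) : C(Itv 1, X) :=
  (mooreComp γ γ' h).comp (mu (1 + 1)).symm.toCM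

end paths

/-! ### Multipointed `d`-spaces -/

/-- A multipointed `d`-space. -/
structure MdSpace : Type 1 where
  carrier : Type
  [top : TopologicalSpace carrier]
  [dgen : DeltaGeneratedSpace carrier]
  state : Set carrier
  /-- the execution paths -/
  path : Set C(Itv 1, carrier)
  path_bot : ∀ γ ∈ path, γ (Itv.bot 1) ∈ state
  path_top : ∀ γ ∈ path, γ (Itv.top 1) ∈ state
  path_rep : ∀ γ ∈ path, ∀ φ : Rep 1 1, γ.comp φ.toCM ∈ path
  path_comp : ∀ γ ∈ path, ∀ γ' ∈ path, ∀ h, normComp γ γ' h ∈ path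

attribute [instance] MdSpace.top MdSpace.dgen

namespace MdSpace

/-- Maps of multipointed `d`-spaces. -/
@[ext] structure Hom (X Y : MdSpace) : Type where
  fn : C(X.carrier, Y.carrier)
  map_state : ∀ x ∈ X.state, fn x ∈ Y.state
  map_path : ∀ γ ∈ X.path, fn.comp γ ∈ Y.path

instance : Category MdSpace where
  Hom := Hom
  id X := ⟨ContinuousMap.id _, fun _ h => h, fun _ h => h⟩
  comp f g := ⟨g.fn.comp f.fn, fun _ h => g.map_state _ (f.map_state _ h),
    fun _ h => g.map_path _ (f.map_path _ h)⟩

variable (X : MdSpace) {a b l : Len}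

/-- The paths of length `l` of the form `γ μ_l`, with `γ` an execution path. -/
def IsPath (γ : C(Itv l, X.carrier)) : Prop := γ.comp (mu l).symm.toCM ∈ X.path

variable {X}

theorem IsPath.rep {γ : C(Itv b, X.carrier)} (h : X.IsPath γ) (φ : Rep a b) :
    X.IsPath (γ.comp φ.toCM) := by
  have := X.path_rep _ h ((mu b).comp (φ.comp (mu a).symm))
  refine Set.mem_of_eq_of_mem (ContinuousMap.ext fun t => ?_) this
  show γ (φ ((mu a).symm t)) = γ ((mu b).symm (mu b (φ ((mu a).symm t))))
  rw [Rep.symm_apply]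

theorem IsPath.comp {γ : C(Itv a, X.carrier)} {γ' : C(Itv b, X.carrier)} (h : X.IsPath γ)
    (h' : X.IsPath γ') (hg : γ (Itv.top a) = γ' (Itv.bot b)) : X.IsPath (mooreComp γ γ' hg) := by
  have hc : (γ.comp (mu a).symm.toCM) (Itv.top 1) = (γ'.comp (mu b).symm.toCM) (Itv.bot 1) := by
    show γ ((mu a).symm (Itv.top 1)) = γ' ((mu b).symm (Itv.bot 1))
    rw [Rep.apply_top, Rep.apply_bot, hg]
  have := X.path_rep _ (X.path_comp _ h _ h' hc)
    ((mu (1 + 1)).comp (((mu a).sum (mu b)).comp (mu (a + b)).symm))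
  refine Set.mem_of_eq_of_mem (ContinuousMap.ext fun t => ?_) this
  show glue γ γ' ((mu (a + b)).symm t) = glue (γ.comp (mu a).symm.toCM) (γ'.comp (mu b).symm.toCM)
    ((mu (1 + 1)).symm (mu (1 + 1) ((mu a).sum (mu b) ((mu (a + b)).symm t))))
  rw [Rep.symm_apply]
  rcases Itv.cases ((mu (a + b)).symm t) with ⟨s, hs⟩ | ⟨s, hs⟩
  · rw [hs, Rep.sum_inl, glue_inl, glue_inl]
    exact congrArg γ ((mu a).symm_apply s).symm
  · rw [hs, Rep.sum_inr, glue_inr hg, glue_inr hc]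
    exact congrArg γ' ((mu b).symm_apply s).symm

variable (X) in
/-- The set of paths of length `l` from `α` to `β`. -/
abbrev MPath (α β : X.state) (l : Len) : Type :=
  {γ : C(Itv l, X.carrier) // X.IsPath γ ∧ γ (Itv.bot l) = α ∧ γ (Itv.top l) = β}

variable (X) in
/-- The `𝒢`-space of paths from `α` to `β`. -/
def pathSpace (α β : X.state) : GSpace where
  obj l := KD (X.MPath α β l)
  top _ := inferInstance
  dgen _ := inferInstance
  act φ γ := ⟨⟨γ.val.1.comp φ.toCM, γ.val.2.1.rep φ,
    (congrArg γ.val.1 φ.apply_bot).trans γ.val.2.2.1,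
    (congrArg γ.val.1 φ.apply_top).trans γ.val.2.2.2⟩⟩
  act_id _ := rfl
  act_comp _ _ _ := rfl
  act_dcont a b := by
    intro n p
    refine path_continuous_iff.2 ?_
    have h1 := Rep.continuous_iff.1 (continuous_fst.comp p.continuous)
    have h2 := path_continuous_iff.1 (continuous_snd.comp p.continuous)
    exact h2.comp (continuous_fst.prodMk h1)

variable (X) in
/-- The Moore composition `P^a(α, β) × P^b(β, γ) → P^(a + b)(α, γ)`. -/
def compBil (α β γ : X.state) :
    GSpace.Bil (X.pathSpace α β) (X.pathSpace β γ) (X.pathSpace α γ) where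
  fn x y := ⟨⟨mooreComp x.val.1 y.val.1 (x.val.2.2.2.trans y.val.2.2.1.symm),
    x.val.2.1.comp y.val.2.1 _, glue_bot.trans x.val.2.2.1,
    (glue_top (x.val.2.2.2.trans y.val.2.2.1.symm)).trans y.val.2.2.2⟩⟩
  dcont a b := by
    intro n p
    refine path_continuous_iff.2 ?_
    have h1 := path_continuous_iff.1 (continuous_fst.comp p.continuous)
    have h2 := path_continuous_iff.1 (continuous_snd.comp p.continuous)
    exact glue_continuous (f := fun z => (p z).1.val.1) (g := fun z => (p z).2.val.1)
      (fun z => (p z).1.val.2.2.2.trans (p z).2.val.2.2.1.symm) h1 h2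
  map_act {a b a' b'} φ ψ x y := by
    refine congrArg KD.mk (Subtype.ext (ContinuousMap.ext fun t => ?_))
    have h := x.val.2.2.2.trans y.val.2.2.1.symm
    show glue (fun s => x.val.1 (φ s)) (fun s => y.val.1 (ψ s)) t =
      glue x.val.1 y.val.1 (φ.sum ψ t)
    rcases Itv.cases t with ⟨s, rfl⟩ | ⟨s, rfl⟩
    · rw [Rep.sum_inl, glue_inl, glue_inl]
    · rw [Rep.sum_inr, glue_inr h, glue_inr]
      rw [φ.apply_top, ψ.apply_bot, h]

/-- The Moore flow `𝕄^𝒢(X)` of a multipointed `d`-space. -/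
def moore (X : MdSpace) : MooreFlow where
  state := X.state
  P := X.pathSpace
  comp α β γ := GSpace.lift (X.compBil α β γ)
  assoc α β γ δ := GSpace.tensorL_hom_ext fun a b c x y z => by
    simp only [GSpace.comp_app, GSpace.tensorMap_tmk, GSpace.lift_tmk, GSpace.assoc_hom_tmk,
      GSpace.Hom.naturality, GSpace.id_app]
    refine congrArg KD.mk (Subtype.ext (ContinuousMap.ext fun t => ?_))
    have h := x.val.2.2.2.trans y.val.2.2.1.symm
    have h' := y.val.2.2.2.trans z.val.2.2.1.symm
    show glue (glue x.val.1 y.val.1) z.val.1 t =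
      glue x.val.1 (glue y.val.1 z.val.1) (Rep.assoc a b c t)
    have h1 : glue x.val.1 y.val.1 (Itv.top (a + b)) = z.val.1 (Itv.bot c) :=
      (glue_top h).trans h'
    have h2 : x.val.1 (Itv.top a) = glue y.val.1 z.val.1 (Itv.bot (b + c)) := by
      rw [glue_bot, h]
    rcases Rep.assoc_aux t with ⟨s, rfl⟩ | ⟨s, rfl⟩ | ⟨s, rfl⟩
    · rw [Rep.assoc_ll, glue_inl, glue_inl, glue_inl]
    · rw [Rep.assoc_lr, glue_inl, glue_inr h, glue_inr h2, glue_inl]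
    · rw [Rep.assoc_r, glue_inr h1, glue_inr h2, glue_inr h']

/-- The functor `𝕄^𝒢` from multipointed `d`-spaces to Moore flows. -/
def mooreFunctor : MdSpace ⥤ MooreFlow where
  obj := moore
  map {X Y} f :=
    { st := fun x => ⟨f.fn x.1, f.map_state _ x.2⟩
      P := fun α β =>
        { app := fun l γ => ⟨⟨f.fn.comp γ.val.1, f.map_path _ γ.val.2.1,
            congrArg f.fn γ.val.2.2.1, congrArg f.fn γ.val.2.2.2⟩⟩
          continuous := fun l => by
            refine DCont.continuous fun n p => path_continuous_iff.2 ?_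
            exact f.fn.continuous.comp (path_continuous_iff.1 p.continuous)
          naturality := fun _ _ => rfl }
      map_comp := fun α β γ => GSpace.tensor_hom_ext fun a b x y => by
        simp only [GSpace.comp_app]
        erw [GSpace.tensorMap_tmk, GSpace.lift_tmk, GSpace.lift_tmk]
        exact congrArg KD.mk (Subtype.ext (ContinuousMap.ext fun t =>
          comp_glue (f := x.val.1) (g := y.val.1) f.fn t)) }

end MdSpace

/-! ### The box category and precubical sets -/

/-- Objects of the box category: `⟨n⟩` is `[n] = {0,1}ⁿ`. -/
structure Box : Type where
  dim : ℕ

/-- A map `[m] → [n]` of the box category, i.e. a composite of coface maps: every coordinate of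
the image is a constant or a coordinate of the argument, and each coordinate of the argument is
used, once and in increasing order. The coface map `δ_i^α` has constant `i`-th coordinate `α`. -/
@[ext] structure BoxHom (m n : ℕ) : Type where
  coord : Fin n → Bool ⊕ Fin m
  mono : ∀ i j k l, i < j → coord i = Sum.inr k → coord j = Sum.inr l → k < l
  surj : ∀ k, ∃ j, coord j = Sum.inr k

namespace BoxHom

variable {m n p : ℕ}

protected def id (n : ℕ) : BoxHom n n :=
  ⟨Sum.inr, by rintro i j k l h ⟨⟩ ⟨⟩; exact h, fun k => ⟨k, rfl⟩⟩

def comp (f : BoxHom m n) (g : BoxHom n p) : BoxHom m p where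
  coord j := Sum.elim Sum.inl f.coord (g.coord j)
  mono i j k l h hi hj := by
    rcases hgi : g.coord i with b | i'
    · simp [hgi] at hi
    rcases hgj : g.coord j with b | j'
    · simp [hgj] at hj
    rw [hgi] at hi
    rw [hgj] at hj
    exact f.mono _ _ _ _ (g.mono _ _ _ _ h hgi hgj) hi hj
  surj k := by
    obtain ⟨j, hj⟩ := f.surj k
    obtain ⟨i, hi⟩ := g.surj j
    exact ⟨i, by simp [hi, hj]⟩

/-- The action on `Xᵐ → Xⁿ`, for a set `X` with two points `c 0` and `c 1`. -/
def map {X : Type} (f : BoxHom m n) (c : Bool → X) (x : Fin m → X) (j : Fin n) : X :=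
  Sum.elim c x (f.coord j)

theorem map_id {X : Type} (c : Bool → X) (x : Fin n → X) : (BoxHom.id n).map c x = x := rfl

theorem map_comp {X : Type} (f : BoxHom m n) (g : BoxHom n p) (c : Bool → X) (x : Fin m → X) :
    (f.comp g).map c x = g.map c (f.map c x) := by
  funext j
  show Sum.elim c x (Sum.elim Sum.inl f.coord (g.coord j)) =
    Sum.elim c (fun i => Sum.elim c x (f.coord i)) (g.coord j)
  rcases g.coord j with b | i <;> rfl

end BoxHom

instance : SmallCategory Box where
  Hom m n := BoxHom m.dim n.dim
  id n := BoxHom.id n.dim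
  comp f g := f.comp g
  id_comp f := by
    refine BoxHom.ext (funext fun j => ?_)
    show Sum.elim Sum.inl Sum.inr (f.coord j) = f.coord j
    rcases f.coord j with b | i <;> rfl
  comp_id _ := rfl
  assoc f g h := by
    refine BoxHom.ext (funext fun j => ?_)
    show Sum.elim Sum.inl (fun j => Sum.elim Sum.inl f.coord (g.coord j)) (h.coord j) =
      Sum.elim Sum.inl f.coord (Sum.elim Sum.inl g.coord (h.coord j))
    rcases h.coord j with b | i <;> rfl

/-- The category of precubical sets. -/
abbrev PrecubicalSet : Type 1 := Boxᵒᵖ ⥤ Type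

/-- The `n`-cube `□[n]`. -/
abbrev cubeSet (n : ℕ) : PrecubicalSet := yoneda.obj (⟨n⟩ : Box)

/-! ### The regular cubes -/

/-- `[0,1]`. -/
abbrev I : Type := Set.Icc (0 : ℝ) 1

def bit (b : Bool) : I := if b then 1 else 0

/-- A path is regular when it is constant on no interval `[s, t]` with `s < t`. -/
def IsRegular {X : Type} {l : Len} (γ : Itv l → X) : Prop :=
  ∀ s t, s < t → ∃ r, s ≤ r ∧ r ≤ t ∧ γ r ≠ γ s

theorem isRegular_iff {X : Type} [PartialOrder X] {l : Len} {γ : Itv l → X} (h : Monotone γ) :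
    IsRegular γ ↔ StrictMono γ := by
  constructor
  · intro hr s t hst
    refine lt_of_le_of_ne (h hst.le) fun he => ?_
    obtain ⟨r, h1, h2, h3⟩ := hr s t hst
    exact h3 (le_antisymm ((h h2).trans he.ge) (h h1))
  · exact fun hs s t hst => ⟨t, hst.le, le_rfl, (hs hst).ne'⟩

/-- The vertices of `[0,1]ⁿ`. -/
def IsVertex {n : ℕ} (x : Fin n → I) : Prop := ∀ i, x i = 0 ∨ x i = 1

/-- The execution paths of the regular cube: the regular `d`-paths from `a` to `b`, for vertices
`a < b`. -/
def IsCubePath {n : ℕ} {l : Len} (γ : C(Itv l, Fin n → I)) : Prop :=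
  IsVertex (γ (Itv.bot l)) ∧ IsVertex (γ (Itv.top l)) ∧ γ (Itv.bot l) < γ (Itv.top l) ∧
    Monotone γ ∧ IsRegular γ

theorem isCubePath_iff {n : ℕ} {l : Len} {γ : C(Itv l, Fin n → I)} : IsCubePath γ ↔
    IsVertex (γ (Itv.bot l)) ∧ IsVertex (γ (Itv.top l)) ∧ StrictMono γ :=
  ⟨fun h => ⟨h.1, h.2.1, (isRegular_iff h.2.2.2.1).1 h.2.2.2.2⟩, fun h =>
    ⟨h.1, h.2.1, h.2.2 (show (0 : ℝ) < l.1 from l.2), h.2.2.monotone,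
      (isRegular_iff h.2.2.monotone).2 h.2.2⟩⟩

theorem IsCubePath.rep {n : ℕ} {a b : Len} {γ : C(Itv b, Fin n → I)} (h : IsCubePath γ)
    (φ : Rep a b) : IsCubePath (γ.comp φ.toCM) := by
  rw [isCubePath_iff] at h ⊢
  refine ⟨?_, ?_, h.2.2.comp φ.iso.strictMono⟩
  · exact (congrArg γ φ.apply_bot) ▸ h.1
  · exact (congrArg γ φ.apply_top) ▸ h.2.1

theorem IsCubePath.comp {n : ℕ} {a b : Len} {γ : C(Itv a, Fin n → I)} {γ' : C(Itv b, Fin n → I)}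
    (h : IsCubePath γ) (h' : IsCubePath γ') (hg : γ (Itv.top a) = γ' (Itv.bot b)) :
    IsCubePath (mooreComp γ γ' hg) := by
  rw [isCubePath_iff] at h h' ⊢
  refine ⟨?_, ?_, glue_strictMono hg h.2.2 h'.2.2⟩
  · show IsVertex (glue γ γ' (Itv.bot _))
    rw [glue_bot]
    exact h.1
  · show IsVertex (glue γ γ' (Itv.top _))
    rw [glue_top hg]
    exact h'.2.1

instance (n : ℕ) : DeltaGeneratedSpace (Fin n → I) :=
  (IsQuotientMap.of_inverse (f := fun (x : Fin n → I) i => (x i : ℝ))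
    (g := fun (x : Eucl n) i => Set.projIcc (0 : ℝ) 1 zero_le_one (x i)) (by fun_prop)
    (continuous_pi fun i => continuous_projIcc.comp (continuous_apply i))
    (fun x => funext fun i => Set.projIcc_val _ _)).isGeneratedBy

/-- The regular `n`-cube `|□[n]|ᵗ_reg`. -/
def regCube (n : ℕ) : MdSpace where
  carrier := Fin n → I
  state := {x | IsVertex x}
  path := {γ | IsCubePath γ}
  path_bot _ h := h.1
  path_top _ h := h.2.1
  path_rep _ h φ := h.rep φ
  path_comp _ h _ h' hg := (h.comp h' hg).rep _

section cubeMap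

variable {m n p : ℕ}

/-- The continuous map `[0,1]ᵐ → [0,1]ⁿ` associated with a map of the box category. -/
def cubeMap (f : BoxHom m n) : C(Fin m → I, Fin n → I) :=
  ⟨f.map bit, continuous_pi fun j => by
    unfold BoxHom.map
    rcases f.coord j with b | i
    · exact continuous_const
    · exact continuous_apply i⟩

theorem cubeMap_strictMono (f : BoxHom m n) : StrictMono (cubeMap f) := by
  refine Monotone.strictMono_of_injective (fun x y h j => ?_) fun x y h => funext fun k => ?_
  · show Sum.elim bit x (f.coord j) ≤ Sum.elim bit y (f.coord j)
    rcases f.coord j with b | i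
    · exact le_rfl
    · exact h i
  · obtain ⟨j, hj⟩ := f.surj k
    have : Sum.elim bit x (f.coord j) = Sum.elim bit y (f.coord j) := congrFun h j
    rwa [hj] at this

theorem cubeMap_vertex (f : BoxHom m n) {x : Fin m → I} (h : IsVertex x) :
    IsVertex (cubeMap f x) := by
  intro j
  show Sum.elim bit x (f.coord j) = 0 ∨ Sum.elim bit x (f.coord j) = 1
  rcases f.coord j with b | i
  · cases b
    · exact Or.inl rfl
    · exact Or.inr rfl
  · exact h i

theorem IsCubePath.map (f : BoxHom m n) {l : Len} {γ : C(Itv l, Fin m → I)} (h : IsCubePath γ) :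
    IsCubePath ((cubeMap f).comp γ) := by
  rw [isCubePath_iff] at h ⊢
  exact ⟨cubeMap_vertex f h.1, cubeMap_vertex f h.2.1, (cubeMap_strictMono f).comp h.2.2⟩

end cubeMap

/-- The cocubical multipointed `d`-space of regular cubes. -/
def regCubeFunctor : Box ⥤ MdSpace where
  obj n := regCube n.dim
  map f := ⟨cubeMap f, fun _ h => cubeMap_vertex f h, fun _ h => h.map f⟩
  map_id _ := rfl
  map_comp f g := MdSpace.Hom.ext (ContinuousMap.ext fun x => BoxHom.map_comp f g bit x)

/-- The cocubical Moore flow `𝕄^𝒢 |□[*]|ᵗ_reg`. -/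
def regCubeFlow : Box ⥤ MooreFlow := regCubeFunctor ⋙ MdSpace.mooreFunctor

/-! ### The spaces of natural `d`-paths of the cubes -/

/-- A positive integer, as a length. -/
def lenN (n : ℕ+) : Len := ⟨(n : ℕ), Nat.cast_pos.2 n.2⟩

/-- The tame regular `d`-paths of length `n` of `□[n]` from `0_n` to `1_n` that are natural: the
`L₁`-arc length between `γ 0` and `γ t` is `t`. -/
def IsNatural (n : ℕ+) (γ : C(Itv (lenN n), Fin n → I)) : Prop :=
  (regCube n).IsPath γ ∧ γ (Itv.bot _) = (fun _ => 0) ∧ γ (Itv.top _) = (fun _ => 1) ∧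
    ∀ t, ∑ i, |(γ (Itv.bot _) i : ℝ) - γ t i| = t.1

/-- The space `N_n`, with the kelleyfied compact-open topology. -/
abbrev N (n : ℕ+) : Type := KD {γ : C(Itv (lenN n), Fin n → I) // IsNatural n γ}

/-- A partition `A ⊔ B` of `{1, …, n}` with `card A = m₁` and `card B = m₂`. -/
structure Part (m₁ m₂ n : ℕ+) : Type where
  A : Finset (Fin n)
  B : Finset (Fin n)
  hB : B = Aᶜ
  cardA : A.card = m₁
  cardB : B.card = m₂

/-- The face of `□[n]` whose free coordinates are those in `A`, the others being `b`. This is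
`∂^b_B (id_[n])` for `B` the complement of `A`. -/
def face {n m : ℕ} (A : Finset (Fin n)) (h : A.card = m) (b : Bool) : BoxHom m n where
  coord j := if hj : j ∈ A then Sum.inr ((A.orderIsoOfFin h).symm ⟨j, hj⟩) else Sum.inl b
  mono i j k l hij hi hj := by
    split_ifs at hi hj with h1 h2
    cases hi
    cases hj
    exact (A.orderIsoOfFin h).symm.strictMono (show (⟨i, h1⟩ : A) < ⟨j, h2⟩ from hij)
  surj k := ⟨A.orderIsoOfFin h k, (dif_pos (A.orderIsoOfFin h k).2).trans
    (congrArg Sum.inr ((A.orderIsoOfFin h).symm_apply_apply k))⟩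

/-- The sum of the coordinates of a point of a face. -/
theorem sum_face {n m : ℕ} (A : Finset (Fin n)) (h : A.card = m) (b : Bool) (x : Fin m → I) :
    ∑ j, (cubeMap (face A h b) x j : ℝ) = ∑ i, (x i : ℝ) + (Aᶜ.card : ℝ) * (bit b : ℝ) := by
  rw [← Finset.sum_add_sum_compl A]
  congr 1
  · rw [← Finset.sum_coe_sort A, ← (A.orderIsoOfFin h).toEquiv.sum_comp]
    refine Finset.sum_congr rfl fun i _ => ?_
    show ((Sum.elim bit x ((face A h b).coord (A.orderIsoOfFin h i)) : I) : ℝ) = x i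
    rw [show (face A h b).coord (A.orderIsoOfFin h i) = Sum.inr i from
      (dif_pos (A.orderIsoOfFin h i).2).trans
        (congrArg Sum.inr ((A.orderIsoOfFin h).symm_apply_apply i))]
    rfl
  · rw [← nsmul_eq_mul, ← Finset.sum_const]
    refine Finset.sum_congr rfl fun j hj => ?_
    simp [cubeMap, BoxHom.map, face, Finset.mem_compl.1 hj]

theorem face_zero {n m : ℕ} (A : Finset (Fin n)) (h : A.card = m) :
    cubeMap (face A h false) (fun _ => 0) = fun _ => 0 := by
  funext j
  by_cases hj : j ∈ A <;> simp [cubeMap, BoxHom.map, face, hj, bit]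

theorem face_one {n m : ℕ} (A : Finset (Fin n)) (h : A.card = m) :
    cubeMap (face A h true) (fun _ => 1) = fun _ => 1 := by
  funext j
  by_cases hj : j ∈ A <;> simp [cubeMap, BoxHom.map, face, hj, bit]

namespace Part

variable {m₁ m₂ n : ℕ+} (π : Part m₁ m₂ n)

/-- The face `∂⁰_B (id)`. -/
def faceA : BoxHom m₁ n := face π.A π.cardA false

/-- The face `∂¹_A (id)`. -/
def faceB : BoxHom m₂ n := face π.B π.cardB true

theorem compl_B : π.Bᶜ = π.A := by rw [π.hB, compl_compl]

theorem meet : cubeMap π.faceA (fun _ => 1) = cubeMap π.faceB (fun _ => 0) := by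
  funext j
  by_cases hj : j ∈ π.A <;>
    simp [cubeMap, BoxHom.map, face, faceA, faceB, hj, bit, π.hB]

theorem len_eq (π : Part m₁ m₂ n) : lenN m₁ + lenN m₂ = lenN n := by
  refine Subtype.ext ?_
  show ((m₁ : ℕ) : ℝ) + ((m₂ : ℕ) : ℝ) = ((n : ℕ) : ℝ)
  have h := Finset.card_add_card_compl π.A
  rw [← π.hB, π.cardA, π.cardB, Fintype.card_fin] at h
  exact_mod_cast h

/-- The Moore composition `(∂⁰_B γ₁) * (∂¹_A γ₂)` of two natural `d`-paths is natural. -/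
def comp (γ₁ : N m₁) (γ₂ : N m₂) : N n :=
  ⟨⟨(mooreComp ((cubeMap π.faceA).comp γ₁.val.1) ((cubeMap π.faceB).comp γ₂.val.1) (by
      show cubeMap π.faceA (γ₁.val.1 _) = cubeMap π.faceB (γ₂.val.1 _)
      rw [γ₁.val.2.2.2.1, γ₂.val.2.2.1, π.meet])).comp (Rep.ofEq π.len_eq.symm).toCM, by
    obtain ⟨⟨γ₁, hp₁, hb₁, ht₁, hn₁⟩⟩ := γ₁
    obtain ⟨⟨γ₂, hp₂, hb₂, ht₂, hn₂⟩⟩ := γ₂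
    have hm : cubeMap π.faceA (γ₁ (Itv.top _)) = cubeMap π.faceB (γ₂ (Itv.bot _)) := by
      rw [ht₁, hb₂, π.meet]
    have hb : mooreComp ((cubeMap π.faceA).comp γ₁) ((cubeMap π.faceB).comp γ₂) hm (Itv.bot _) =
        fun _ => 0 := glue_bot.trans ((congrArg _ hb₁).trans (face_zero _ _))
    have ht : mooreComp ((cubeMap π.faceA).comp γ₁) ((cubeMap π.faceB).comp γ₂) hm (Itv.top _) =
        fun _ => 1 := (glue_top hm).trans ((congrArg _ ht₂).trans (face_one _ _))
    refine ⟨?_, ?_, ?_, fun t => ?_⟩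
    · have h1 := MdSpace.IsPath.comp (X := regCube n) (γ := (cubeMap π.faceA).comp γ₁)
        (γ' := (cubeMap π.faceB).comp γ₂) (IsCubePath.map π.faceA hp₁)
        (IsCubePath.map π.faceB hp₂) hm
      exact h1.rep _
    · exact (congrArg _ (Rep.apply_bot _)).trans hb
    · exact (congrArg _ (Rep.apply_top _)).trans ht
    · have e : ∀ s : Itv (lenN m₁ + lenN m₂),
          ∑ i, (glue (fun t => cubeMap π.faceA (γ₁ t)) (fun t => cubeMap π.faceB (γ₂ t)) s i : ℝ)
            = s.1 := by
        intro s
        rcases Itv.cases s with ⟨s, rfl⟩ | ⟨s, rfl⟩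
        · rw [glue_inl, faceA, sum_face]
          have := hn₁ s
          rw [hb₁] at this
          simp only [Set.Icc.coe_zero, zero_sub, abs_neg, abs_of_nonneg (γ₁ s _).2.1] at this
          rw [this]
          simp [bit, Itv.inl]
        · rw [glue_inr hm, faceB, sum_face]
          have := hn₂ s
          rw [hb₂] at this
          simp only [Set.Icc.coe_zero, zero_sub, abs_neg, abs_of_nonneg (γ₂ s _).2.1] at this
          rw [this, π.compl_B, π.cardA]
          simp [bit, Itv.inr, lenN, add_comm]
      have hb' : ((mooreComp ((cubeMap π.faceA).comp γ₁) ((cubeMap π.faceB).comp γ₂) hm).comp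
          (Rep.ofEq π.len_eq.symm).toCM) (Itv.bot _) = fun _ => 0 :=
        (congrArg _ (Rep.apply_bot _)).trans hb
      rw [hb']
      have h0 : ∀ i, |(((0 : I) : ℝ)) - ((mooreComp ((cubeMap π.faceA).comp γ₁)
          ((cubeMap π.faceB).comp γ₂) hm).comp (Rep.ofEq π.len_eq.symm).toCM) t i| =
          (glue (fun t => cubeMap π.faceA (γ₁ t)) (fun t => cubeMap π.faceB (γ₂ t))
            (Rep.ofEq π.len_eq.symm t) i : ℝ) := by
        intro i
        rw [Set.Icc.coe_zero, zero_sub, abs_neg]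
        exact abs_of_nonneg (glue (fun t => cubeMap π.faceA (γ₁ t))
          (fun t => cubeMap π.faceB (γ₂ t)) (Rep.ofEq π.len_eq.symm t) i).2.1
      simp only [h0]
      rw [e, Rep.ofEq_val]⟩⟩

theorem comp_dcont : DCont fun p : N m₁ × N m₂ => π.comp p.1 p.2 := by
  intro k p
  refine path_continuous_iff.2 ?_
  have h1 := path_continuous_iff.1 (continuous_fst.comp p.continuous)
  have h2 := path_continuous_iff.1 (continuous_snd.comp p.continuous)
  have h := glue_continuous (f := fun z t => cubeMap π.faceA ((p z).1.val.1 t))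
    (g := fun z t => cubeMap π.faceB ((p z).2.val.1 t)) (fun z => by
      rw [(p z).1.val.2.2.2.1, (p z).2.val.2.2.1, π.meet])
    ((cubeMap π.faceA).continuous.comp h1) ((cubeMap π.faceB).continuous.comp h2)
  exact h.comp (continuous_fst.prodMk ((Rep.continuous _).comp continuous_snd))

end Part

/-! ### The `n̲`-cubes -/

/-- Nonempty finite sequences of positive integers. -/
inductive PSeq : Type
  | one (n : ℕ+) : PSeq
  | cons (n : ℕ+) (s : PSeq) : PSeq

namespace PSeq

/-- The length `|n̲| = n₁ + ⋯ + n_p`. -/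
def total : PSeq → ℕ+
  | one n => n
  | cons n s => n + total s

def append : PSeq → PSeq → PSeq
  | one n, t => cons n t
  | cons n s, t => cons n (append s t)

theorem total_append (s t : PSeq) : (append s t).total = s.total + t.total := by
  induction s with
  | one n => rfl
  | cons n s ih => exact (congrArg (n + ·) ih).trans (add_assoc _ _ _).symm

theorem append_assoc (s t u : PSeq) : (s.append t).append u = s.append (t.append u) := by
  induction s with
  | one n => rfl
  | cons n s ih => exact congrArg (cons n) ih

end PSeq

/-- The map of the box category with value the vertex `(b, …, b)`. -/
def constHom (n : ℕ) (b : Bool) : BoxHom 0 n :=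
  ⟨fun _ => Sum.inl b, fun _ _ _ _ _ h _ => (nomatch h), fun k => Fin.elim0 k⟩

/-- The vertex `(b, …, b)` of `□[n]`: its initial state `0_n` or its final state `1_n`. -/
def vtx (n : ℕ) (b : Bool) : cubeSet 0 ⟶ cubeSet n :=
  yoneda.map (X := (⟨0⟩ : Box)) (Y := ⟨n⟩) (constHom n b)

open Limits in
/-- The precubical set `□[n̲] = □[n₁] * ⋯ * □[n_p]`, together with its initial state `0_{n₁}`. It
is obtained by identifying the final state of `□[n₁]` and the initial state of
`□[n₂] * ⋯ * □[n_p]`. -/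
def wedge : PSeq → Σ X : PrecubicalSet, (cubeSet 0 ⟶ X)
  | PSeq.one n => ⟨cubeSet n, vtx n false⟩
  | PSeq.cons n s => ⟨pushout (vtx n true) (wedge s).2,
      vtx n false ≫ pushout.inl (vtx n true) (wedge s).2⟩

/-- The `n̲`-cube. -/
def W (s : PSeq) : PrecubicalSet := (wedge s).1

namespace W

/-- The initial state `0_{n₁}`. -/
def init (s : PSeq) : cubeSet 0 ⟶ W s := (wedge s).2

variable {n : ℕ+} {s : PSeq} {X : PrecubicalSet}

def inl (n : ℕ+) (s : PSeq) : cubeSet n ⟶ W (PSeq.cons n s) :=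
  Limits.pushout.inl (vtx n true) (init s)

def inr (n : ℕ+) (s : PSeq) : W s ⟶ W (PSeq.cons n s) :=
  Limits.pushout.inr (vtx n true) (init s)

/-- The final state `1_{n_p}`. -/
def final : ∀ s : PSeq, cubeSet 0 ⟶ W s
  | PSeq.one n => vtx n true
  | PSeq.cons n s => final s ≫ inr n s

theorem condition : vtx n true ≫ inl n s = init s ≫ inr n s := Limits.pushout.condition

theorem init_cons : init (PSeq.cons n s) = vtx n false ≫ inl n s := rfl

def desc (f : cubeSet n ⟶ X) (g : W s ⟶ X) (h : vtx n true ≫ f = init s ≫ g) :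
    W (PSeq.cons n s) ⟶ X := Limits.pushout.desc f g h

@[simp] theorem inl_desc (f : cubeSet n ⟶ X) (g : W s ⟶ X)
    (h : vtx n true ≫ f = init s ≫ g) : inl n s ≫ desc f g h = f := Limits.pushout.inl_desc _ _ _

@[simp] theorem inr_desc (f : cubeSet n ⟶ X) (g : W s ⟶ X)
    (h : vtx n true ≫ f = init s ≫ g) : inr n s ≫ desc f g h = g := Limits.pushout.inr_desc _ _ _

theorem inl_desc_assoc {Z : PrecubicalSet} (f : cubeSet n ⟶ X) (g : W s ⟶ X)
    (h : vtx n true ≫ f = init s ≫ g) (k : X ⟶ Z) : inl n s ≫ desc f g h ≫ k = f ≫ k := by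
  rw [← Category.assoc, inl_desc]

theorem inr_desc_assoc {Z : PrecubicalSet} (f : cubeSet n ⟶ X) (g : W s ⟶ X)
    (h : vtx n true ≫ f = init s ≫ g) (k : X ⟶ Z) : inr n s ≫ desc f g h ≫ k = g ≫ k := by
  rw [← Category.assoc, inr_desc]

theorem hom_ext {f g : W (PSeq.cons n s) ⟶ X} (h₁ : inl n s ≫ f = inl n s ≫ g)
    (h₂ : inr n s ≫ f = inr n s ≫ g) : f = g := Limits.pushout.hom_ext h₁ h₂

end W

namespace Part

variable {m₁ m₂ n : ℕ+} (π : Part m₁ m₂ n)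

def inA : cubeSet m₁ ⟶ cubeSet n := yoneda.map (X := (⟨m₁⟩ : Box)) (Y := ⟨n⟩) π.faceA

def inB : cubeSet m₂ ⟶ cubeSet n := yoneda.map (X := (⟨m₂⟩ : Box)) (Y := ⟨n⟩) π.faceB

theorem vtx_inA : vtx m₁ false ≫ π.inA = vtx n false := by
  rw [vtx, inA, ← Functor.map_comp]
  congr 1
  refine BoxHom.ext (funext fun j => ?_)
  show Sum.elim Sum.inl (fun _ => Sum.inl false) (π.faceA.coord j) = Sum.inl false
  by_cases hj : j ∈ π.A <;> simp [faceA, face, hj]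

theorem vtx_inB : vtx m₂ true ≫ π.inB = vtx n true := by
  rw [vtx, inB, ← Functor.map_comp]
  congr 1
  refine BoxHom.ext (funext fun j => ?_)
  show Sum.elim Sum.inl (fun _ => Sum.inl true) (π.faceB.coord j) = Sum.inl true
  by_cases hj : j ∈ π.B <;> simp [faceB, face, hj]

theorem vtx_meet : vtx m₁ true ≫ π.inA = vtx m₂ false ≫ π.inB := by
  rw [vtx, vtx, inA, inB, ← Functor.map_comp, ← Functor.map_comp]
  congr 1
  refine BoxHom.ext (funext fun j => ?_)
  show Sum.elim Sum.inl (fun _ => Sum.inl true) (π.faceA.coord j) =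
    Sum.elim Sum.inl (fun _ => Sum.inl false) (π.faceB.coord j)
  by_cases hj : j ∈ π.A <;> simp [faceA, faceB, face, hj, π.hB]

/-- The map `φ_{A,B} : □[m₁] * □[m₂] ⟶ □[n]`. -/
def phi : W (PSeq.cons m₁ (PSeq.one m₂)) ⟶ cubeSet n := W.desc π.inA π.inB π.vtx_meet

end Part

/-- The names of the maps `δ_{i,A,B} : □[s] ⟶ □[s']`: in the first case `φ_{A,B}` is alone, in the
second case it acts on the first two cubes, and in the third case it acts further. -/
inductive Gen : PSeq → PSeq → Type
  | last {m₁ m₂ n : ℕ+} (π : Part m₁ m₂ n) : Gen (PSeq.cons m₁ (PSeq.one m₂)) (PSeq.one n)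
  | head {m₁ m₂ n : ℕ+} (π : Part m₁ m₂ n) (s : PSeq) :
      Gen (PSeq.cons m₁ (PSeq.cons m₂ s)) (PSeq.cons n s)
  | tail (n : ℕ+) {s s' : PSeq} (g : Gen s s') : Gen (PSeq.cons n s) (PSeq.cons n s')

namespace Gen

/-- The map `δ_{i,A,B}`, which preserves the initial state. -/
def wmapAux : ∀ {s s' : PSeq}, Gen s s' → {f : W s ⟶ W s' // W.init s ≫ f = W.init s'}
  | _, _, last π => ⟨π.phi, (Category.assoc _ _ _).trans
      ((congrArg (vtx _ false ≫ ·) (W.inl_desc (s := PSeq.one _) π.inA π.inB π.vtx_meet)).trans π.vtx_inA)⟩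
  | _, _, head π s => ⟨W.desc (π.inA ≫ W.inl _ s) (W.desc (π.inB ≫ W.inl _ s) (W.inr _ s) (by
        rw [← Category.assoc, π.vtx_inB, W.condition])) (by
        rw [W.init_cons, Category.assoc, W.inl_desc, ← Category.assoc, π.vtx_meet,
          Category.assoc]), by
      rw [W.init_cons, Category.assoc, W.inl_desc, ← Category.assoc, π.vtx_inA, W.init_cons]⟩
  | _, _, tail n g => ⟨W.desc (W.inl n _) (g.wmapAux.1 ≫ W.inr n _) (by
        rw [← Category.assoc, g.wmapAux.2, W.condition]), by
      rw [W.init_cons, Category.assoc, W.inl_desc, W.init_cons]⟩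

def wmap {s s' : PSeq} (g : Gen s s') : W s ⟶ W s' := g.wmapAux.1

theorem init_wmap {s s' : PSeq} (g : Gen s s') : W.init s ≫ g.wmap = W.init s' := g.wmapAux.2

theorem final_wmap {s s' : PSeq} (g : Gen s s') : W.final s ≫ g.wmap = W.final s' := by
  induction g with
  | last π =>
    exact (Category.assoc _ _ _).trans ((congrArg (vtx _ true ≫ ·)
      (W.inr_desc (s := PSeq.one _) π.inA π.inB π.vtx_meet)).trans π.vtx_inB)
  | head π s =>
    show ((W.final s ≫ W.inr _ s) ≫ W.inr _ _) ≫ W.desc _ _ _ = _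
    rw [Category.assoc, W.inr_desc, Category.assoc, W.inr_desc]
    rfl
  | tail n g ih =>
    show (W.final _ ≫ W.inr n _) ≫ W.desc _ _ _ = _
    rw [Category.assoc, W.inr_desc, ← Category.assoc]
    exact congrArg (· ≫ W.inr n _) ih

end Gen

/-! ### The `𝒢`-spaces associated with the `n̲`-cubes -/

open GSpace

/-- The `𝒢`-space `𝔽_n N_n`. -/
abbrev FN (n : ℕ+) : GSpace := free (lenN n) (N n)

/-- The `𝒢`-space `𝔽_{n₁} N_{n₁} ⊗ ⋯ ⊗ 𝔽_{n_p} N_{n_p}`. -/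
def T : PSeq → GSpace
  | PSeq.one n => FN n
  | PSeq.cons n s => tensor (FN n) (T s)

/-- The map `𝔽_{m₁} N_{m₁} ⊗ 𝔽_{m₂} N_{m₂} ⟶ 𝔽_n N_n` induced by `φ_{A,B}`, which takes
`(φ₁, γ₁) ⊗ (φ₂, γ₂)` to `(φ₁ ⊗ φ₂, γ₁ * γ₂)`. -/
def Part.merge {m₁ m₂ n : ℕ+} (π : Part m₁ m₂ n) : tensor (FN m₁) (FN m₂) ⟶ FN n :=
  lift
    { fn := fun x y => KD.mk
        ((Rep.ofEq π.len_eq).comp (x.val.1.sum y.val.1), π.comp x.val.2 y.val.2)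
      dcont := fun a b => by
        have h1 : DCont fun p : (FN m₁).obj a × (FN m₂).obj b => p.1.val :=
          KD.val_dcont.comp' (DCont.mk continuous_fst)
        have h2 : DCont fun p : (FN m₁).obj a × (FN m₂).obj b => p.2.val :=
          KD.val_dcont.comp' (DCont.mk continuous_snd)
        exact KD.mk_dcont.comp' (DCont.prodMk (Rep.dcont_comp.comp' (DCont.prodMk
          (DCont.mk continuous_const) (Rep.dcont_sum.comp' (h1.fst.prodMk h2.fst))))
          (π.comp_dcont.comp' (h1.snd.prodMk h2.snd)))
      map_act := fun α β x y => by
        show KD.mk ((Rep.ofEq π.len_eq).comp ((x.val.1.comp α).sum (y.val.1.comp β)), _) = _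
        rw [Rep.sum_comp]
        rfl }

namespace Gen

/-- The map of `𝒢`-spaces associated with `δ_{i,A,B}`. -/
def tmap : ∀ {s s' : PSeq}, Gen s s' → (T s ⟶ T s')
  | _, _, last π => π.merge
  | _, _, head π s => (GSpace.assoc _ _ _).inv ≫ tensorMap π.merge (𝟙 (T s))
  | _, _, tail n g => tensorMap (𝟙 (FN n)) g.tmap

end Gen

/-- The composites of maps `δ_{i,A,B}`. -/
inductive GPath : PSeq → PSeq → Type
  | nil (s : PSeq) : GPath s s
  | cons {s s' s'' : PSeq} (g : Gen s s') (p : GPath s' s'') : GPath s s''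

namespace GPath

def wmap : ∀ {s s' : PSeq}, GPath s s' → (W s ⟶ W s')
  | _, _, nil _ => 𝟙 _
  | _, _, cons g p => g.wmap ≫ p.wmap

def tmap : ∀ {s s' : PSeq}, GPath s s' → (T s ⟶ T s')
  | _, _, nil _ => 𝟙 _
  | _, _, cons g p => g.tmap ≫ p.tmap

def append : ∀ {s s' s'' : PSeq}, GPath s s' → GPath s' s'' → GPath s s''
  | _, _, _, nil _, q => q
  | _, _, _, cons g p, q => cons g (p.append q)

theorem wmap_append {s s' s'' : PSeq} (p : GPath s s') (q : GPath s' s'') :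
    (p.append q).wmap = p.wmap ≫ q.wmap := by
  induction p with
  | nil s => exact (Category.id_comp _).symm
  | cons g p ih => exact (congrArg (g.wmap ≫ ·) (ih q)).trans (Category.assoc _ _ _).symm

theorem tmap_append {s s' s'' : PSeq} (p : GPath s s') (q : GPath s' s'') :
    (p.append q).tmap = p.tmap ≫ q.tmap := by
  induction p with
  | nil s => exact (Category.id_comp _).symm
  | cons g p ih => exact (congrArg (g.tmap ≫ ·) (ih q)).trans (Category.assoc _ _ _).symm

end GPath

/-! ### The map of `𝒢`-spaces only depends on the map of precubical sets

The two are compared through the paths that they induce in arbitrary sets. -/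

section independence

theorem glue_inr_pos {a b : Len} {X : Type*} {f : Itv a → X} {g : Itv b → X} {t : Itv b}
    (ht : 0 < t.1) : glue f g (Itv.inr a t) = g t := by
  have hn : ¬ (a.1 + t.1 ≤ a.1) := by linarith
  simp [glue, Itv.inr, hn, Set.projIcc_of_mem b.2.le t.2]

theorem Itv.cases_pos {a b : Len} (t : Itv (a + b)) :
    (∃ s, t = Itv.inl b s) ∨ ∃ s : Itv b, 0 < s.1 ∧ t = Itv.inr a s := by
  rcases Itv.cases t with h | ⟨s, rfl⟩
  · exact Or.inl h
  · rcases eq_or_lt_of_le s.2.1 with h | h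
    · have : s = Itv.bot b := Subtype.ext h.symm
      exact Or.inl ⟨Itv.top a, by rw [this, Itv.inl_top]⟩
    · exact Or.inr ⟨s, h, rfl⟩

theorem Rep.val_pos {a b : Len} (φ : Rep a b) {t : Itv a} (h : 0 < t.1) : 0 < (φ t).1 := by
  have := φ.iso.strictMono (show Itv.bot a < t from h)
  change φ (Itv.bot a) < φ t at this
  rw [φ.apply_bot] at this
  exact this

theorem glue_sum {a b a' b' : Len} {X : Type*} (f : Itv a' → X) (g : Itv b' → X) (α : Rep a a')
    (β : Rep b b') (t : Itv (a + b)) :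
    glue (fun t => f (α t)) (fun t => g (β t)) t = glue f g (α.sum β t) := by
  rcases Itv.cases_pos t with ⟨s, rfl⟩ | ⟨s, hs, rfl⟩
  · rw [glue_inl, Rep.sum_inl, glue_inl]
  · rw [glue_inr_pos hs, Rep.sum_inr, glue_inr_pos (β.val_pos hs)]

theorem glue_assoc' {a b c : Len} {X : Type*} (f : Itv a → X) (g : Itv b → X) (h : Itv c → X)
    (t : Itv (a + (b + c))) :
    glue f (glue g h) t = glue (glue f g) h (Rep.assoc' a b c t) := by
  obtain ⟨t, rfl⟩ : ∃ u, t = Rep.assoc a b c u :=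
    ⟨Rep.assoc' a b c t, (congrArg (fun φ : Rep _ _ => φ t) Rep.assoc_assoc').symm⟩
  have e : Rep.assoc' a b c (Rep.assoc a b c t) = t :=
    congrArg (fun φ : Rep _ _ => φ t) Rep.assoc'_assoc
  rw [e]
  rcases Itv.cases_pos t with ⟨t, rfl⟩ | ⟨t, ht, rfl⟩
  · rcases Itv.cases_pos t with ⟨t, rfl⟩ | ⟨t, ht, rfl⟩
    · rw [Rep.assoc_ll, glue_inl, glue_inl, glue_inl]
    · rw [Rep.assoc_lr, glue_inr_pos (show 0 < (Itv.inl c t).1 from ht), glue_inl, glue_inl,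
        glue_inr_pos ht]
  · rw [Rep.assoc_r, glue_inr_pos (show 0 < (Itv.inr b t).1 from add_pos b.2 ht),
      glue_inr_pos ht, glue_inr_pos ht]

theorem dcont_top {Z M : Type} [TopologicalSpace Z] (f : Z → M) : @DCont Z M _ (kD ⊤) f := by
  let _ : TopologicalSpace M := ⊤
  exact DCont.rng_kD (DCont.mk (f := f) continuous_top)

/-- The set of all maps from a segment to a set. -/
def AllMaps (Y : Type) (l : Len) : Type := Itv l → Y

instance (Y : Type) (l : Len) : TopologicalSpace (AllMaps Y l) := kD ⊤

/-- The `𝒢`-space of all maps from the segments to a set. -/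
def maps (Y : Type) : GSpace where
  obj := AllMaps Y
  top _ := kD ⊤
  dgen _ := dgen_kD _
  act φ γ t := γ (φ t)
  act_id _ := rfl
  act_comp _ _ _ := rfl
  act_dcont _ _ := dcont_top _

/-- The precubical set of all maps from the cubes to a set. -/
def sing (Y : Type) : PrecubicalSet where
  obj m := (Fin m.unop.dim → I) → Y
  map f := TypeCat.ofHom fun σ x => σ (cubeMap f.unop x)
  map_id _ := rfl
  map_comp f g := by
    ext σ x
    exact congrArg σ (BoxHom.map_comp g.unop f.unop bit x)

variable {Y : Type}

/-- The map `□[n] ⟶ sing Y` given by a map `[0,1]ⁿ → Y`, and conversely. -/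
def ofMap {n : ℕ} (σ : (Fin n → I) → Y) : cubeSet n ⟶ sing Y :=
  yonedaEquiv.symm (show (sing Y).obj (op ⟨n⟩) from σ)

def toMap {n : ℕ} (h : cubeSet n ⟶ sing Y) : (Fin n → I) → Y := yonedaEquiv h

theorem toMap_ofMap {n : ℕ} (σ : (Fin n → I) → Y) : toMap (ofMap σ) = σ :=
  yonedaEquiv.apply_symm_apply _

theorem toMap_comp {m n : ℕ} (f : BoxHom m n) (h : cubeSet n ⟶ sing Y) :
    toMap (yoneda.map (X := (⟨m⟩ : Box)) (Y := ⟨n⟩) f ≫ h) = fun x => toMap h (cubeMap f x) :=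
  (yonedaEquiv_naturality h (show (⟨m⟩ : Box) ⟶ ⟨n⟩ from f)).symm

theorem hom_ext_toMap {n : ℕ} {f g : cubeSet n ⟶ sing Y} (h : toMap f = toMap g) : f = g :=
  yonedaEquiv.injective h

def ev1 {n : ℕ+} (σ : (Fin n → I) → Y) : FN n ⟶ maps Y where
  app _ x t := σ (x.val.2.val.1 (x.val.1 t))
  continuous _ := DCont.continuous (dcont_top _)
  naturality _ _ := rfl

/-- The paths in `Y` induced by a map `□[s] ⟶ sing Y`. -/
def ev : ∀ s : PSeq, (W s ⟶ sing Y) → (T s ⟶ maps Y)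
  | PSeq.one n, h => ev1 (n := n) (toMap h)
  | PSeq.cons n s, h => lift
    { fn := fun x y => glue ((ev1 (toMap (W.inl n s ≫ h))).app _ x) ((ev s (W.inr n s ≫ h)).app _ y)
      dcont := fun _ _ => dcont_top _
      map_act := fun α β x y => by
        rw [Hom.naturality, Hom.naturality]
        exact funext fun t => glue_sum ((ev1 (toMap (W.inl n s ≫ h))).app _ x)
          ((ev s (W.inr n s ≫ h)).app _ y) α β t }

theorem ev_cons {n : ℕ+} {s : PSeq} (h : W (PSeq.cons n s) ⟶ sing Y) {a b : Len}
    (x : (FN n).obj a) (y : (T s).obj b) : (ev _ h).app (a + b) (tmk x y) =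
      glue ((ev1 (toMap (W.inl n s ≫ h))).app _ x) ((ev s (W.inr n s ≫ h)).app _ y) :=
  lift_tmk _ _ _

theorem merge_tmk {m₁ m₂ n : ℕ+} (π : Part m₁ m₂ n) {a b : Len} (x : (FN m₁).obj a)
    (y : (FN m₂).obj b) : π.merge.app _ (tmk x y) = KD.mk
      ((Rep.ofEq π.len_eq).comp (x.val.1.sum y.val.1), π.comp x.val.2 y.val.2) := lift_tmk _ _ _

theorem ev1_merge {m₁ m₂ n : ℕ+} (π : Part m₁ m₂ n) {a b : Len} (x : (FN m₁).obj a)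
    (y : (FN m₂).obj b) (h : cubeSet n ⟶ sing Y) :
    (ev1 (toMap h)).app _ (π.merge.app _ (tmk x y)) =
      glue ((ev1 (toMap (π.inA ≫ h))).app _ x) ((ev1 (toMap (π.inB ≫ h))).app _ y) := by
  rw [merge_tmk]
  funext t
  have e : ∀ u, Rep.ofEq π.len_eq.symm (Rep.ofEq π.len_eq u) = u := fun u =>
    Subtype.ext (by rw [Rep.ofEq_val, Rep.ofEq_val])
  show toMap h (glue (fun t => cubeMap π.faceA (x.val.2.val.1 t))
    (fun t => cubeMap π.faceB (y.val.2.val.1 t)) (Rep.ofEq π.len_eq.symm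
      (Rep.ofEq π.len_eq (x.val.1.sum y.val.1 t)))) = _
  rw [e]
  refine (comp_glue (toMap h) _).trans ((glue_sum (fun t => toMap h (cubeMap π.faceA
    (x.val.2.val.1 t))) (fun t => toMap h (cubeMap π.faceB (y.val.2.val.1 t))) _ _ t).symm.trans ?_)
  rw [Part.inA, Part.inB, toMap_comp, toMap_comp]
  rfl

theorem Gen.tmap_ev {s s' : PSeq} (g : Gen s s') (h : W s' ⟶ sing Y) :
    g.tmap ≫ ev s' h = ev s (g.wmap ≫ h) := by
  induction g with
  | last π =>
    refine tensor_hom_ext fun a b x y => ?_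
    refine (ev1_merge π x y h).trans ((ev_cons (s := PSeq.one _) _ x y).trans ?_).symm
    have h1 : W.inl _ _ ≫ (last π).wmap ≫ h = π.inA ≫ h :=
      W.inl_desc_assoc (s := PSeq.one _) _ _ _ h
    have h2 : W.inr _ _ ≫ (last π).wmap ≫ h = π.inB ≫ h :=
      W.inr_desc_assoc (s := PSeq.one _) _ _ _ h
    rw [h1, h2]
    rfl
  | head π s =>
    refine tensorR_hom_ext fun a b c x y z => ?_
    have h1 : W.inl _ _ ≫ (head π s).wmap ≫ h = π.inA ≫ W.inl _ _ ≫ h := 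
      (W.inl_desc_assoc _ _ _ h).trans (Category.assoc _ _ _)
    have h2 : W.inr _ _ ≫ (head π s).wmap ≫ h =
        W.desc (π.inB ≫ W.inl _ s) (W.inr _ s) (by
          rw [← Category.assoc, π.vtx_inB, W.condition]) ≫ h := 
      W.inr_desc_assoc _ _ _ h
    refine Eq.trans ?_ (ev_cons (s := PSeq.cons _ s) _ x (tmk y z)).symm
    rw [h1, h2, ev_cons, W.inl_desc_assoc, W.inr_desc_assoc, Category.assoc]
    show (ev _ h).app _ ((tensorMap π.merge (𝟙 (T s))).app _ ((GSpace.assoc _ _ _).inv.app _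
      (tmk x (tmk y z)))) = _
    rw [assoc_inv_tmk, Hom.naturality, tensorMap_tmk]
    refine ((ev _ h).naturality _ _).trans
      ((congrArg ((maps Y).act _) (ev_cons h _ _)).trans ?_)
    rw [ev1_merge]
    exact funext fun t => (glue_assoc' _ _ _ t).symm
  | tail n g ih =>
    refine tensor_hom_ext fun a b x y => ?_
    refine Eq.trans ?_ (ev_cons _ x y).symm
    have h1 : W.inl _ _ ≫ (tail n g).wmap ≫ h = W.inl _ _ ≫ h := 
      W.inl_desc_assoc _ _ _ h
    have h2 : W.inr _ _ ≫ (tail n g).wmap ≫ h = g.wmap ≫ W.inr _ _ ≫ h := 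
      (W.inr_desc_assoc _ _ _ h).trans (Category.assoc _ _ _)
    rw [h1, h2, ← ih]
    show (ev _ h).app _ ((tensorMap (𝟙 (FN n)) g.tmap).app _ (tmk x y)) = _
    rw [tensorMap_tmk, ev_cons]
    rfl

theorem GPath.tmap_ev {s s' : PSeq} (p : GPath s s') (h : W s' ⟶ sing Y) :
    p.tmap ≫ ev s' h = ev s (p.wmap ≫ h) := by
  induction p with
  | nil s => exact (Category.id_comp _).trans (congrArg (ev s) (Category.id_comp h).symm)
  | cons g p ih =>
    show (g.tmap ≫ p.tmap) ≫ ev _ h = ev _ ((g.wmap ≫ p.wmap) ≫ h)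
    rw [Category.assoc, Category.assoc, ih, g.tmap_ev]

/-- The points of `T s` represented by tuples of natural paths, without reparametrization. -/
def IsStd : ∀ s : PSeq, (Σ l, (T s).obj l) → Prop
  | PSeq.one n, u => ∃ γ : N n, u = ⟨lenN n, KD.mk (Rep.id _, γ)⟩
  | PSeq.cons n s, u => ∃ (γ : N n) (y : Σ l, (T s).obj l), IsStd s y ∧
      u = ⟨lenN n + y.1, tmk (D := FN n) (KD.mk (Rep.id _, γ)) y.2⟩

theorem exists_std (s : PSeq) {l : Len} (u : (T s).obj l) :
    ∃ (y : Σ l, (T s).obj l) (φ : Rep l y.1), IsStd s y ∧ u = (T s).act φ y.2 := by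
  induction s generalizing l with
  | one n => exact ⟨_, u.val.1, ⟨u.val.2, rfl⟩, rfl⟩
  | cons n s ih =>
    obtain ⟨a, b, φ, x, y, rfl⟩ := tensor_ind u
    obtain ⟨y, ψ, hy, rfl⟩ := ih y
    refine ⟨_, (x.val.1.sum ψ).comp φ, ⟨x.val.2, y, hy, rfl⟩, ?_⟩
    rw [GSpace.act_comp]
    exact congrArg ((tensor (FN n) (T s)).act φ)
      (tmk_act (D := FN n) x.val.1 ψ (KD.mk (Rep.id _, x.val.2)) y.2)

theorem natural_sum {n : ℕ+} (γ : N n) (t : Itv (lenN n)) :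
    ∑ i, (γ.val.1 t i : ℝ) = t.1 := by
  have h := γ.val.2.2.2.2 t
  rw [γ.val.2.2.1] at h
  simpa only [Set.Icc.coe_zero, zero_sub, abs_neg, abs_of_nonneg (γ.val.1 t _).2.1] using h

theorem toMap_vtx {n : ℕ} (b : Bool) (σ : (Fin n → I) → Y) :
    vtx n b ≫ ofMap σ = ofMap fun _ => σ fun _ => bit b :=
  hom_ext_toMap (by rw [vtx, toMap_comp, toMap_ofMap, toMap_ofMap]; rfl)

/-- A height function, for which the points of `IsStd s` are parametrized by height. -/
theorem exists_height (s : PSeq) (c : ℝ) : ∃ h : W s ⟶ sing ℝ,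
    W.init s ≫ h = ofMap (fun _ => c) ∧
      ∀ y, IsStd s y → ∀ t, (ev s h).app _ y.2 t = c + t.1 := by
  induction s generalizing c with
  | one n =>
    refine ⟨ofMap (n := n) fun x => c + ∑ i, (x i : ℝ), ?_, ?_⟩
    · exact (toMap_vtx false _).trans (by simp [bit])
    · rintro _ ⟨γ, rfl⟩ t
      show toMap (ofMap (n := n) fun x => c + ∑ i, (x i : ℝ)) (γ.val.1 t) = _
      rw [toMap_ofMap, natural_sum]
  | cons n s ih =>
    obtain ⟨h, h1, h2⟩ := ih (c + n)
    refine ⟨W.desc (ofMap fun x => c + ∑ i, (x i : ℝ)) h ?_, ?_, ?_⟩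
    · rw [h1, toMap_vtx]
      simp [bit]
    · rw [W.init_cons, Category.assoc, W.inl_desc, toMap_vtx]
      simp [bit]
    · rintro _ ⟨γ, y, hy, rfl⟩ t
      refine (congrFun (ev_cons _ (KD.mk (Rep.id _, γ)) y.2) t).trans ?_
      rw [W.inl_desc, W.inr_desc, toMap_ofMap]
      rcases Itv.cases_pos t with ⟨t, rfl⟩ | ⟨t, ht, rfl⟩
      · exact (glue_inl t).trans (congrArg (c + ·) (natural_sum γ t))
      · exact (glue_inr_pos ht).trans ((h2 y hy t).trans (add_assoc _ _ _))

theorem natural_ext {n : ℕ+} {γ γ' : N n} (h : ∀ t, 0 < t.1 → γ.val.1 t = γ'.val.1 t) :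
    γ = γ' := by
  refine congrArg KD.mk (Subtype.ext (ContinuousMap.ext fun t => ?_))
  rcases eq_or_lt_of_le t.2.1 with h0 | h0
  · have : t = Itv.bot _ := Subtype.ext h0.symm
    rw [this, γ.val.2.2.1, γ'.val.2.2.1]
  · exact h t h0

/-- Standard points are separated by the paths that they induce. -/
theorem std_ext (s : PSeq) {y y' : Σ l, (T s).obj l} (hy : IsStd s y) (hy' : IsStd s y')
    (h : ∀ (Y : Type) (k : W s ⟶ sing Y) (t : Itv y.1) (t' : Itv y'.1), 0 < t.1 → t.1 = t'.1 →
      (ev s k).app _ y.2 t = (ev s k).app _ y'.2 t') : y = y' := by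
  induction s with
  | one n =>
    obtain ⟨γ, rfl⟩ := hy
    obtain ⟨γ', rfl⟩ := hy'
    suffices γ = γ' by rw [this]
    refine natural_ext fun t h0 => ?_
    have := h _ (ofMap (n := n) fun x => x) t t h0 rfl
    change toMap (ofMap (n := n) fun x => x) (γ.val.1 t) =
      toMap (ofMap (n := n) fun x => x) (γ'.val.1 t) at this
    rwa [toMap_ofMap] at this
  | cons n s ih =>
    obtain ⟨γ, y, hy, rfl⟩ := hy
    obtain ⟨γ', y', hy', rfl⟩ := hy'
    have key : ∀ (Y : Type) (k : W (PSeq.cons n s) ⟶ sing Y) (t : Itv (lenN n + y.1))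
        (t' : Itv (lenN n + y'.1)), 0 < t.1 → t.1 = t'.1 →
        glue (fun t => toMap (W.inl n s ≫ k) (γ.val.1 t)) ((ev s (W.inr n s ≫ k)).app _ y.2) t =
          glue (fun t => toMap (W.inl n s ≫ k) (γ'.val.1 t))
            ((ev s (W.inr n s ≫ k)).app _ y'.2) t' := fun Y k t t' h1 h2 =>
      (congrFun (ev_cons k (KD.mk (Rep.id _, γ)) y.2) t).symm.trans
        ((h Y k t t' h1 h2).trans (congrFun (ev_cons k (KD.mk (Rep.id _, γ')) y'.2) t'))
    have e1 : γ = γ' := by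
      refine natural_ext fun t h0 => ?_
      let k : W s ⟶ sing (Fin n → I) :=
        { app := fun _ => TypeCat.ofHom fun _ _ _ => bit true, naturality := fun _ _ _ => rfl }
      have hk : vtx n true ≫ ofMap (fun x => x) = W.init s ≫ k :=
        (toMap_vtx true _).trans (hom_ext_toMap (toMap_ofMap _))
      have := (glue_inl t).symm.trans ((key _ (W.desc (ofMap fun x => x) k hk) (Itv.inl _ t)
        (Itv.inl _ t) h0 rfl).trans (glue_inl t))
      rwa [W.inl_desc, toMap_ofMap] at this
    have e2 : y = y' := by
      refine ih hy hy' fun Y k t t' h0 ht => ?_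
      have hk : vtx n true ≫ ofMap (fun _ => toMap (W.init s ≫ k) fun i => i.elim0) =
          W.init s ≫ k := (toMap_vtx true _).trans (hom_ext_toMap ((toMap_ofMap _).trans
            (funext fun x => congrArg _ (Subsingleton.elim _ _))))
      have := (glue_inr_pos h0).symm.trans ((key _ (W.desc _ k hk) (Itv.inr _ t) (Itv.inr _ t')
        (add_pos (lenN n).2 h0) (congrArg ((lenN n).1 + ·) ht)).trans (glue_inr_pos (ht ▸ h0)))
      rwa [W.inr_desc] at this
    rw [e1, e2]

theorem T_ext (s : PSeq) {l : Len} {u u' : (T s).obj l}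
    (h : ∀ (Y : Type) (k : W s ⟶ sing Y), (ev s k).app l u = (ev s k).app l u') : u = u' := by
  obtain ⟨y, φ, hy, rfl⟩ := exists_std s u
  obtain ⟨y', φ', hy', rfl⟩ := exists_std s u'
  have h' : ∀ (Y : Type) (k : W s ⟶ sing Y) (t : Itv l),
      (ev s k).app _ y.2 (φ t) = (ev s k).app _ y'.2 (φ' t) := fun Y k t => by
    have := h Y k
    rw [Hom.naturality, Hom.naturality] at this
    exact congrFun this t
  obtain ⟨k, -, hk⟩ := exists_height s 0
  have hφ : ∀ t, (φ t).1 = (φ' t).1 := fun t => by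
    have := h' _ k t
    rwa [hk y hy, hk y' hy', zero_add, zero_add] at this
  have e : y = y' := by
    refine std_ext s hy hy' fun Y k t t' _ ht => ?_
    have := h' Y k (φ.symm t)
    rw [Rep.apply_symm] at this
    refine this.trans (congrArg ((ev s k).app y'.1 y'.2) (Subtype.ext ?_))
    rw [← hφ, Rep.apply_symm, ht]
  subst e
  have : φ = φ' := Rep.ext fun t => Subtype.ext (hφ t)
  rw [this]

/-- Two composites of maps `δ_{i,A,B}` that are equal as maps of precubical sets induce the same
map of `𝒢`-spaces. -/
theorem GPath.tmap_congr {s s' : PSeq} {p q : GPath s s'} (h : p.wmap = q.wmap) :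
    p.tmap = q.tmap := by
  ext l u
  refine T_ext s' fun Y k => ?_
  have := (p.tmap_ev k).trans ((congrArg (fun f => ev s (f ≫ k)) h).trans (q.tmap_ev k).symm)
  exact congrArg (fun f => Hom.app f l u) this

end independence

/-! ### Concatenation -/

theorem Rep.ofEq_sum {a b a' b' : Len} (h : a = a') (h' : b = b') :
    (Rep.ofEq h).sum (Rep.ofEq h') = Rep.ofEq (congrArg₂ (· + ·) h h') := by
  subst h; subst h'; exact Rep.sum_id

theorem Rep.sum_ofEq_id {a a' b : Len} (h : a = a') :
    (Rep.ofEq h).sum (Rep.id b) = Rep.ofEq (congrArg (· + b) h) := by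
  subst h; exact Rep.sum_id

theorem Rep.sum_id_ofEq {a b b' : Len} (h : b = b') :
    (Rep.id a).sum (Rep.ofEq h) = Rep.ofEq (congrArg (a + ·) h) := by
  subst h; exact Rep.sum_id

namespace GSpace

variable {D E : GSpace}

theorem tmk_act_left {a b a' : Len} (α : Rep a a') (x : D.obj a') (y : E.obj b) :
    tmk (D.act α x) y = (tensor D E).act (α.sum (Rep.id b)) (tmk x y) := by
  have := tmk_act α (Rep.id b) x y
  rwa [E.act_id] at this

theorem tmk_act_right {a b b' : Len} (β : Rep b b') (x : D.obj a) (y : E.obj b') :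
    tmk x (E.act β y) = (tensor D E).act ((Rep.id a).sum β) (tmk x y) := by
  have := tmk_act (Rep.id a) β x y
  rwa [D.act_id] at this

theorem tensorLL_hom_ext {F G H : GSpace} {f g : tensor (tensor (tensor D E) F) G ⟶ H}
    (h : ∀ (a b c d : Len) (x : D.obj a) (y : E.obj b) (z : F.obj c) (w : G.obj d),
      f.app _ (tmk (tmk (tmk x y) z) w) = g.app _ (tmk (tmk (tmk x y) z) w)) : f = g := by
  refine tensorL_hom_ext fun l c d u z w => ?_
  obtain ⟨a, b, φ, x, y, rfl⟩ := tensor_ind u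
  rw [tmk_act_left, tmk_act_left, f.naturality, g.naturality, h]

theorem tensorRL_hom_ext {F G H : GSpace} {f g : tensor (tensor D (tensor E F)) G ⟶ H}
    (h : ∀ (a b c d : Len) (x : D.obj a) (y : E.obj b) (z : F.obj c) (w : G.obj d),
      f.app _ (tmk (tmk x (tmk y z)) w) = g.app _ (tmk (tmk x (tmk y z)) w)) : f = g := by
  refine tensorL_hom_ext fun a l d x u w => ?_
  obtain ⟨b, c, φ, y, z, rfl⟩ := tensor_ind u
  rw [tmk_act_right, tmk_act_left, f.naturality, g.naturality, h]

theorem cat_aux {D E F G EF FG X : GSpace} (f : tensor E F ⟶ EF) (g : tensor EF G ⟶ X)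
    (k : tensor F G ⟶ FG) (h : tensor E FG ⟶ X)
    (e : tensorMap f (𝟙 G) ≫ g = (assoc E F G).hom ≫ tensorMap (𝟙 E) k ≫ h) :
    tensorMap ((assoc D E F).hom ≫ tensorMap (𝟙 D) f) (𝟙 G) ≫ (assoc D EF G).hom ≫
        tensorMap (𝟙 D) g =
      (assoc (tensor D E) F G).hom ≫ tensorMap (𝟙 (tensor D E)) k ≫ (assoc D E FG).hom ≫
        tensorMap (𝟙 D) h := by
  refine tensorLL_hom_ext fun a b c d x y z w => ?_
  have e' := congrArg (fun f => Hom.app f (b + c + d) (tmk (tmk y z) w)) e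
  simp only [comp_app, tensorMap_tmk, assoc_hom_tmk, id_app, Hom.naturality] at e'
  simp only [comp_app, tensorMap_tmk, assoc_hom_tmk, id_app, Hom.naturality, tmk_act_left,
    tmk_act_right, act_act, e', Rep.assoc, Rep.sum_ofEq_id, Rep.sum_id_ofEq, Rep.ofEq_comp_ofEq]

theorem cat_head {D E F G FG X : GSpace} (f : tensor D E ⟶ X) (g : tensor F G ⟶ FG) :
    tensorMap ((assoc D E F).inv ≫ tensorMap f (𝟙 F)) (𝟙 G) ≫ (assoc X F G).hom ≫
        tensorMap (𝟙 X) g =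
      ((assoc D (tensor E F) G).hom ≫ tensorMap (𝟙 D) ((assoc E F G).hom ≫ tensorMap (𝟙 E) g)) ≫
        (assoc D E FG).inv ≫ tensorMap f (𝟙 FG) := by
  refine tensorRL_hom_ext fun a b c d x y z w => ?_
  simp only [comp_app, tensorMap_tmk, assoc_hom_tmk, assoc_inv_tmk, id_app, Hom.naturality,
    tmk_act_left, tmk_act_right, act_act, Rep.assoc, Rep.assoc', Rep.sum_ofEq_id, Rep.sum_id_ofEq,
    Rep.ofEq_comp_ofEq]

theorem cat_tail {D E E' G X X' : GSpace} (f : E ⟶ E') (g : tensor E' G ⟶ X')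
    (h : tensor E G ⟶ X) (k : X ⟶ X') (e : tensorMap f (𝟙 G) ≫ g = h ≫ k) :
    tensorMap (tensorMap (𝟙 D) f) (𝟙 G) ≫ (assoc D E' G).hom ≫ tensorMap (𝟙 D) g =
      ((assoc D E G).hom ≫ tensorMap (𝟙 D) h) ≫ tensorMap (𝟙 D) k := by
  refine tensorL_hom_ext fun a b c x y z => ?_
  have e' := congrArg (fun f => Hom.app f (b + c) (tmk y z)) e
  simp only [comp_app, tensorMap_tmk, id_app] at e'
  simp only [comp_app, tensorMap_tmk, assoc_hom_tmk, id_app, Hom.naturality, e']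

theorem cat_left {D E G G' X X' : GSpace} (f : G ⟶ G') (g : tensor E G' ⟶ X')
    (h : tensor E G ⟶ X) (k : X ⟶ X') (e : tensorMap (𝟙 E) f ≫ g = h ≫ k) :
    tensorMap (𝟙 (tensor D E)) f ≫ (assoc D E G').hom ≫ tensorMap (𝟙 D) g =
      ((assoc D E G).hom ≫ tensorMap (𝟙 D) h) ≫ tensorMap (𝟙 D) k := by
  refine tensorL_hom_ext fun a b c x y z => ?_
  have e' := congrArg (fun f => Hom.app f (b + c) (tmk y z)) e
  simp only [comp_app, tensorMap_tmk, id_app] at e'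
  simp only [comp_app, tensorMap_tmk, assoc_hom_tmk, id_app, Hom.naturality, e']

end GSpace

/-- The canonical isomorphism from `T s ⊗ T t` to `T (s.append t)`, given by the associators. -/
def cat : ∀ s t : PSeq, tensor (T s) (T t) ⟶ T (s.append t)
  | PSeq.one n, t => 𝟙 (tensor (FN n) (T t))
  | PSeq.cons n s, t => (GSpace.assoc (FN n) (T s) (T t)).hom ≫ tensorMap (𝟙 (FN n)) (cat s t)

theorem castT_cons (n : ℕ+) {s s' : PSeq} (h : s = s') :
    eqToHom (congrArg T (congrArg (PSeq.cons n) h)) =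
      tensorMap (𝟙 (FN n)) (eqToHom (congrArg T h)) := by
  subst h; exact tensorMap_id.symm

/-- The associativity of `cat`. -/
theorem cat_assoc (s t u : PSeq) :
    (tensorMap (cat s t) (𝟙 (T u)) ≫ cat (s.append t) u) ≫
        eqToHom (congrArg T (PSeq.append_assoc s t u)) =
      (GSpace.assoc _ _ _).hom ≫ tensorMap (𝟙 (T s)) (cat t u) ≫ cat s (t.append u) := by
  induction s with
  | one n =>
    show (tensorMap (𝟙 (tensor (FN n) (T t))) (𝟙 (T u)) ≫ ((GSpace.assoc _ _ _).hom ≫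
      tensorMap (𝟙 (FN n)) (cat t u))) ≫ 𝟙 (tensor (FN n) (T (t.append u))) = 
      (GSpace.assoc _ _ _).hom ≫ tensorMap (𝟙 (FN n)) (cat t u) ≫ 𝟙 _
    rw [tensorMap_id, Category.id_comp, Category.comp_id, Category.comp_id]
  | cons n s ih =>
    have h := cat_aux (D := FN n) (cat s t) (cat (s.append t) u ≫
      eqToHom (congrArg T (PSeq.append_assoc s t u))) (cat t u) (cat s (t.append u))
      ((Category.assoc _ _ _).symm.trans ih)
    have h' : tensorMap (𝟙 (FN n)) (cat (s.append t) u ≫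
        eqToHom (congrArg T (PSeq.append_assoc s t u))) =
        tensorMap (𝟙 (FN n)) (cat (s.append t) u) ≫
          eqToHom (congrArg T (PSeq.append_assoc (PSeq.cons n s) t u)) := by
      refine Eq.trans ?_ (congrArg (tensorMap (𝟙 (FN n)) (cat (s.append t) u) ≫ ·)
        (castT_cons n (PSeq.append_assoc s t u)).symm)
      rw [← tensorMap_comp, Category.comp_id]
    rw [h'] at h
    exact h

/-- The concatenation of chains `□[s] ⟶ K` and `□[t] ⟶ K`, as a map with the initial state of the
first chain. -/
def catW {K : PrecubicalSet} {t : PSeq} (y : W t ⟶ K) : ∀ (s : PSeq) (x : W s ⟶ K),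
    W.final s ≫ x = W.init t ≫ y →
      {f : W (s.append t) ⟶ K // W.init (s.append t) ≫ f = W.init s ≫ x}
  | PSeq.one n, x, h => ⟨W.desc (n := n) x y h, 
      (Category.assoc _ _ _).trans (congrArg (vtx n false ≫ ·) (W.inl_desc _ _ _))⟩
  | PSeq.cons n s, x, h =>
    ⟨W.desc (W.inl n s ≫ x) (catW y s (W.inr n s ≫ x) ((Category.assoc _ _ _).symm.trans h)).1 (by
        rw [(catW y s _ _).2, ← Category.assoc, ← Category.assoc, W.condition]),
      ((Category.assoc _ _ _).trans (congrArg (vtx n false ≫ ·) (W.inl_desc _ _ _))).trans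
        (Category.assoc _ _ _).symm⟩

section catW

variable {K : PrecubicalSet} {t : PSeq} (y : W t ⟶ K)

theorem catW_congr (s : PSeq) {x x' : W s ⟶ K} (e : x = x') {h : W.final s ≫ x = W.init t ≫ y}
    {h' : W.final s ≫ x' = W.init t ≫ y} : (catW y s x h).1 = (catW y s x' h').1 := by
  subst e; rfl

theorem final_catW (s : PSeq) (x : W s ⟶ K) (h : W.final s ≫ x = W.init t ≫ y) :
    W.final (s.append t) ≫ (catW y s x h).1 = W.final t ≫ y := by
  induction s with
  | one n => exact (Category.assoc _ _ _).trans (congrArg (W.final t ≫ ·) (W.inr_desc _ _ _))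
  | cons n s ih => exact (Category.assoc _ _ _).trans ((congrArg (W.final (s.append t) ≫ ·)
      (W.inr_desc _ _ _)).trans (ih _ _))

theorem catW_comp {L : PrecubicalSet} (k : K ⟶ L) (s : PSeq) (x : W s ⟶ K)
    (h : W.final s ≫ x = W.init t ≫ y) (h' : W.final s ≫ x ≫ k = W.init t ≫ y ≫ k) :
    (catW y s x h).1 ≫ k = (catW (y ≫ k) s (x ≫ k) h').1 := by
  induction s with
  | one n =>
    refine W.hom_ext ?_ ?_
    · exact (W.inl_desc_assoc _ _ _ _).trans (W.inl_desc _ _ _).symm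
    · exact (W.inr_desc_assoc _ _ _ _).trans (W.inr_desc _ _ _).symm
  | cons n s ih =>
    refine W.hom_ext ?_ ?_
    · exact (W.inl_desc_assoc _ _ _ _).trans ((Category.assoc _ _ _).trans
        (W.inl_desc _ _ _).symm)
    · refine (W.inr_desc_assoc _ _ _ _).trans (Eq.trans ?_ (W.inr_desc _ _ _).symm)
      refine (ih _ _ ?_).trans (catW_congr (y ≫ k) s (Category.assoc _ _ _))
      exact (congrArg (W.final s ≫ ·) (Category.assoc _ _ _)).trans
        ((Category.assoc _ _ _).symm.trans h')

theorem castW_cons (n : ℕ+) {s s' : PSeq} (h : s = s') (f : W (PSeq.cons n s') ⟶ K) :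
    W.inl n s ≫ eqToHom (congrArg W (congrArg (PSeq.cons n) h)) ≫ f = W.inl n s' ≫ f ∧
      W.inr n s ≫ eqToHom (congrArg W (congrArg (PSeq.cons n) h)) ≫ f =
        eqToHom (congrArg W h) ≫ W.inr n s' ≫ f := by
  subst h; simp

/-- The associativity of the concatenation of chains. -/
theorem catW_assoc {u : PSeq} (z : W u ⟶ K) (s : PSeq) (x : W s ⟶ K)
    (h : W.final s ≫ x = W.init t ≫ y) (h' : W.final t ≫ y = W.init u ≫ z)
    (h₁ : W.final (s.append t) ≫ (catW y s x h).1 = W.init u ≫ z)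
    (h₂ : W.final s ≫ x = W.init (t.append u) ≫ (catW z t y h').1) :
    (catW z (s.append t) (catW y s x h).1 h₁).1 =
      eqToHom (congrArg W (PSeq.append_assoc s t u)) ≫
        (catW (catW z t y h').1 s x h₂).1 := by
  induction s with
  | one n =>
    refine Eq.trans ?_ (Category.id_comp _).symm
    refine W.hom_ext ?_ ?_
    · exact (W.inl_desc _ _ _).trans ((W.inl_desc _ _ _).trans (W.inl_desc _ _ _).symm)
    · exact (W.inr_desc _ _ _).trans ((catW_congr z t (W.inr_desc _ _ _)).trans
        (W.inr_desc _ _ _).symm)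
  | cons n s ih =>
    have h₃ : W.final s ≫ W.inr n s ≫ x = W.init t ≫ y := (Category.assoc _ _ _).symm.trans h
    have e : W.inr n (s.append t) ≫ (catW y (PSeq.cons n s) x h).1 = (catW y s _ h₃).1 :=
      W.inr_desc _ _ _
    have c := castW_cons n (PSeq.append_assoc s t u) (catW (catW z t y h').1 (PSeq.cons n s) x h₂).1
    refine W.hom_ext ?_ ?_
    · exact (W.inl_desc _ _ _).trans ((W.inl_desc _ _ _).trans
        (c.1.trans (W.inl_desc _ _ _)).symm)
    · refine (W.inr_desc _ _ _).trans ((catW_congr z _ e (h' := ?_)).trans ((ih _ _ ?_ ?_).trans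
        (c.2.trans (congrArg (eqToHom _ ≫ ·) (W.inr_desc _ _ _))).symm))
      · rw [final_catW, h']
      · rw [final_catW, h']
      · exact (Category.assoc _ _ _).symm.trans h₂

end catW

namespace Gen

/-- The action of `δ_{i,A,B}` on the first factor of a concatenation. -/
def appendR (t : PSeq) : ∀ {s s' : PSeq}, Gen s s' → Gen (s.append t) (s'.append t)
  | _, _, last π => head π t
  | _, _, head π s => head π (s.append t)
  | _, _, tail n g => tail n (g.appendR t)

/-- The action of `δ_{i,A,B}` on the second factor of a concatenation. -/
def appendL {t t' : PSeq} (g : Gen t t') : ∀ s : PSeq, Gen (s.append t) (s.append t')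
  | PSeq.one n => tail n g
  | PSeq.cons n s => tail n (g.appendL s)

theorem appendR_tmap (t : PSeq) {s s' : PSeq} (g : Gen s s') :
    tensorMap g.tmap (𝟙 (T t)) ≫ cat s' t = cat s t ≫ (g.appendR t).tmap := by
  induction g with
  | @last m₁ m₂ n π =>
    show tensorMap π.merge (𝟙 (T t)) ≫ 𝟙 _ = ((GSpace.assoc (FN m₁) (FN m₂) (T t)).hom ≫
      tensorMap (𝟙 (FN m₁)) (𝟙 (tensor (FN m₂) (T t)))) ≫ (GSpace.assoc _ _ _).inv ≫
        tensorMap π.merge (𝟙 (T t))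
    rw [tensorMap_id, Category.comp_id, Category.comp_id, Iso.hom_inv_id_assoc]
  | head π s => exact cat_head π.merge (cat s t)
  | tail n g ih => exact cat_tail g.tmap (cat _ t) (cat _ t) (g.appendR t).tmap ih

theorem appendL_tmap {t t' : PSeq} (g : Gen t t') (s : PSeq) :
    tensorMap (𝟙 (T s)) g.tmap ≫ cat s t' = cat s t ≫ (g.appendL s).tmap := by
  induction s with
  | one n => exact (Category.comp_id _).trans (Category.id_comp _).symm
  | cons n s ih => exact cat_left g.tmap (cat s _) (cat s _) (g.appendL s).tmap ih

theorem appendR_wmap {K : PrecubicalSet} {t : PSeq} (y : W t ⟶ K) {s s' : PSeq} (g : Gen s s')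
    (x : W s' ⟶ K) (h : W.final s' ≫ x = W.init t ≫ y)
    (h' : W.final s ≫ g.wmap ≫ x = W.init t ≫ y) :
    (g.appendR t).wmap ≫ (catW y s' x h).1 = (catW y s (g.wmap ≫ x) h').1 := by
  induction g with
  | @last m₁ m₂ n π =>
    refine W.hom_ext ?_ (W.hom_ext ?_ ?_)
    · exact (W.inl_desc_assoc _ _ _ _).trans (((Category.assoc _ _ _).trans
        (congrArg (π.inA ≫ ·) (W.inl_desc _ _ _))).trans
          ((W.inl_desc _ _ _).trans (W.inl_desc_assoc (s := PSeq.one m₂) _ _ _ _)).symm)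
    · refine (congrArg (W.inl m₂ t ≫ ·) (W.inr_desc_assoc _ _ _ _)).trans ?_
      refine Eq.trans ?_ (congrArg (W.inl m₂ t ≫ ·) (W.inr_desc _ _ _)).symm
      exact (W.inl_desc_assoc _ _ _ _).trans (((Category.assoc _ _ _).trans
        (congrArg (π.inB ≫ ·) (W.inl_desc _ _ _))).trans
          ((W.inl_desc _ _ _).trans (W.inr_desc_assoc (s := PSeq.one m₂) _ _ _ _)).symm)
    · refine (congrArg (W.inr m₂ t ≫ ·) (W.inr_desc_assoc _ _ _ _)).trans ?_
      refine Eq.trans ?_ (congrArg (W.inr m₂ t ≫ ·) (W.inr_desc _ _ _)).symm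
      exact (W.inr_desc_assoc _ _ _ _).trans ((W.inr_desc _ _ _).trans (W.inr_desc _ _ _).symm)
  | @head m₁ m₂ n π s =>
    refine W.hom_ext ?_ (W.hom_ext ?_ ?_)
    · exact (W.inl_desc_assoc _ _ _ _).trans (((Category.assoc _ _ _).trans
        (congrArg (π.inA ≫ ·) (W.inl_desc _ _ _))).trans
          ((W.inl_desc _ _ _).trans ((W.inl_desc_assoc _ _ _ _).trans (Category.assoc _ _ _))).symm)
    · refine (congrArg (W.inl m₂ (s.append t) ≫ ·) (W.inr_desc_assoc _ _ _ _)).trans ?_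
      refine Eq.trans ?_ (congrArg (W.inl m₂ (s.append t) ≫ ·) (W.inr_desc _ _ _)).symm
      refine (W.inl_desc_assoc _ _ _ _).trans (((Category.assoc _ _ _).trans
        (congrArg (π.inB ≫ ·) (W.inl_desc _ _ _))).trans (Eq.symm ?_))
      exact (W.inl_desc _ _ _).trans ((congrArg (W.inl m₂ s ≫ ·) (W.inr_desc_assoc _ _ _ _)).trans
        ((W.inl_desc_assoc _ _ _ _).trans (Category.assoc _ _ _)))
    · refine (congrArg (W.inr m₂ (s.append t) ≫ ·) (W.inr_desc_assoc _ _ _ _)).trans ?_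
      refine Eq.trans ?_ (congrArg (W.inr m₂ (s.append t) ≫ ·) (W.inr_desc _ _ _)).symm
      refine (W.inr_desc_assoc _ _ _ _).trans ((W.inr_desc _ _ _).trans (Eq.symm ?_))
      refine (W.inr_desc _ _ _).trans (catW_congr y s ?_)
      exact (congrArg (W.inr m₂ s ≫ ·) (W.inr_desc_assoc _ _ _ _)).trans
        (W.inr_desc_assoc _ _ _ _)
  | tail n g ih =>
    refine W.hom_ext ?_ ?_
    · exact (W.inl_desc_assoc _ _ _ _).trans ((W.inl_desc _ _ _).trans
        ((W.inl_desc _ _ _).trans (W.inl_desc_assoc _ _ _ _)).symm)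
    · have e : W.inr n _ ≫ (tail n g).wmap ≫ x = g.wmap ≫ W.inr n _ ≫ x :=
        (W.inr_desc_assoc _ _ _ _).trans (Category.assoc _ _ _)
      have h1 : W.final _ ≫ W.inr n _ ≫ x = W.init t ≫ y := (Category.assoc _ _ _).symm.trans h
      have h2 : W.final _ ≫ g.wmap ≫ W.inr n _ ≫ x = W.init t ≫ y := by
        rw [← Category.assoc, g.final_wmap, h1]
      refine (W.inr_desc_assoc _ _ _ _).trans (((Category.assoc _ _ _).trans
        (congrArg ((g.appendR t).wmap ≫ ·) (W.inr_desc _ _ _))).trans ?_)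
      exact (ih _ h1 h2).trans ((W.inr_desc _ _ _).trans (catW_congr y _ e)).symm

theorem appendL_wmap {K : PrecubicalSet} {t t' : PSeq} (g : Gen t t') (y : W t' ⟶ K) (s : PSeq)
    (x : W s ⟶ K) (h : W.final s ≫ x = W.init t' ≫ y)
    (h' : W.final s ≫ x = W.init t ≫ g.wmap ≫ y) :
    (g.appendL s).wmap ≫ (catW y s x h).1 = (catW (g.wmap ≫ y) s x h').1 := by
  induction s with
  | one n =>
    refine W.hom_ext ?_ ?_
    · exact (W.inl_desc_assoc _ _ _ _).trans ((W.inl_desc _ _ _).trans (W.inl_desc _ _ _).symm)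
    · exact (W.inr_desc_assoc _ _ _ _).trans (((Category.assoc _ _ _).trans
        (congrArg (g.wmap ≫ ·) (W.inr_desc _ _ _))).trans (W.inr_desc _ _ _).symm)
  | cons n s ih =>
    refine W.hom_ext ?_ ?_
    · exact (W.inl_desc_assoc _ _ _ _).trans ((W.inl_desc _ _ _).trans (W.inl_desc _ _ _).symm)
    · exact (W.inr_desc_assoc _ _ _ _).trans (((Category.assoc _ _ _).trans
        (congrArg ((g.appendL s).wmap ≫ ·) (W.inr_desc _ _ _))).trans
          ((ih _ _ _).trans (W.inr_desc _ _ _).symm))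

end Gen

namespace GPath

theorem init_wmap {s s' : PSeq} (p : GPath s s') : W.init s ≫ p.wmap = W.init s' := by
  induction p with
  | nil s => exact Category.comp_id _
  | cons g p ih =>
    exact (Category.assoc _ _ _).symm.trans ((congrArg (· ≫ p.wmap) g.init_wmap).trans ih)

theorem final_wmap {s s' : PSeq} (p : GPath s s') : W.final s ≫ p.wmap = W.final s' := by
  induction p with
  | nil s => exact Category.comp_id _
  | cons g p ih =>
    exact (Category.assoc _ _ _).symm.trans ((congrArg (· ≫ p.wmap) g.final_wmap).trans ih)

def appendR (t : PSeq) : ∀ {s s' : PSeq}, GPath s s' → GPath (s.append t) (s'.append t)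
  | _, _, nil s => nil (s.append t)
  | _, _, cons g p => cons (g.appendR t) (p.appendR t)

def appendL (s : PSeq) : ∀ {t t' : PSeq}, GPath t t' → GPath (s.append t) (s.append t')
  | _, _, nil t => nil (s.append t)
  | _, _, cons g p => cons (g.appendL s) (p.appendL s)

theorem appendR_tmap (t : PSeq) {s s' : PSeq} (p : GPath s s') :
    tensorMap p.tmap (𝟙 (T t)) ≫ cat s' t = cat s t ≫ (p.appendR t).tmap := by
  induction p with
  | nil s =>
    show tensorMap (𝟙 (T s)) (𝟙 (T t)) ≫ cat s t = cat s t ≫ 𝟙 _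
    rw [tensorMap_id, Category.id_comp, Category.comp_id]
  | cons g p ih =>
    show tensorMap (g.tmap ≫ p.tmap) (𝟙 (T t)) ≫ cat _ t = cat _ t ≫ (g.appendR t).tmap ≫
      (p.appendR t).tmap
    rw [← Category.comp_id (𝟙 (T t)), tensorMap_comp, Category.assoc, ih, ← Category.assoc,
      g.appendR_tmap, Category.assoc]

theorem appendL_tmap (s : PSeq) {t t' : PSeq} (p : GPath t t') :
    tensorMap (𝟙 (T s)) p.tmap ≫ cat s t' = cat s t ≫ (p.appendL s).tmap := by
  induction p with
  | nil t =>
    show tensorMap (𝟙 (T s)) (𝟙 (T t)) ≫ cat s t = cat s t ≫ 𝟙 _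
    rw [tensorMap_id, Category.id_comp, Category.comp_id]
  | cons g p ih =>
    show tensorMap (𝟙 (T s)) (g.tmap ≫ p.tmap) ≫ cat s _ = cat s _ ≫ (g.appendL s).tmap ≫
      (p.appendL s).tmap
    rw [← Category.comp_id (𝟙 (T s)), tensorMap_comp, Category.assoc, ih, ← Category.assoc,
      g.appendL_tmap, Category.assoc]

variable {K : PrecubicalSet}

theorem appendR_wmap {t : PSeq} (y : W t ⟶ K) {s s' : PSeq} (p : GPath s s') (x : W s' ⟶ K)
    (h : W.final s' ≫ x = W.init t ≫ y) (h' : W.final s ≫ p.wmap ≫ x = W.init t ≫ y) :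
    (p.appendR t).wmap ≫ (catW y s' x h).1 = (catW y s (p.wmap ≫ x) h').1 := by
  induction p with
  | nil s => exact (Category.id_comp _).trans (catW_congr y s (Category.id_comp _).symm)
  | cons g p ih =>
    have h₁ : W.final _ ≫ p.wmap ≫ x = W.init t ≫ y := by
      rw [← Category.assoc, p.final_wmap, h]
    have h₂ : W.final _ ≫ g.wmap ≫ p.wmap ≫ x = W.init t ≫ y := by
      rw [← Category.assoc, g.final_wmap, h₁]
    refine (Category.assoc _ _ _).trans ((congrArg ((g.appendR t).wmap ≫ ·) (ih x h h₁)).trans ?_)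
    exact (g.appendR_wmap y _ h₁ h₂).trans (catW_congr y _ (Category.assoc _ _ _).symm)

theorem appendL_wmap {t t' : PSeq} (p : GPath t t') (y : W t' ⟶ K) (s : PSeq) (x : W s ⟶ K)
    (h : W.final s ≫ x = W.init t' ≫ y) (h' : W.final s ≫ x = W.init t ≫ p.wmap ≫ y) :
    (p.appendL s).wmap ≫ (catW y s x h).1 = (catW (p.wmap ≫ y) s x h').1 := by
  induction p with
  | nil t =>
    have : ∀ y' : W t ⟶ K, y = y' → ∀ h'', (catW y s x h).1 = (catW y' s x h'').1 := by
      rintro _ rfl _; rfl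
    exact (Category.id_comp _).trans (this _ (Category.id_comp _).symm _)
  | cons g p ih =>
    have h₁ : W.final s ≫ x = W.init _ ≫ p.wmap ≫ y := by
      rw [← Category.assoc, p.init_wmap, h]
    have h₂ : W.final s ≫ x = W.init _ ≫ g.wmap ≫ p.wmap ≫ y := by
      rw [← Category.assoc, g.init_wmap, h₁]
    have : ∀ y' : W _ ⟶ K, g.wmap ≫ p.wmap ≫ y = y' → ∀ h'',
        (catW (g.wmap ≫ p.wmap ≫ y) s x h₂).1 = (catW y' s x h'').1 := by
      rintro _ rfl _; rfl
    refine (Category.assoc _ _ _).trans ((congrArg ((g.appendL s).wmap ≫ ·) (ih y h h₁)).trans ?_)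
    exact (g.appendL_wmap _ s x h₁ h₂).trans (this _ (Category.assoc _ _ _).symm _)

end GPath

/-! ### Cube chains -/

/-- The set `K₀` of vertices. -/
abbrev Vert (K : PrecubicalSet) : Type := K.obj (op ⟨0⟩)

/-- A cube chain `□[s] ⟶ K` of length `n` from `α` to `β`: an object of `Ch_{α,β}(K, n)`. -/
structure Chain (K : PrecubicalSet) (α β : Vert K) (n : ℕ+) : Type where
  s : PSeq
  total : s.total = n
  x : W s ⟶ K
  init : yonedaEquiv (W.init s ≫ x) = α
  final : yonedaEquiv (W.final s ≫ x) = β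

namespace Chain

variable {K L : PrecubicalSet} {α β γ δ : Vert K} {m n p : ℕ+}

/-- A morphism of `Ch_{α,β}(K, n)`: a map over `K` which is a composite of maps `δ_{i,A,B}`. -/
@[ext] structure Hom (a b : Chain K α β n) : Type where
  f : W a.s ⟶ W b.s
  comp : ∃ p : GPath a.s b.s, p.wmap = f
  w : f ≫ b.x = a.x

/-- The category `Ch_{α,β}(K, n)`. -/
instance : SmallCategory (Chain K α β n) where
  Hom := Hom
  id a := ⟨𝟙 _, ⟨GPath.nil _, rfl⟩, Category.id_comp _⟩
  comp f g := ⟨f.f ≫ g.f, by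
    obtain ⟨p, hp⟩ := f.comp
    obtain ⟨q, hq⟩ := g.comp
    exact ⟨p.append q, by rw [GPath.wmap_append, hp, hq]⟩, by rw [Category.assoc, g.w, f.w]⟩
  id_comp f := Hom.ext (Category.id_comp _)
  comp_id f := Hom.ext (Category.comp_id _)
  assoc f g h := Hom.ext (Category.assoc _ _ _)

/-- The map of `𝒢`-spaces associated with a morphism of cube chains. -/
def Hom.tmap {a b : Chain K α β n} (f : Hom a b) : T a.s ⟶ T b.s := f.comp.choose.tmap

theorem Hom.tmap_eq {a b : Chain K α β n} (f : Hom a b) (p : GPath a.s b.s) (h : p.wmap = f.f) :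
    f.tmap = p.tmap := GPath.tmap_congr (f.comp.choose_spec.trans h.symm)

end Chain

/-- The functor `𝒟^𝒢_{α,β}(K, n)`. -/
def DG (K : PrecubicalSet) (α β : Vert K) (n : ℕ+) : Chain K α β n ⥤ GSpace where
  obj a := T a.s
  map f := Chain.Hom.tmap f
  map_id a := Chain.Hom.tmap_eq (𝟙 a) (GPath.nil _) rfl
  map_comp f g := by
    obtain ⟨p, hp⟩ := f.comp
    obtain ⟨q, hq⟩ := g.comp
    have h : (p.append q).wmap = (f ≫ g).f := by rw [GPath.wmap_append, hp, hq]; rfl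
    rw [Chain.Hom.tmap_eq (f ≫ g) _ h, Chain.Hom.tmap_eq f p hp, Chain.Hom.tmap_eq g q hq,
      GPath.tmap_append]

/-- The `𝒢`-space of execution paths `ℙ_{α,β} ‖K‖^𝒢`. -/
def PG (K : PrecubicalSet) (α β : Vert K) : GSpace := sigma fun n => colim (DG K α β n)

namespace Chain

variable {K L : PrecubicalSet} {α β γ δ : Vert K} {m n p : ℕ+}

/-- The canonical map from `T a.s` to `ℙ_{α,β} ‖K‖^𝒢`. -/
def incl (a : Chain K α β n) : T a.s ⟶ PG K α β where
  app _ x := ⟨n, CObj.mk (Φ := DG K α β n) a x⟩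
  continuous _ := continuous_sigmaMk.comp (CObj.mk_continuous (Φ := DG K α β n) a)
  naturality _ _ := rfl

theorem incl_path {a b : Chain K α β n} (p : GPath a.s b.s) (h : p.wmap ≫ b.x = a.x) :
    p.tmap ≫ b.incl = a.incl := by
  have e : Hom.tmap (⟨_, ⟨p, rfl⟩, h⟩ : a.Hom b) = p.tmap := Hom.tmap_eq _ p rfl
  ext l x
  refine congrArg (Sigma.mk n) (Quot.sound (r := fun x y : Σ j, ((DG K α β n).obj j).obj l => _)
    ⟨(⟨_, ⟨p, rfl⟩, h⟩ : a.Hom b), ?_⟩).symm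
  exact (congrArg (fun f => GSpace.Hom.app f l x) e).symm

theorem incl_eq {a : Chain K α β m} {b : Chain K α β n} (hn : m = n) (hs : a.s = b.s)
    (hx : a.x = eqToHom (congrArg W hs) ≫ b.x) :
    a.incl = eqToHom (congrArg T hs) ≫ b.incl := by
  subst hn
  obtain ⟨s, h1, x, h2, h3⟩ := a
  obtain ⟨s', h1', x', h2', h3'⟩ := b
  dsimp only at hs hx
  subst hs
  have : x = x' := hx.trans (Category.id_comp _)
  subst this
  exact (Category.id_comp _).symm

theorem exists_incl {l : Len} (u : (PG K α β).obj l) :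
    ∃ (n : ℕ+) (a : Chain K α β n) (x : (T a.s).obj l), u = a.incl.app l x := by
  obtain ⟨n, u⟩ := u
  obtain ⟨⟨a, x⟩, rfl⟩ := Quot.exists_rep u
  exact ⟨n, a, x, rfl⟩

theorem dcont_PG {l : Len} {Y Z : Type} [TopologicalSpace Y] [TopologicalSpace Z]
    {f : Z → (PG K α β).obj l → Y}
    (h : ∀ (n : ℕ+) (a : Chain K α β n),
      DCont fun w : Z × (T a.s).obj l => f w.1 (a.incl.app l w.2)) :
    DCont fun w : Z × (PG K α β).obj l => f w.1 w.2 :=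
  sigma_dcont fun n => CObj.prod_dcont (Φ := DG K α β n) (f := fun z u => f z ⟨n, u⟩)
    fun a => h n a

/-- Functions on the points of `ℙ_{α,β} ‖K‖^𝒢`. -/
def descFn {X : Type} {l : Len} (f : ∀ (n : ℕ+) (a : Chain K α β n), (T a.s).obj l → X)
    (h : ∀ (n : ℕ+) (a b : Chain K α β n) (p : GPath a.s b.s), p.wmap ≫ b.x = a.x →
      ∀ x, f n b (p.tmap.app l x) = f n a x) (u : (PG K α β).obj l) : X :=
  Quot.lift (fun y : Σ j, ((DG K α β u.1).obj j).obj l => f u.1 y.1 y.2) (by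
    rintro ⟨a, x⟩ ⟨b, y⟩ ⟨k, hk⟩
    dsimp only at k hk
    subst hk
    obtain ⟨p, hp⟩ := k.comp
    have e : (DG K α β u.1).map k = p.tmap := Hom.tmap_eq k p hp
    dsimp only
    rw [e]
    exact (h u.1 a b p (by rw [hp, k.w]) x).symm) u.2

/-- Maps out of `ℙ_{α,β} ‖K‖^𝒢`. -/
def desc {X : GSpace} (f : ∀ (n : ℕ+) (a : Chain K α β n), T a.s ⟶ X)
    (h : ∀ (n : ℕ+) (a b : Chain K α β n) (p : GPath a.s b.s), p.wmap ≫ b.x = a.x →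
      p.tmap ≫ f n b = f n a) : PG K α β ⟶ X where
  app l := descFn (fun n a => (f n a).app l) fun n a b p e x =>
    congrArg (fun k => GSpace.Hom.app k l x) (h n a b p e)
  continuous l := DCont.continuous ((dcont_PG (Z := Unit) (f := fun _ => descFn
    (fun n a => (f n a).app l) fun n a b p e x =>
      congrArg (fun k => GSpace.Hom.app k l x) (h n a b p e)) fun n a =>
    ((f n a).dcont l).comp' (DCont.mk continuous_snd)).comp'
      (DCont.mk (f := fun x => ((), x)) (by fun_prop)))
  naturality φ u := by
    obtain ⟨n, a, x, rfl⟩ := exists_incl u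
    exact (f n a).naturality φ x

theorem incl_desc {X : GSpace} (f : ∀ (n : ℕ+) (a : Chain K α β n), T a.s ⟶ X)
    (h : ∀ (n : ℕ+) (a b : Chain K α β n) (p : GPath a.s b.s), p.wmap ≫ b.x = a.x →
      p.tmap ≫ f n b = f n a) (a : Chain K α β n) : a.incl ≫ desc f h = f n a := rfl

theorem hom_ext {X : GSpace} {f g : PG K α β ⟶ X}
    (h : ∀ (n : ℕ+) (a : Chain K α β n), a.incl ≫ f = a.incl ≫ g) : f = g := by
  ext l u
  obtain ⟨n, a, x, rfl⟩ := exists_incl u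
  exact congrArg (fun k => GSpace.Hom.app k l x) (h n a)

section desc₂

variable {X : GSpace}
  (f : ∀ (m n : ℕ+) (a : Chain K α β m) (b : Chain K β γ n), tensor (T a.s) (T b.s) ⟶ X)
  (h₁ : ∀ (m n : ℕ+) (a a' : Chain K α β m) (b : Chain K β γ n) (p : GPath a.s a'.s),
    p.wmap ≫ a'.x = a.x → tensorMap p.tmap (𝟙 _) ≫ f m n a' b = f m n a b)
  (h₂ : ∀ (m n : ℕ+) (a : Chain K α β m) (b b' : Chain K β γ n) (p : GPath b.s b'.s),
    p.wmap ≫ b'.x = b.x → tensorMap (𝟙 _) p.tmap ≫ f m n a b' = f m n a b)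

def desc₂Fn {c d : Len} (u : (PG K α β).obj c) (v : (PG K β γ).obj d) : X.obj (c + d) :=
  descFn (fun m a x => descFn (fun n b y => (f m n a b).app _ (tmk x y)) (fun n b b' p e y => by
      have := congrArg (fun k => GSpace.Hom.app k _ (tmk x y)) (h₂ m n a b b' p e)
      simp only [comp_app, tensorMap_tmk, id_app] at this
      exact this) v) (fun m a a' p e x => by
    obtain ⟨n, b, y, rfl⟩ := exists_incl v
    have := congrArg (fun k => GSpace.Hom.app k _ (tmk x y)) (h₁ m n a a' b p e)
    simp only [comp_app, tensorMap_tmk, id_app] at this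
    exact this) u

theorem desc₂Fn_incl (a : Chain K α β m) (b : Chain K β γ n) {c d : Len} (x : (T a.s).obj c)
    (y : (T b.s).obj d) :
    desc₂Fn f h₁ h₂ (a.incl.app c x) (b.incl.app d y) = (f m n a b).app _ (tmk x y) := rfl

/-- Maps out of `ℙ_{α,β} ‖K‖^𝒢 ⊗ ℙ_{β,γ} ‖K‖^𝒢`. -/
def desc₂ : tensor (PG K α β) (PG K β γ) ⟶ X :=
  lift
    { fn := desc₂Fn f h₁ h₂
      dcont := fun c d => dcont_PG (f := fun (u : (PG K α β).obj c) (v : (PG K β γ).obj d) =>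
          desc₂Fn f h₁ h₂ u v) fun n b =>
        (dcont_PG (f := fun (y : (T b.s).obj d) (u : (PG K α β).obj c) =>
          desc₂Fn f h₁ h₂ u (b.incl.app d y)) fun m a => ((f m n a b).dcont _).comp'
            ((tmk_dcont c d).comp' (DCont.mk continuous_swap))).comp' (DCont.mk continuous_swap)
      map_act := fun φ ψ u v => by
        obtain ⟨m, a, x, rfl⟩ := exists_incl u
        obtain ⟨n, b, y, rfl⟩ := exists_incl v
        exact (congrArg ((f m n a b).app _) (tmk_act φ ψ x y)).trans
          ((f m n a b).naturality _ _) }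

theorem incl_desc₂ (a : Chain K α β m) (b : Chain K β γ n) :
    tensorMap a.incl b.incl ≫ desc₂ f h₁ h₂ = f m n a b :=
  tensor_hom_ext fun c d x y => by
    rw [comp_app, tensorMap_tmk, desc₂, lift_tmk]
    exact desc₂Fn_incl f h₁ h₂ a b x y

end desc₂

theorem hom_ext₂ {X : GSpace} {f g : tensor (PG K α β) (PG K β γ) ⟶ X}
    (h : ∀ (m n : ℕ+) (a : Chain K α β m) (b : Chain K β γ n),
      tensorMap a.incl b.incl ≫ f = tensorMap a.incl b.incl ≫ g) : f = g := by
  refine tensor_hom_ext fun c d u v => ?_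
  obtain ⟨m, a, x, rfl⟩ := exists_incl u
  obtain ⟨n, b, y, rfl⟩ := exists_incl v
  have := congrArg (fun k => GSpace.Hom.app k _ (tmk x y)) (h m n a b)
  simpa only [comp_app, tensorMap_tmk] using this

theorem hom_ext₃ {X : GSpace} {f g : tensor (tensor (PG K α β) (PG K β γ)) (PG K γ δ) ⟶ X}
    (h : ∀ (m n p : ℕ+) (a : Chain K α β m) (b : Chain K β γ n) (c : Chain K γ δ p),
      tensorMap (tensorMap a.incl b.incl) c.incl ≫ f =
        tensorMap (tensorMap a.incl b.incl) c.incl ≫ g) : f = g := by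
  refine tensorL_hom_ext fun c d e u v w => ?_
  obtain ⟨m, a, x, rfl⟩ := exists_incl u
  obtain ⟨n, b, y, rfl⟩ := exists_incl v
  obtain ⟨p, c, z, rfl⟩ := exists_incl w
  have := congrArg (fun k => GSpace.Hom.app k _ (tmk (tmk x y) z)) (h m n p a b c)
  simpa only [comp_app, tensorMap_tmk] using this

theorem meet (a : Chain K α β m) (b : Chain K β γ n) : W.final a.s ≫ a.x = W.init b.s ≫ b.x :=
  yonedaEquiv.injective (a.final.trans b.init.symm)

/-- The concatenation of cube chains. -/
abbrev concat (a : Chain K α β m) (b : Chain K β γ n) : Chain K α γ (m + n) where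
  s := a.s.append b.s
  total := by rw [PSeq.total_append, a.total, b.total]
  x := (catW b.x a.s a.x (meet a b)).1
  init := by rw [(catW b.x a.s a.x (meet a b)).2, a.init]
  final := by rw [final_catW, b.final]

/-- The canonical map associated with a concatenation. -/
def concatIncl (a : Chain K α β m) (b : Chain K β γ n) : T (a.s.append b.s) ⟶ PG K α γ :=
  (concat a b).incl

/-- The composition law, on chains `a` and `b`. -/
def compMap (a : Chain K α β m) (b : Chain K β γ n) : tensor (T a.s) (T b.s) ⟶ PG K α γ :=
  cat a.s b.s ≫ concatIncl a b

theorem compMap_left (a a' : Chain K α β m) (b : Chain K β γ n) (p : GPath a.s a'.s)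
    (e : p.wmap ≫ a'.x = a.x) : tensorMap p.tmap (𝟙 _) ≫ compMap a' b = compMap a b := by
  have h : (p.appendR b.s).wmap ≫ (concat a' b).x = (concat a b).x :=
    (p.appendR_wmap b.x a'.x _ (by rw [e, meet])).trans (catW_congr _ _ e)
  rw [compMap, ← Category.assoc, p.appendR_tmap, Category.assoc, compMap]
  exact congrArg (cat a.s b.s ≫ ·) (incl_path (a := concat a b) (b := concat a' b) _ h)

theorem compMap_right (a : Chain K α β m) (b b' : Chain K β γ n) (p : GPath b.s b'.s)
    (e : p.wmap ≫ b'.x = b.x) : tensorMap (𝟙 _) p.tmap ≫ compMap a b' = compMap a b := by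
  have h : (p.appendL a.s).wmap ≫ (concat a b').x = (concat a b).x := by
    refine (p.appendL_wmap b'.x a.s a.x _ (by rw [e, meet])).trans ?_
    unfold concat
    congr!
  rw [compMap, ← Category.assoc, p.appendL_tmap, Category.assoc, compMap]
  exact congrArg (cat a.s b.s ≫ ·) (incl_path (a := concat a b) (b := concat a b') _ h)

/-- The composition law of `‖K‖^𝒢`. -/
def compPG (K : PrecubicalSet) (α β γ : Vert K) :
    tensor (PG K α β) (PG K β γ) ⟶ PG K α γ :=
  desc₂ (fun _ _ a b => compMap a b) (fun _ _ a a' b p e => compMap_left a a' b p e)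
    fun _ _ a b b' p e => compMap_right a b b' p e

theorem incl_compPG (a : Chain K α β m) (b : Chain K β γ n) :
    tensorMap a.incl b.incl ≫ compPG K α β γ = cat a.s b.s ≫ concatIncl a b :=
  incl_desc₂ _ _ _ a b

theorem concatIncl_comp (a : Chain K α β m) (b : Chain K β γ n) (c : Chain K γ δ p) :
    tensorMap (concatIncl a b) c.incl ≫ compPG K α γ δ =
      cat (a.s.append b.s) c.s ≫ concatIncl (concat a b) c := incl_compPG (concat a b) c

theorem comp_concatIncl (a : Chain K α β m) (b : Chain K β γ n) (c : Chain K γ δ p) :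
    tensorMap a.incl (concatIncl b c) ≫ compPG K α β δ =
      cat a.s (b.s.append c.s) ≫ concatIncl a (concat b c) := incl_compPG a (concat b c)

theorem concatIncl_assoc (a : Chain K α β m) (b : Chain K β γ n) (c : Chain K γ δ p) :
    concatIncl (concat a b) c = eqToHom (congrArg T (PSeq.append_assoc a.s b.s c.s)) ≫
      concatIncl a (concat b c) :=
  incl_eq (add_assoc m n p) (PSeq.append_assoc a.s b.s c.s) (catW_assoc _ _ _ _ _ _ _ _)

theorem compPG_assoc (K : PrecubicalSet) (α β γ δ : Vert K) :
    tensorMap (compPG K α β γ) (𝟙 (PG K γ δ)) ≫ compPG K α γ δ =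
      (GSpace.assoc _ _ _).hom ≫ tensorMap (𝟙 (PG K α β)) (compPG K β γ δ) ≫ compPG K α β δ := by
  refine hom_ext₃ fun m n p a b c => ?_
  have e₁ : tensorMap (cat a.s b.s ≫ concatIncl a b) c.incl =
      tensorMap (cat a.s b.s) (𝟙 _) ≫ tensorMap (concatIncl a b) c.incl := by
    rw [← tensorMap_comp, Category.id_comp]
  have e₂ : tensorMap a.incl (cat b.s c.s ≫ concatIncl b c) =
      tensorMap (𝟙 _) (cat b.s c.s) ≫ tensorMap a.incl (concatIncl b c) := by
    rw [← tensorMap_comp, Category.id_comp]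
  have e₃ : tensorMap (tensorMap a.incl b.incl) c.incl ≫ (GSpace.assoc _ _ _).hom =
      (GSpace.assoc _ _ _).hom ≫ tensorMap a.incl (tensorMap b.incl c.incl) := by
    refine tensorL_hom_ext fun l₁ l₂ l₃ x y z => ?_
    simp only [comp_app, tensorMap_tmk, assoc_hom_tmk, Hom.naturality]
  rw [← Category.assoc, ← tensorMap_comp, incl_compPG, Category.comp_id, e₁, Category.assoc,
    concatIncl_comp, concatIncl_assoc, ← Category.assoc (cat (a.s.append b.s) c.s),
    ← Category.assoc, ← Category.assoc, cat_assoc, ← Category.assoc (tensorMap _ _), e₃,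
    Category.assoc, Category.assoc, Category.assoc, ← Category.assoc (tensorMap a.incl _),
    ← tensorMap_comp, incl_compPG, Category.comp_id, e₂, Category.assoc, comp_concatIncl]

end Chain

/-- The Moore flow `‖K‖^𝒢`. -/
def doubleBarObj (K : PrecubicalSet) : MooreFlow where
  state := Vert K
  P := PG K
  comp := Chain.compPG K
  assoc := Chain.compPG_assoc K

variable {K L : PrecubicalSet} {α β γ : Vert K} {m n : ℕ+}

/-- The image of a cube chain by a map of precubical sets. -/
abbrev Chain.map (k : K ⟶ L) (a : Chain K α β n) : Chain L (k.app _ α) (k.app _ β) n where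
  s := a.s
  total := a.total
  x := a.x ≫ k
  init := congrArg (k.app _) a.init
  final := congrArg (k.app _) a.final

/-- The map `ℙ_{α,β} ‖K‖^𝒢 ⟶ ℙ_{k(α),k(β)} ‖L‖^𝒢`. -/
def mapPG (k : K ⟶ L) (α β : Vert K) : PG K α β ⟶ PG L (k.app _ α) (k.app _ β) :=
  Chain.desc (fun _ a => (a.map k).incl) fun _ a b p e =>
    Chain.incl_path (a := a.map k) (b := b.map k) p (by rw [← Category.assoc, e])

theorem mapPG_comp (k : K ⟶ L) (α β γ : Vert K) :
    Chain.compPG K α β γ ≫ mapPG k α γ =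
      tensorMap (mapPG k α β) (mapPG k β γ) ≫ Chain.compPG L _ _ _ := by
  refine Chain.hom_ext₂ fun m n a b => ?_
  rw [← Category.assoc, Chain.incl_compPG, ← Category.assoc, ← tensorMap_comp]
  refine Eq.trans ?_ (Chain.incl_compPG (a.map k) (b.map k)).symm
  rw [Category.assoc]
  refine congrArg (cat a.s b.s ≫ ·) ((Chain.incl_eq (a := (Chain.concat a b).map k)
    (b := Chain.concat (a.map k) (b.map k)) rfl rfl ?_).trans (Category.id_comp _))
  exact (catW_comp b.x k a.s a.x _ (Chain.meet (a.map k) (b.map k))).trans (Category.id_comp _).symm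

theorem MooreFlow.hom_ext {X Y : MooreFlow} {st : X.state → Y.state}
    {P P' : ∀ α β, X.P α β ⟶ Y.P (st α) (st β)} {h h'} (e : ∀ α β, P α β = P' α β) :
    MooreFlow.Hom.mk st P h = MooreFlow.Hom.mk st P' h' := by
  obtain rfl : P = P' := funext fun α => funext fun β => e α β
  rfl

/-- The functor `K ↦ ‖K‖^𝒢` from precubical sets to Moore flows. -/
def doubleBar : PrecubicalSet ⥤ MooreFlow where
  obj := doubleBarObj
  map k := ⟨k.app _, mapPG k, mapPG_comp k⟩
  map_id K := MooreFlow.hom_ext fun _ _ => Chain.hom_ext fun _ a =>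
    (Chain.incl_eq (a := a.map (𝟙 K)) (b := a) rfl rfl
      ((Category.comp_id _).trans (Category.id_comp _).symm)).trans
        ((Category.id_comp _).trans (Category.comp_id _).symm)
  map_comp k k' := MooreFlow.hom_ext fun _ _ => Chain.hom_ext fun _ a =>
    (Chain.incl_eq (a := a.map (k ≫ k')) (b := (a.map k).map k') rfl rfl
      ((Category.assoc _ _ _).symm.trans (Category.id_comp _).symm)).trans (Category.id_comp _)

end

end MooreFlows

namespace MooreFlows

noncomputable section

open GSpace

/-! ### Box maps are determined by the images of the extremal vertices -/

/-! The assignment sending `K` to the colimit of the cube flows over the cubes of `K` is the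
pointwise left Kan extension of `regCubeFlow` along the Yoneda embedding. It therefore suffices to
equip `doubleBar` with a natural map `unit` from the cube flows and to check that each `‖K‖^𝒢` is
then the colimit over the category of cubes of `K`. Existence of the colimits and naturality of the
isomorphism follow formally from this.

The geometric input concerns a single cube. A path from a vertex `a` to a vertex `b` is increasing,
so it stays in the face whose extremal vertices are `a` and `b`, and this face is unique
(`BoxHom.eq_of_extremal`, `BoxHom.exists_of_le`). Being strictly increasing, the path is in exactly
one way a natural path of that face precomposed with its `L₁`-arc length, and both parts depend
continuously on it. Hence the path space from `a` to `b` is `𝔽_m N_m` (`realIso`). An intermediate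
vertex splits the directions of the face into those used before it and those used after it. This is
a partition `A ⊔ B`, and Moore composition becomes the map `Part.merge` (`Span.exists_part`,
`Part.merge_real`).

The unit sends a path of a face to the chain made of this one cube. It respects composition because
the map `φ_{A,B}` identifies the chain of the two subfaces with the whole face
(`Span.comp_desc_incl`).

Given a cocone on the cubes of `K`, a chain is evaluated by evaluating each of its cubes and
composing in the target flow. The maps `δ_{i,A,B}` are respected because the two subfaces lie in one
cube, on which the cocone is a semifunctor (`CubeCocone.merge_evalCube`, `CubeCocone.tmap_eval`).
Concatenation goes to composition (`CubeCocone.cat_eval`). The map so obtained is the only one,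
since every chain is the composite of its cubes (`inclW_cons`, `doubleBarObj_hom_ext`). -/

theorem bit_injective : Function.Injective bit := by
  intro b c h
  cases b <;> cases c <;> simp_all [bit]

theorem exists_bit {x : I} (h : x = 0 ∨ x = 1) : ∃ b, bit b = x := by
  rcases h with rfl | rfl
  · exact ⟨false, rfl⟩
  · exact ⟨true, rfl⟩

namespace BoxHom

variable {m m' n p : ℕ}

theorem cubeMap_inl (f : BoxHom m n) {j : Fin n} {b : Bool} (h : f.coord j = Sum.inl b)
    (x : Fin m → I) : cubeMap f x j = bit b := by
  show Sum.elim bit x (f.coord j) = bit b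
  rw [h]; rfl

theorem cubeMap_inr (f : BoxHom m n) {j : Fin n} {k : Fin m} (h : f.coord j = Sum.inr k)
    (x : Fin m → I) : cubeMap f x j = x k := by
  show Sum.elim bit x (f.coord j) = x k
  rw [h]; rfl

theorem cubeMap_comp (f : BoxHom m n) (g : BoxHom n p) (x : Fin m → I) :
    cubeMap (f.comp g) x = cubeMap g (cubeMap f x) := map_comp f g bit x

/-- The coordinate of the target that carries a given coordinate of the source. -/
def emb (f : BoxHom m n) (k : Fin m) : Fin n := (f.surj k).choose

theorem coord_emb (f : BoxHom m n) (k : Fin m) : f.coord (f.emb k) = Sum.inr k :=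
  (f.surj k).choose_spec

/-- The field `surj` gives only existence of a position carrying `k`. Two distinct such positions
would give `k < k` by `mono`, so the choice made in `emb` is forced. -/
theorem emb_eq (f : BoxHom m n) {j : Fin n} {k : Fin m} (h : f.coord j = Sum.inr k) :
    f.emb k = j := by
  rcases lt_trichotomy (f.emb k) j with h' | h' | h'
  · exact absurd (f.mono _ _ _ _ h' (f.coord_emb k) h) (lt_irrefl k)
  · exact h'
  · exact absurd (f.mono _ _ _ _ h' h (f.coord_emb k)) (lt_irrefl k)

theorem emb_strictMono (f : BoxHom m n) : StrictMono f.emb := by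
  intro k l h
  rcases lt_trichotomy (f.emb k) (f.emb l) with h' | h' | h'
  · exact h'
  · have := f.coord_emb k
    rw [h', f.coord_emb l] at this
    exact absurd (Sum.inr.inj this) h.ne'
  · exact absurd (f.mono _ _ _ _ h' (f.coord_emb l) (f.coord_emb k)) h.le.not_gt

/-- A constant coordinate takes the same value at both extremal vertices, while a free one takes the
values 0 and 1. The set of free coordinates can thus be read off from the two image vertices. -/
theorem mem_range_emb (f : BoxHom m n) {j : Fin n} :
    j ∈ Set.range f.emb ↔ cubeMap f (fun _ => 0) j ≠ cubeMap f (fun _ => 1) j := by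
  rcases h : f.coord j with b | k
  · rw [f.cubeMap_inl h, f.cubeMap_inl h]
    simp only [Set.mem_range, ne_eq, not_true_eq_false, iff_false, not_exists]
    intro k hk
    rw [← hk, f.coord_emb] at h
    cases h
  · rw [f.cubeMap_inr h, f.cubeMap_inr h]
    exact iff_of_true ⟨k, f.emb_eq h⟩ zero_ne_one

/-- A map of the box category is determined by the images of the initial and final states. -/
theorem eq_of_extremal (f g : BoxHom m n) (h0 : cubeMap f (fun _ => 0) = cubeMap g (fun _ => 0))
    (h1 : cubeMap f (fun _ => 1) = cubeMap g (fun _ => 1)) : f = g := by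
  -- A strictly increasing map on a finite ordinal is determined by its range.
  have hr : f.emb = g.emb := by
    refine (f.emb_strictMono.range_inj g.emb_strictMono).1 (Set.ext fun j => ?_)
    rw [mem_range_emb, mem_range_emb, h0, h1]
  refine BoxHom.ext (funext fun j => ?_)
  rcases hf : f.coord j with b | k
  · rcases hg : g.coord j with c | k
    · have := congrFun h0 j
      rw [f.cubeMap_inl hf, g.cubeMap_inl hg] at this
      rw [bit_injective this]
    · have := g.emb_eq hg
      rw [← hr] at this
      rw [← this, f.coord_emb] at hf
      cases hf
  · rw [← f.emb_eq hf, hr, g.coord_emb]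

/-- Each dimension is the number of coordinates in which the two extremal images differ. This has to
be known before the two box maps, a priori with different sources, can be compared. -/
theorem dim_eq_of_extremal (f : BoxHom m n) (g : BoxHom m' n)
    (h0 : cubeMap f (fun _ => 0) = cubeMap g (fun _ => 0))
    (h1 : cubeMap f (fun _ => 1) = cubeMap g (fun _ => 1)) : m = m' := by
  have hr : Set.range f.emb = Set.range g.emb := Set.ext fun j => by
    rw [mem_range_emb, mem_range_emb, h0, h1]
  have h := congrArg Set.ncard hr
  rwa [← Set.image_univ, ← Set.image_univ,
    Set.ncard_image_of_injective _ f.emb_strictMono.injective,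
    Set.ncard_image_of_injective _ g.emb_strictMono.injective, Set.ncard_univ, Set.ncard_univ,
    Nat.card_fin, Nat.card_fin] at h

/-- Two comparable vertices are the extremal vertices of a face. -/
theorem exists_of_le {a b : Fin n → I} (ha : IsVertex a) (hb : IsVertex b) (h : a ≤ b) :
    ∃ (m : ℕ) (f : BoxHom m n), cubeMap f (fun _ => 0) = a ∧ cubeMap f (fun _ => 1) = b := by
  classical
  choose c hc using fun j => exists_bit (ha j)
  -- The free coordinates are those in which the two vertices differ; each other coordinate is
  -- frozen at the common value `bit (c j)`.
  let A : Finset (Fin n) := Finset.univ.filter fun j => a j ≠ b j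
  let f : BoxHom A.card n :=
    { coord := fun j => if hj : j ∈ A then Sum.inr ((A.orderIsoOfFin rfl).symm ⟨j, hj⟩)
        else Sum.inl (c j)
      mono := fun i j k l hij hi hj => by
        split_ifs at hi hj with h1 h2
        cases hi
        cases hj
        exact (A.orderIsoOfFin rfl).symm.strictMono (show (⟨i, h1⟩ : A) < ⟨j, h2⟩ from hij)
      surj := fun k => ⟨A.orderIsoOfFin rfl k, (dif_pos (A.orderIsoOfFin rfl k).2).trans
        (congrArg Sum.inr ((A.orderIsoOfFin rfl).symm_apply_apply k))⟩ }
  -- Only here is `a ≤ b` used: it excludes a coordinate going from 1 down to 0.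
  have key : ∀ j, (a j ≠ b j → a j = 0 ∧ b j = 1) := by
    intro j hj
    rcases ha j with h1 | h1 <;> rcases hb j with h2 | h2
    · exact absurd (h1.trans h2.symm) hj
    · exact ⟨h1, h2⟩
    · have := h j
      rw [h1, h2] at this
      exact absurd this (by simp)
    · exact absurd (h1.trans h2.symm) hj
  refine ⟨A.card, f, funext fun j => ?_, funext fun j => ?_⟩
  · by_cases hj : j ∈ A
    · rw [f.cubeMap_inr (dif_pos hj), (key j (by simpa [A] using hj)).1]
    · rw [f.cubeMap_inl (dif_neg hj), hc]
  · by_cases hj : j ∈ A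
    · rw [f.cubeMap_inr (dif_pos hj), (key j (by simpa [A] using hj)).2]
    · rw [f.cubeMap_inl (dif_neg hj), hc]
      simpa [A] using hj

/-- The retraction of `cubeMap f` that forgets the constant coordinates. -/
def retract (f : BoxHom m n) (x : Fin n → I) (k : Fin m) : I := x (f.emb k)

theorem retract_continuous (f : BoxHom m n) : Continuous f.retract :=
  continuous_pi fun k => continuous_apply (f.emb k)

theorem retract_cubeMap (f : BoxHom m n) (x : Fin m → I) : f.retract (cubeMap f x) = x :=
  funext fun k => f.cubeMap_inr (f.coord_emb k) x

theorem cubeMap_injective (f : BoxHom m n) : Function.Injective (cubeMap f) :=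
  Function.LeftInverse.injective f.retract_cubeMap

/-- A frozen coordinate of `x` is squeezed between two equal values, so an order interval between
the extremal vertices of a face is contained in that face. -/
theorem cubeMap_retract (f : BoxHom m n) {x : Fin n → I} (h0 : cubeMap f (fun _ => 0) ≤ x)
    (h1 : x ≤ cubeMap f (fun _ => 1)) : cubeMap f (f.retract x) = x := by
  funext j
  rcases h : f.coord j with b | k
  · have h0 := h0 j
    have h1 := h1 j
    rw [f.cubeMap_inl h] at h0 h1 ⊢
    exact le_antisymm h0 h1
  · rw [f.cubeMap_inr h, retract, f.emb_eq h]

end BoxHom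

/-! ### Inversion of reparametrizations -/

namespace Rep

variable {a b : Len}

/-- In the order topology it is enough to see that the conditions `u < φ⁻¹(s)` and `φ⁻¹(s) < u` are
open. They mean `φ(u) < s` and `s < φ(u)`, and for fixed `u` both sides vary continuously. This is
what makes naturalization of paths continuous. -/
theorem dcont_symm : DCont fun φ : Rep a b => φ.symm := by
  intro n p
  have h := continuous_iff.1 p.continuous
  refine continuous_iff.2 (continuous_iff_continuousAt.2 fun ⟨x, s⟩ => ?_)
  refine tendsto_order.2 ⟨fun u hu => ?_, fun u hu => ?_⟩
  · have h1 : p x u < s := by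
      have := (p x).iso.strictMono hu
      exact this.trans_eq ((p x).apply_symm s)
    have h2 : Continuous fun w : Eucl n × Itv b => p w.1 u :=
      h.comp (continuous_fst.prodMk continuous_const)
    filter_upwards [h2.continuousAt.eventually_lt continuous_snd.continuousAt h1] with w hw
    exact (p w.1).iso.lt_iff_lt.1 (hw.trans_eq ((p w.1).apply_symm w.2).symm)
  · have h1 : s < p x u := by
      have := (p x).iso.strictMono hu
      exact ((p x).apply_symm s).symm.trans_lt this
    have h2 : Continuous fun w : Eucl n × Itv b => p w.1 u :=
      h.comp (continuous_fst.prodMk continuous_const)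
    filter_upwards [continuous_snd.continuousAt.eventually_lt h2.continuousAt h1] with w hw
    exact (p w.1).iso.lt_iff_lt.1 (((p w.1).apply_symm w.2).trans_lt hw)

end Rep

/-! ### Naturalization of the paths of the regular cubes -/

/-- The sum of the coordinates of a point of the cube. -/
def height {m : ℕ} (x : Fin m → I) : ℝ := ∑ i, (x i : ℝ)

theorem height_continuous {m : ℕ} : Continuous (height (m := m)) := by
  unfold height; fun_prop

theorem height_strictMono {m : ℕ} : StrictMono (height (m := m)) := fun x y h => by
  obtain ⟨h1, i, h2⟩ := Pi.lt_def.1 h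
  exact Finset.sum_lt_sum (fun i _ => h1 i) ⟨i, Finset.mem_univ i, h2⟩

theorem height_zero {m : ℕ} : height (fun _ : Fin m => (0 : I)) = 0 := by simp [height]

theorem height_one {m : ℕ} : height (fun _ : Fin m => (1 : I)) = m := by simp [height]

/-- A strictly increasing path from the initial to the final state of the cube. -/
structure Diag (m : ℕ+) (l : Len) : Type where
  path : C(Itv l, Fin m → I)
  strictMono : StrictMono path
  bot : path (Itv.bot l) = fun _ => 0
  top : path (Itv.top l) = fun _ => 1

namespace Diag

variable {m : ℕ+} {l l' : Len} (γ : Diag m l)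

theorem height_mem (t : Itv l) : height (γ.path t) ∈ Set.Icc (0 : ℝ) (lenN m).1 := by
  constructor
  · exact Finset.sum_nonneg fun i _ => (γ.path t i).2.1
  · refine (height_strictMono.monotone
      (γ.strictMono.monotone (show t ≤ Itv.top l from t.2.2))).trans_eq ?_
    rw [γ.top, height_one]; rfl

/-- The `L₁`-arc length as a reparametrization. -/
def arc : Rep l (lenN m) :=
  ⟨StrictMono.orderIsoOfSurjective (fun t => (⟨height (γ.path t), γ.height_mem t⟩ : Itv (lenN m)))
    (fun _ _ h => height_strictMono (γ.strictMono h)) (by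
      -- Surjectivity is the intermediate value theorem: the height runs from 0 to `m` along the
      -- path.
      have hp : PreconnectedSpace (Itv l) := Subtype.preconnectedSpace isPreconnected_Icc
      intro c
      refine mem_range_of_exists_le_of_exists_ge
        (Continuous.subtype_mk (height_continuous.comp γ.path.continuous) _)
        ⟨Itv.bot l, ?_⟩ ⟨Itv.top l, ?_⟩
      · show height (γ.path (Itv.bot l)) ≤ c.1
        rw [γ.bot, height_zero]
        exact c.2.1
      · show c.1 ≤ height (γ.path (Itv.top l))
        rw [γ.top, height_one]
        exact c.2.2)⟩

/-- The natural path with the same image. -/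
def natural : N m :=
  ⟨⟨γ.path.comp γ.arc.symm.toCM, by
    have hb : (γ.path.comp γ.arc.symm.toCM) (Itv.bot _) = fun _ => 0 :=
      (congrArg γ.path γ.arc.symm.apply_bot).trans γ.bot
    have ht : (γ.path.comp γ.arc.symm.toCM) (Itv.top _) = fun _ => 1 :=
      (congrArg γ.path γ.arc.symm.apply_top).trans γ.top
    have hp : IsCubePath (γ.path.comp γ.arc.symm.toCM) := isCubePath_iff.2
      ⟨by rw [hb]; exact fun _ => Or.inl rfl, by rw [ht]; exact fun _ => Or.inr rfl,
        γ.strictMono.comp γ.arc.symm.iso.strictMono⟩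
    refine ⟨hp.rep _, hb, ht, fun t => ?_⟩
    rw [hb]
    simp only [Set.Icc.coe_zero, zero_sub, abs_neg,
      abs_of_nonneg ((γ.path.comp γ.arc.symm.toCM) t _).2.1]
    -- The height of the new path at time `t` is the arc length evaluated at its own inverse at `t`.
    exact congrArg Subtype.val (γ.arc.apply_symm t)⟩⟩

end Diag

/-! ### Path spaces of the regular cubes as free `𝒢`-spaces on natural paths. -/

theorem isCubePath_of_isPath {n : ℕ} {l : Len} {γ : C(Itv l, Fin n → I)}
    (h : (regCube n).IsPath γ) : IsCubePath γ := by
  -- `IsPath` speaks of the path rescaled to length 1; rescaling back is a reparametrization, under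
  -- which cube paths are stable.
  have e : (γ.comp (mu l).symm.toCM).comp (mu l).toCM = γ :=
    ContinuousMap.ext fun t => congrArg γ ((mu l).symm_apply t)
  exact e ▸ IsCubePath.rep h (mu l)

/-- The path of the cube underlying a point of a path space. -/
abbrev under {n : ℕ} {a b : (regCube n).state} {l : Len}
    (γ : ((regCube n).pathSpace a b).obj l) : C(Itv l, Fin n → I) := γ.val.1

theorem under_strictMono {n : ℕ} {a b : (regCube n).state} {l : Len}
    (γ : ((regCube n).pathSpace a b).obj l) : StrictMono (under γ) :=
  (isCubePath_iff.1 (isCubePath_of_isPath γ.val.2.1)).2.2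

theorem under_bot {n : ℕ} {a b : (regCube n).state} {l : Len}
    (γ : ((regCube n).pathSpace a b).obj l) : under γ (Itv.bot l) = a.1 := γ.val.2.2.1

theorem under_top {n : ℕ} {a b : (regCube n).state} {l : Len}
    (γ : ((regCube n).pathSpace a b).obj l) : under γ (Itv.top l) = b.1 := γ.val.2.2.2

/-- A monotone path remains between its two end vertices, hence in the face that they span, where
forgetting the frozen coordinates loses nothing. -/
theorem cubeMap_retract_under {m n : ℕ} (δ : BoxHom m n) {a b : (regCube n).state}
    (ha : cubeMap δ (fun _ => 0) = a.1) (hb : cubeMap δ (fun _ => 1) = b.1) {l : Len}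
    (γ : ((regCube n).pathSpace a b).obj l) (t : Itv l) :
    cubeMap δ (δ.retract (under γ t)) = under γ t := by
  refine δ.cubeMap_retract ?_ ?_
  · exact (ha.trans (under_bot γ).symm).trans_le ((under_strictMono γ).monotone t.2.1)
  · exact ((under_strictMono γ).monotone t.2.2).trans_eq ((under_top γ).trans hb.symm)

section real

variable {m : ℕ+} {n : ℕ} (δ : BoxHom m n) {a b : (regCube n).state}
  (ha : cubeMap δ (fun _ => 0) = a.1) (hb : cubeMap δ (fun _ => 1) = b.1)

/-- The paths in the regular cube given by the natural paths of a face with extremal vertices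
`a` and `b`. -/
def real : FN m ⟶ (regCube n).pathSpace a b where
  app l x := ⟨⟨(cubeMap δ).comp (x.val.2.val.1.comp x.val.1.toCM), by
      exact (IsCubePath.map δ ((isCubePath_of_isPath x.val.2.val.2.1).rep _)).rep _,
    (congrArg (fun t => cubeMap δ (x.val.2.val.1 t)) x.val.1.apply_bot).trans
      ((congrArg (cubeMap δ) x.val.2.val.2.2.1).trans ha),
    (congrArg (fun t => cubeMap δ (x.val.2.val.1 t)) x.val.1.apply_top).trans
      ((congrArg (cubeMap δ) x.val.2.val.2.2.2.1).trans hb)⟩⟩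
  continuous l := by
    refine DCont.continuous fun k p => path_continuous_iff.2 ?_
    have h := KD.val_dcont p
    have h1 := Rep.continuous_iff.1 (continuous_fst.comp h)
    have h2 := path_continuous_iff.1 (continuous_snd.comp h)
    exact (cubeMap δ).continuous.comp (h2.comp (continuous_fst.prodMk h1))
  naturality _ _ := rfl

theorem real_apply {l : Len} (x : (FN m).obj l) (t : Itv l) :
    ((real δ ha hb).app l x).val.1 t = cubeMap δ (x.val.2.val.1 (x.val.1 t)) := rfl

/-- The height of a natural path at time `t` is `t`, so the reparametrization is recovered as the
height of the composite path. Inverting it then recovers the natural path. -/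
theorem real_injective (l : Len) : Function.Injective ((real δ ha hb).app l) := by
  intro x y h
  have h1 : ∀ t, x.val.2.val.1 (x.val.1 t) = y.val.2.val.1 (y.val.1 t) := fun t =>
    δ.cubeMap_injective (by rw [← real_apply δ ha hb, ← real_apply δ ha hb, h])
  have h2 : x.val.1 = y.val.1 := Rep.ext fun t => Subtype.ext (by
    rw [← natural_sum x.val.2, ← natural_sum y.val.2, h1])
  have h3 : x.val.2 = y.val.2 := congrArg KD.mk (Subtype.ext (ContinuousMap.ext fun t => by
    have := h1 (x.val.1.symm t)
    rwa [← h2, Rep.apply_symm] at this))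
  exact congrArg KD.mk (Prod.ext h2 h3)

/-- The image of a path of the regular cube in the face that it spans. -/
def toDiag {l : Len} (γ : ((regCube n).pathSpace a b).obj l) : Diag m l where
  path := (⟨δ.retract, δ.retract_continuous⟩ : C(Fin n → I, Fin m → I)).comp (under γ)
  strictMono := by
    -- The retraction is not injective on the whole cube, but on this path it is inverted by
    -- `cubeMap δ`.
    refine Monotone.strictMono_of_injective
      (fun s t hst k => (under_strictMono γ).monotone hst _) fun s t hst => ?_
    exact (under_strictMono γ).injective ((cubeMap_retract_under δ ha hb γ s).symm.trans
      ((congrArg (cubeMap δ) hst).trans (cubeMap_retract_under δ ha hb γ t)))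
  bot := (congrArg δ.retract ((under_bot γ).trans ha.symm)).trans (δ.retract_cubeMap _)
  top := (congrArg δ.retract ((under_top γ).trans hb.symm)).trans (δ.retract_cubeMap _)

/-- The naturalization of the paths from `a` to `b`. -/
def realInvFn (l : Len) (γ : ((regCube n).pathSpace a b).obj l) : (FN m).obj l :=
  KD.mk ((toDiag δ ha hb γ).arc, (toDiag δ ha hb γ).natural)

/-- The naturalized path contains the inverse of the arc length, which cancels against the arc
length itself. What remains is to retract onto the face and embed it back. -/
theorem real_realInvFn {l : Len} (γ : ((regCube n).pathSpace a b).obj l) :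
    (real δ ha hb).app l (realInvFn δ ha hb l γ) = γ := by
  refine congrArg KD.mk (Subtype.ext (ContinuousMap.ext fun t => ?_))
  show cubeMap δ ((toDiag δ ha hb γ).path ((toDiag δ ha hb γ).arc.symm
    ((toDiag δ ha hb γ).arc t))) = γ.val.1 t
  rw [Rep.symm_apply]
  exact cubeMap_retract_under δ ha hb γ t

/-- The map `real` is an isomorphism. -/
def realIso : FN m ≅ (regCube n).pathSpace a b where
  hom := real δ ha hb
  inv :=
    { app := realInvFn δ ha hb
      continuous := fun l => by
        refine DCont.continuous fun k p => ?_
        have h := path_continuous_iff.1 p.continuous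
        -- Continuity is tested on plots. The arc length is the height of the retracted path, so it
        -- is jointly continuous; its inverse is so by `dcont_symm`, and therefore also the natural
        -- path.
        have h1 : Continuous fun w : Eucl k × Itv l => (toDiag δ ha hb (p w.1)).path w.2 :=
          δ.retract_continuous.comp h
        have h2 : Continuous fun x => (toDiag δ ha hb (p x)).arc :=
          Rep.continuous_iff.2 (Continuous.subtype_mk (height_continuous.comp h1) _)
        have h3 : Continuous fun x => (toDiag δ ha hb (p x)).arc.symm :=
          Rep.dcont_symm ⟨_, h2⟩
        have h4 : Continuous fun x => (toDiag δ ha hb (p x)).natural :=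
          path_continuous_iff.2 (h1.comp (continuous_fst.prodMk (Rep.continuous_iff.1 h3)))
        exact KD.mk_dcont ⟨_, h2.prodMk h4⟩
      -- Naturality of the inverse needs no computation with arc lengths: it holds after applying
      -- the natural injection `real`.
      naturality := fun φ γ => real_injective δ ha hb _ (by
        rw [(real δ ha hb).naturality, real_realInvFn, real_realInvFn]) }
  hom_inv_id := by
    ext l x
    exact real_injective δ ha hb l (real_realInvFn δ ha hb _)
  inv_hom_id := by
    ext l γ
    exact real_realInvFn δ ha hb γ

end real

/-- A face of positive dimension with prescribed extremal vertices. -/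
structure Span {n : ℕ} (a b : (regCube n).state) : Type where
  dim : ℕ+
  hom : BoxHom dim n
  bot : cubeMap hom (fun _ => 0) = a.1
  top : cubeMap hom (fun _ => 1) = b.1

namespace Span

variable {n : ℕ} {a b c : (regCube n).state}

/-- Box maps are determined by their extremal images. This allows definitions by cases on the
existence of a face, with an arbitrary choice when there is one. -/
instance : Subsingleton (Span a b) where
  allEq s t := by
    obtain ⟨m, δ, h0, h1⟩ := s
    obtain ⟨m', δ', h0', h1'⟩ := t
    obtain rfl : m = m' := PNat.coe_injective
      (δ.dim_eq_of_extremal δ' (h0.trans h0'.symm) (h1.trans h1'.symm))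
    obtain rfl : δ = δ' := δ.eq_of_extremal δ' (h0.trans h0'.symm) (h1.trans h1'.symm)
    rfl

theorem nonempty_of_lt (h : (show Fin n → I from a.1) < b.1) : Nonempty (Span a b) := by
  obtain ⟨m, δ, h0, h1⟩ := BoxHom.exists_of_le a.2 b.2 h.le
  -- A 0-dimensional cube has a single vertex, so dimension 0 would force `a = b`.
  have hm : 0 < m := by
    refine Nat.pos_of_ne_zero fun hm => ?_
    subst hm
    exact h.ne (h0.symm.trans ((congrArg _ (Subsingleton.elim _ _)).trans h1))
  exact ⟨⟨⟨m, hm⟩, δ, h0, h1⟩⟩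

theorem nonempty_of_path {l : Len} (γ : ((regCube n).pathSpace a b).obj l) :
    Nonempty (Span a b) := by
  have h : under γ (Itv.bot l) < under γ (Itv.top l) :=
    under_strictMono γ (show (0 : ℝ) < l.1 from l.2)
  exact nonempty_of_lt (((under_bot γ).symm.trans_lt h).trans_eq (under_top γ))

/-- Positivity of the dimension supplies a coordinate, with index 0, in which the extremal vertices
of the source cube differ; `cubeMap` preserves strict inequalities. -/
theorem lt (s : Span a b) : (show Fin n → I from a.1) < b.1 :=
  (s.bot.symm.trans_lt (cubeMap_strictMono s.hom
    (Pi.lt_def.2 ⟨fun _ => zero_le_one, ⟨0, s.dim.2⟩, zero_lt_one⟩))).trans_eq s.top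

/-- The isomorphism `real` for a given face. -/
def iso (s : Span a b) : FN s.dim ≅ (regCube n).pathSpace a b := realIso s.hom s.bot s.top

/-- Maps out of a path space are determined by their restrictions to the natural paths. -/
theorem hom_ext {X : GSpace} {f g : (regCube n).pathSpace a b ⟶ X}
    (h : ∀ s : Span a b, s.iso.hom ≫ f = s.iso.hom ≫ g) : f = g := by
  ext l γ
  obtain ⟨s⟩ := nonempty_of_path γ
  exact congrArg (fun k => Hom.app k l γ) ((cancel_epi s.iso.hom).1 (h s))

/-- Maps out of a path space. -/
def desc {X : GSpace} (f : ∀ s : Span a b, FN s.dim ⟶ X) : (regCube n).pathSpace a b ⟶ X :=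
  open Classical in
  -- Without such a face the path space is empty at every length by `nonempty_of_path`, so the
  -- second branch defines a map vacuously.
  if h : Nonempty (Span a b) then h.some.iso.inv ≫ f h.some
  else
    { app := fun _ γ => (h (nonempty_of_path γ)).elim
      continuous := fun _ => continuous_iff_continuousAt.2 fun γ => (h (nonempty_of_path γ)).elim
      naturality := fun _ γ => (h (nonempty_of_path γ)).elim }

theorem hom_desc {X : GSpace} (f : ∀ s : Span a b, FN s.dim ⟶ X) (s : Span a b) :
    s.iso.hom ≫ desc f = f s := by
  have h : Nonempty (Span a b) := ⟨s⟩
  obtain rfl : s = h.some := Subsingleton.elim _ _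
  rw [desc, dif_pos h, Iso.hom_inv_id_assoc]

end Span

/-! ### Subdivision of faces -/

namespace Part

variable {m₁ m₂ m : ℕ+} {n : ℕ} (π : Part m₁ m₂ m) (δ : BoxHom m n)

/-- The composition of paths of the regular cube restricts to the map `merge`. -/
theorem merge_real {a b c : (regCube n).state}
    (ha : cubeMap (π.faceA.comp δ) (fun _ => 0) = a.1)
    (hb : cubeMap (π.faceA.comp δ) (fun _ => 1) = b.1)
    (hb' : cubeMap (π.faceB.comp δ) (fun _ => 0) = b.1)
    (hc : cubeMap (π.faceB.comp δ) (fun _ => 1) = c.1)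
    (ha' : cubeMap δ (fun _ => 0) = a.1) (hc' : cubeMap δ (fun _ => 1) = c.1) :
    tensorMap (real (π.faceA.comp δ) ha hb) (real (π.faceB.comp δ) hb' hc) ≫
        lift ((regCube n).compBil a b c) = π.merge ≫ real δ ha' hc' := by
  refine tensor_hom_ext fun l l' x y => ?_
  rw [comp_app, comp_app, tensorMap_tmk, lift_tmk, merge_tmk]
  refine congrArg KD.mk (Subtype.ext (ContinuousMap.ext fun t => ?_))
  -- The identification of lengths in `Part.comp` and the one in `Part.merge` are mutually inverse.
  -- After that, `cubeMap δ` passes inside the gluing and the reparametrizations act on each half.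
  have e : ∀ u, Rep.ofEq π.len_eq.symm (Rep.ofEq π.len_eq u) = u := fun u =>
    Subtype.ext (by rw [Rep.ofEq_val, Rep.ofEq_val])
  show glue (fun t => cubeMap (π.faceA.comp δ) (x.val.2.val.1 (x.val.1 t)))
      (fun t => cubeMap (π.faceB.comp δ) (y.val.2.val.1 (y.val.1 t))) t =
    cubeMap δ (glue (fun t => cubeMap π.faceA (x.val.2.val.1 t))
      (fun t => cubeMap π.faceB (y.val.2.val.1 t)) (Rep.ofEq π.len_eq.symm
        (Rep.ofEq π.len_eq (x.val.1.sum y.val.1 t))))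
  rw [e]
  simp only [BoxHom.cubeMap_comp]
  refine Eq.trans ?_ (comp_glue (cubeMap δ) _).symm
  exact glue_sum (fun t => cubeMap δ (cubeMap π.faceA (x.val.2.val.1 t)))
    (fun t => cubeMap δ (cubeMap π.faceB (y.val.2.val.1 t))) x.val.1 y.val.1 t

end Part

namespace Span

variable {n : ℕ} {a b c : (regCube n).state}

/-- The face spanned by `a < c` is subdivided by an intermediate vertex. -/
theorem exists_part (s : Span a b) (t : Span b c) (u : Span a c) :
    ∃ π : Part s.dim t.dim u.dim, π.faceA.comp u.hom = s.hom ∧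
      π.faceB.comp u.hom = t.hom := by
  classical
  -- `A` consists of the directions of the large face already completed at `b`; those in its
  -- complement are still at 0 there.
  let A : Finset (Fin u.dim) := Finset.univ.filter fun k => b.1 (u.hom.emb k) = 1
  have hab := s.lt
  have hbc := t.lt
  have hA : ∀ k, k ∉ A → b.1 (u.hom.emb k) = 0 := fun k hk =>
    (b.2 _).resolve_right fun h => hk (by simp [A, h])
  have hA' : ∀ k, k ∈ A → b.1 (u.hom.emb k) = 1 := fun k hk => by simpa [A] using hk
  -- The intermediate vertex belongs to the face `u` because it lies between `a` and `c`. By `e1`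
  -- and `e2` it is the final state of the first subface and the initial state of the second.
  have hbr : cubeMap u.hom (u.hom.retract b.1) = b.1 :=
    u.hom.cubeMap_retract (u.bot.trans_le hab.le) (hbc.le.trans_eq u.top.symm)
  have e1 : cubeMap (face A rfl false) (fun _ => 1) = u.hom.retract b.1 := by
    funext k
    by_cases hk : k ∈ A
    · rw [BoxHom.cubeMap_inr _ (dif_pos hk)]
      exact (hA' k hk).symm
    · rw [BoxHom.cubeMap_inl _ (dif_neg hk)]
      exact (hA k hk).symm
  have e2 : cubeMap (face Aᶜ rfl true) (fun _ => 0) = u.hom.retract b.1 := by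
    funext k
    by_cases hk : k ∈ A
    · rw [BoxHom.cubeMap_inl _ (dif_neg (by simpa using hk))]
      exact (hA' k hk).symm
    · rw [BoxHom.cubeMap_inr _ (dif_pos (by simpa using hk))]
      exact (hA k hk).symm
  have f1 : cubeMap ((face A rfl false).comp u.hom) (fun _ => 0) = a.1 := by
    rw [BoxHom.cubeMap_comp, face_zero, u.bot]
  have f2 : cubeMap ((face A rfl false).comp u.hom) (fun _ => 1) = b.1 := by
    rw [BoxHom.cubeMap_comp, e1, hbr]
  have f3 : cubeMap ((face Aᶜ rfl true).comp u.hom) (fun _ => 0) = b.1 := by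
    rw [BoxHom.cubeMap_comp, e2, hbr]
  have f4 : cubeMap ((face Aᶜ rfl true).comp u.hom) (fun _ => 1) = c.1 := by
    rw [BoxHom.cubeMap_comp, face_one, u.top]
  -- The cardinalities are obtained by comparing extremal vertices; no counting is needed.
  have d1 : A.card = s.dim :=
    BoxHom.dim_eq_of_extremal _ s.hom (f1.trans s.bot.symm) (f2.trans s.top.symm)
  have d2 : Aᶜ.card = t.dim :=
    BoxHom.dim_eq_of_extremal _ t.hom (f3.trans t.bot.symm) (f4.trans t.top.symm)
  -- So far the faces have `A.card` and `Aᶜ.card` as dimensions, whereas a `Part` must use `s.dim`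
  -- and `t.dim`. On constant points the change of dimension is invisible.
  have g : ∀ {m : ℕ} (B : Finset (Fin u.dim)) (h : B.card = m) (b : Bool) (x : I),
      cubeMap ((face B h b).comp u.hom) (fun _ => x) =
        cubeMap ((face B rfl b).comp u.hom) (fun _ => x) := by
    rintro _ B rfl b x; rfl
  refine ⟨⟨A, Aᶜ, rfl, d1, d2⟩, ?_, ?_⟩
  · exact BoxHom.eq_of_extremal _ _ ((g A d1 false 0).trans (f1.trans s.bot.symm))
      ((g A d1 false 1).trans (f2.trans s.top.symm))
  · exact BoxHom.eq_of_extremal _ _ ((g Aᶜ d2 true 0).trans (f3.trans t.bot.symm))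
      ((g Aᶜ d2 true 1).trans (f4.trans t.top.symm))

end Span

/-! ### Maps of Moore flows up to equality of states -/

namespace MooreFlow

variable {X Y Z : MooreFlow}

/-- The map `f.P`, with values in path spaces between states that are equal to the images. -/
def Hom.castP (f : X ⟶ Y) (v w : X.state) {α β : Y.state} (hα : f.st v = α) (hβ : f.st w = β) :
    X.P v w ⟶ Y.P α β := f.P v w ≫ eqToHom (by rw [hα, hβ])

theorem Hom.castP_rfl (f : X ⟶ Y) (v w : X.state) : Hom.castP f v w rfl rfl = f.P v w :=
  Category.comp_id _

/-- This is `map_comp` transported along equalities of states. The target states are variables, so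
that the equalities can be substituted away. -/
theorem Hom.comp_castP (f : X ⟶ Y) {u v w : X.state} {α β γ : Y.state} (hα : f.st u = α)
    (hβ : f.st v = β) (hγ : f.st w = γ) : X.comp u v w ≫ Hom.castP f u w hα hγ =
      tensorMap (Hom.castP f u v hα hβ) (Hom.castP f v w hβ hγ) ≫ Y.comp α β γ := by
  subst hα hβ hγ
  simp only [castP_rfl]
  exact f.map_comp u v w

theorem Hom.castP_comp (f : X ⟶ Y) (g : Y ⟶ Z) {v w : X.state} {α β : Y.state} {α' β' : Z.state}
    (hα : f.st v = α) (hβ : f.st w = β) (hα' : g.st α = α') (hβ' : g.st β = β')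
    (h : Hom.st (f ≫ g) v = α') (h' : Hom.st (f ≫ g) w = β') :
    Hom.castP (f ≫ g) v w h h' = Hom.castP f v w hα hβ ≫ Hom.castP g α β hα' hβ' := by
  subst hα hβ hα' hβ'
  simp only [castP_rfl]
  rfl

theorem Hom.castP_congr {f g : X ⟶ Y} (e : f = g) {v w : X.state} {α β : Y.state}
    (hα : f.st v = α) (hβ : f.st w = β) (hα' : g.st v = α) (hβ' : g.st w = β) :
    Hom.castP f v w hα hβ = Hom.castP g v w hα' hβ' := by
  subst e; rfl

/-- Two maps whose state maps agree only propositionally have path components with different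
targets; `castP` brings them to a common one. -/
theorem hom_ext_castP {f g : X ⟶ Y} (hs : ∀ v, f.st v = g.st v)
    (hP : ∀ v w, Hom.castP f v w (hs v) (hs w) = g.P v w) : f = g := by
  obtain ⟨st, P, h⟩ := f
  obtain ⟨st', P', h'⟩ := g
  obtain rfl : st = st' := funext hs
  exact MooreFlow.hom_ext fun v w => (Hom.castP_rfl _ v w).symm.trans (hP v w)

end MooreFlow

/-! ### The canonical maps into `‖K‖^𝒢` -/

section inclW

variable {K L : PrecubicalSet} {α β γ : Vert K}

/-- The map `T s ⟶ ℙ_{α,β} ‖K‖^𝒢` associated with a chain `□[s] ⟶ K` from `α` to `β`. -/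
def inclW (s : PSeq) (x : W s ⟶ K) {α β : Vert K} (hα : yonedaEquiv (W.init s ≫ x) = α)
    (hβ : yonedaEquiv (W.final s ≫ x) = β) : T s ⟶ PG K α β :=
  (⟨s, rfl, x, hα, hβ⟩ : Chain K α β s.total).incl

/-- The index `n` is forced to be the total of the sequence, so a summand of the coproduct over `n`
is determined by the chain alone. -/
theorem Chain.incl_eq_inclW {n : ℕ+} (a : Chain K α β n) :
    a.incl = inclW a.s a.x a.init a.final := by
  obtain ⟨s, rfl, x, h, h'⟩ := a
  rfl

theorem PG_hom_ext {X : GSpace} {f g : PG K α β ⟶ X}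
    (h : ∀ (s : PSeq) (x : W s ⟶ K) (hα : yonedaEquiv (W.init s ≫ x) = α)
      (hβ : yonedaEquiv (W.final s ≫ x) = β), inclW s x hα hβ ≫ f = inclW s x hα hβ ≫ g) :
    f = g :=
  Chain.hom_ext fun n a => by rw [a.incl_eq_inclW]; exact h _ _ _ _

/-- The endpoint equations of the concatenation are separate hypotheses, so that the concatenated
chain can later be replaced by an equal map. -/
theorem inclW_comp {s t : PSeq} (x : W s ⟶ K) (y : W t ⟶ K)
    (hα : yonedaEquiv (W.init s ≫ x) = α) (hβ : yonedaEquiv (W.final s ≫ x) = β)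
    (hβ' : yonedaEquiv (W.init t ≫ y) = β) (hγ : yonedaEquiv (W.final t ≫ y) = γ)
    (h : W.final s ≫ x = W.init t ≫ y)
    (h₁ : yonedaEquiv (W.init (s.append t) ≫ (catW y s x h).1) = α)
    (h₂ : yonedaEquiv (W.final (s.append t) ≫ (catW y s x h).1) = γ) :
    tensorMap (inclW s x hα hβ) (inclW t y hβ' hγ) ≫ Chain.compPG K α β γ =
      cat s t ≫ inclW (s.append t) (catW y s x h).1 h₁ h₂ :=
  (Chain.incl_compPG (⟨s, rfl, x, hα, hβ⟩ : Chain K α β s.total) ⟨t, rfl, y, hβ', hγ⟩).trans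
    (congrArg (cat s t ≫ ·) (Chain.incl_eq_inclW
      (Chain.concat (⟨s, rfl, x, hα, hβ⟩ : Chain K α β s.total) ⟨t, rfl, y, hβ', hγ⟩)))

/-- A partition replaces `m₁, m₂` by their sum. This puts the source and target of a generator in
one category `Ch_{α,β}(K, n)`, so that it gives a morphism there. -/
theorem PSeq.total_of_gen {s s' : PSeq} (g : Gen s s') : s.total = s'.total := by
  have hp : ∀ {m₁ m₂ n : ℕ+}, Part m₁ m₂ n → m₁ + m₂ = n := fun π => PNat.coe_injective (by
    have h := Finset.card_add_card_compl π.A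
    rw [← π.hB, π.cardA, π.cardB, Fintype.card_fin] at h
    exact h)
  induction g with
  | last π => exact hp π
  | head π s => exact (add_assoc _ _ _).symm.trans (congrArg (· + s.total) (hp π))
  | tail n g ih => exact congrArg (n + ·) ih

/-- A generator over `K` is a morphism of cube chains, a composite of length one, and the inclusions
into the colimit form a cocone. -/
theorem Gen.tmap_inclW {s s' : PSeq} (g : Gen s s') (x : W s' ⟶ K)
    (hα : yonedaEquiv (W.init s' ≫ x) = α) (hβ : yonedaEquiv (W.final s' ≫ x) = β)
    (hα' : yonedaEquiv (W.init s ≫ g.wmap ≫ x) = α)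
    (hβ' : yonedaEquiv (W.final s ≫ g.wmap ≫ x) = β) :
    g.tmap ≫ inclW s' x hα hβ = inclW s (g.wmap ≫ x) hα' hβ' := by
  have e : g.tmap = (GPath.cons g (GPath.nil s')).tmap := (Category.comp_id _).symm
  have e' : (GPath.cons g (GPath.nil s')).wmap ≫ x = g.wmap ≫ x :=
    congrArg (· ≫ x) (Category.comp_id g.wmap)
  let a : Chain K α β s.total := ⟨s, rfl, g.wmap ≫ x, hα', hβ'⟩
  let b : Chain K α β s.total := ⟨s', (PSeq.total_of_gen g).symm, x, hα, hβ⟩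
  rw [e]
  refine Eq.trans ?_ (Chain.incl_path (a := a) (b := b) _ e')
  rw [b.incl_eq_inclW]

theorem doubleBar_map_castP (k : K ⟶ L) {α' β' : Vert L} (s : PSeq) (x : W s ⟶ K)
    (hα : yonedaEquiv (W.init s ≫ x) = α) (hβ : yonedaEquiv (W.final s ≫ x) = β)
    (kα : k.app _ α = α') (kβ : k.app _ β = β')
    (hα' : yonedaEquiv (W.init s ≫ x ≫ k) = α') (hβ' : yonedaEquiv (W.final s ≫ x ≫ k) = β') :
    inclW s x hα hβ ≫ MooreFlow.Hom.castP (doubleBar.map k) α β kα kβ =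
      inclW s (x ≫ k) hα' hβ' := by
  subst kα kβ
  refine (congrArg (inclW s x hα hβ ≫ ·) (MooreFlow.Hom.castP_rfl (doubleBar.map k) α β)).trans ?_
  rfl

end inclW

/-! ### The unit -/

/-- A vertex of the regular cube, as a map of the box category. -/
def vert {n : ℕ} (a : (regCube n).state) : BoxHom 0 n where
  coord j := Sum.inl (exists_bit (a.2 j)).choose
  mono _ _ _ _ _ h _ := nomatch h
  surj k := k.elim0

theorem cubeMap_vert {n : ℕ} (a : (regCube n).state) (x : Fin 0 → I) :
    cubeMap (vert a) x = a.1 :=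
  funext fun j => (exists_bit (a.2 j)).choose_spec

/-- The 0-cube is a point, so its two extremal vertices coincide and a single value determines the
map. -/
theorem eq_vert {n : ℕ} (a : (regCube n).state) (f : BoxHom 0 n) (x : Fin 0 → I)
    (h : cubeMap f x = a.1) : f = vert a := by
  refine f.eq_of_extremal _ ?_ ?_ <;>
  · rw [cubeMap_vert, ← h]
    exact congrArg _ (Subsingleton.elim _ _)

theorem constHom_zero_comp {m n : ℕ} (δ : BoxHom m n) (a : (regCube n).state) (b : Bool)
    (h : cubeMap δ (fun _ => bit b) = a.1) : (constHom m b).comp δ = vert a :=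
  eq_vert a _ (fun _ => 0) (by rw [BoxHom.cubeMap_comp]; exact h)

/-- The map of precubical sets associated with a map of the box category. -/
abbrev ymap {m n : ℕ} (δ : BoxHom m n) : cubeSet m ⟶ cubeSet n :=
  yoneda.map (X := (⟨m⟩ : Box)) (Y := ⟨n⟩) δ

theorem ymap_comp {m n p : ℕ} (δ : BoxHom m n) (ε : BoxHom n p) :
    ymap (δ.comp ε) = ymap δ ≫ ymap ε :=
  yoneda.map_comp (X := (⟨m⟩ : Box)) (Y := ⟨n⟩) (Z := ⟨p⟩) δ ε

theorem vtx_comp_ymap {m n : ℕ} (δ : BoxHom m n) (a : (regCube n).state) (b : Bool)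
    (h : cubeMap δ (fun _ => bit b) = a.1) : vtx m b ≫ ymap δ = ymap (vert a) := by
  rw [← constHom_zero_comp δ a b h, ymap_comp]; rfl

theorem yonedaEquiv_ymap {m n : ℕ} (δ : BoxHom m n) : yonedaEquiv (ymap δ) = δ := by
  exact yonedaEquiv_yoneda_map (X := (⟨m⟩ : Box)) (Y := ⟨n⟩) δ

theorem yonedaEquiv_vtx_comp {m n : ℕ} (δ : BoxHom m n) (a : (regCube n).state) (b : Bool)
    (h : cubeMap δ (fun _ => bit b) = a.1) : yonedaEquiv (vtx m b ≫ ymap δ) = vert a := by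
  rw [vtx_comp_ymap δ a b h, yonedaEquiv_ymap]

/-- The map `𝔽_m N_m ⟶ ℙ ‖□[n]‖^𝒢` associated with a face. -/
def Span.incl {n : ℕ} {a b : (regCube n).state} (s : Span a b) :
    FN s.dim ⟶ PG (cubeSet n) (vert a) (vert b) :=
  inclW (PSeq.one s.dim) (ymap s.hom) (yonedaEquiv_vtx_comp s.hom a false s.bot)
    (yonedaEquiv_vtx_comp s.hom b true s.top)

/-- The chain of the two subfaces factors as `φ_{A,B}` followed by the one-cube chain of the large
face. The colimit over cube chains therefore identifies a composite of paths of the subfaces with a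
path of the large face. -/
theorem Span.merge_incl {n : ℕ} {a b c : (regCube n).state} (s : Span a b) (t : Span b c)
    (u : Span a c) (π : Part s.dim t.dim u.dim) (hA : π.faceA.comp u.hom = s.hom)
    (hB : π.faceB.comp u.hom = t.hom) :
    tensorMap s.incl t.incl ≫ Chain.compPG (cubeSet n) (vert a) (vert b) (vert c) =
      π.merge ≫ u.incl := by
  have h : W.final (PSeq.one s.dim) ≫ ymap s.hom = W.init (PSeq.one t.dim) ≫ ymap t.hom :=
    (vtx_comp_ymap s.hom b true s.top).trans (vtx_comp_ymap t.hom b false t.bot).symm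
  -- Both sides are maps out of a pushout of two cubes, so they are compared on each cube.
  have h₀ : (catW (ymap t.hom) (PSeq.one s.dim) (ymap s.hom) h).1 =
      (Gen.last π).wmap ≫ ymap u.hom := by
    refine W.hom_ext ?_ ?_
    · refine (W.inl_desc _ _ _).trans (Eq.symm ?_)
      refine (W.inl_desc_assoc (s := PSeq.one _) _ _ _ _).trans ?_
      rw [← hA, ymap_comp]; rfl
    · refine (W.inr_desc _ _ _).trans (Eq.symm ?_)
      refine (W.inr_desc_assoc (s := PSeq.one _) _ _ _ _).trans ?_
      rw [← hB, ymap_comp]; rfl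
  have h₁ : yonedaEquiv (W.init (PSeq.cons s.dim (PSeq.one t.dim)) ≫
      (Gen.last π).wmap ≫ ymap u.hom) = vert a := by
    refine Eq.trans (congrArg yonedaEquiv ((Category.assoc _ _ _).symm.trans
      (congrArg (· ≫ ymap u.hom) (Gen.last π).init_wmap))) ?_
    exact yonedaEquiv_vtx_comp u.hom a false u.bot
  have h₂ : yonedaEquiv (W.final (PSeq.cons s.dim (PSeq.one t.dim)) ≫
      (Gen.last π).wmap ≫ ymap u.hom) = vert c := by
    refine Eq.trans (congrArg yonedaEquiv ((Category.assoc _ _ _).symm.trans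
      (congrArg (· ≫ ymap u.hom) (Gen.last π).final_wmap))) ?_
    exact yonedaEquiv_vtx_comp u.hom c true u.top
  refine (inclW_comp _ _ _ _ _ _ h (by rw [h₀]; exact h₁) (by rw [h₀]; exact h₂)).trans ?_
  refine (Category.id_comp _).trans (Eq.symm ?_)
  refine (Gen.tmap_inclW (Gen.last π) (ymap u.hom) _ _ h₁ h₂).trans ?_
  congr 1
  exact h₀.symm

/-- Each factor of a tensor `x ⊗ y` is an actual path, so it spans a face and comes from a natural
path there. If there are no paths, nothing is to be checked. -/
theorem Span.tensor_hom_ext {n : ℕ} {a b c : (regCube n).state} {X : GSpace}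
    {f g : tensor ((regCube n).pathSpace a b) ((regCube n).pathSpace b c) ⟶ X}
    (h : ∀ (s : Span a b) (t : Span b c), tensorMap s.iso.hom t.iso.hom ≫ f =
      tensorMap s.iso.hom t.iso.hom ≫ g) : f = g := by
  refine GSpace.tensor_hom_ext fun l l' x y => ?_
  obtain ⟨s⟩ := Span.nonempty_of_path x
  obtain ⟨t⟩ := Span.nonempty_of_path y
  have := congrArg (fun f => Hom.app f _ (tmk (s.iso.inv.app _ x) (t.iso.inv.app _ y))) (h s t)
  have ex : s.iso.hom.app _ (s.iso.inv.app _ x) = x :=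
    congrArg (fun f => Hom.app f _ x) s.iso.inv_hom_id
  have ey : t.iso.hom.app _ (t.iso.inv.app _ y) = y :=
    congrArg (fun f => Hom.app f _ y) t.iso.inv_hom_id
  simpa only [comp_app, tensorMap_tmk, ex, ey] using this

theorem Span.merge_iso {n : ℕ} {a b c : (regCube n).state} (s : Span a b) (t : Span b c)
    (u : Span a c) (π : Part s.dim t.dim u.dim) (hA : π.faceA.comp u.hom = s.hom)
    (hB : π.faceB.comp u.hom = t.hom) :
    tensorMap s.iso.hom t.iso.hom ≫ lift ((regCube n).compBil a b c) =
      π.merge ≫ u.iso.hom := by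
  obtain ⟨m₁, δ₁, h1, h2⟩ := s
  obtain ⟨m₂, δ₂, h3, h4⟩ := t
  dsimp only at π hA hB
  -- With the two subfaces written as composites with `u.hom`, the claim is `Part.merge_real`.
  subst hA hB
  exact π.merge_real u.hom h1 h2 h3 h4 u.bot u.top

/-- Restricted to natural paths of two consecutive faces, both sides become `π.merge ≫ u.incl`. On
the left Moore composition in the cube is the merge map, and on the right the colimit relation gives
the same. -/
theorem Span.comp_desc_incl {n : ℕ} (a b c : (regCube n).state) :
    lift ((regCube n).compBil a b c) ≫ Span.desc Span.incl =
      tensorMap (Span.desc Span.incl) (Span.desc Span.incl) ≫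
        Chain.compPG (cubeSet n) (vert a) (vert b) (vert c) := by
  refine Span.tensor_hom_ext fun s t => ?_
  obtain ⟨u⟩ := Span.nonempty_of_lt (s.lt.trans t.lt)
  obtain ⟨π, hA, hB⟩ := Span.exists_part s t u
  rw [← Category.assoc (tensorMap _ _) (tensorMap _ _), ← tensorMap_comp, Span.hom_desc,
    Span.hom_desc, Span.merge_incl s t u π hA hB, ← Category.assoc,
    Span.merge_iso s t u π hA hB, Category.assoc, Span.hom_desc]

/-- The map `𝕄^𝒢 |□[n]|ᵗ_reg ⟶ ‖□[n]‖^𝒢`. -/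
def unitApp (n : ℕ) : (regCube n).moore ⟶ doubleBarObj (cubeSet n) where
  st := vert
  P _ _ := Span.desc Span.incl
  map_comp := Span.comp_desc_incl

theorem Span.iso_unitApp {n : ℕ} {a b : (regCube n).state} (s : Span a b)
    {α β : Vert (cubeSet n)} (ha : vert a = α) (hb : vert b = β)
    (hα : yonedaEquiv (vtx s.dim false ≫ ymap s.hom) = α)
    (hβ : yonedaEquiv (vtx s.dim true ≫ ymap s.hom) = β) :
    s.iso.hom ≫ MooreFlow.Hom.castP (unitApp n) a b ha hb =
      inclW (PSeq.one s.dim) (ymap s.hom) hα hβ := by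
  subst ha hb
  exact (congrArg (s.iso.hom ≫ ·) (MooreFlow.Hom.castP_rfl (unitApp n) a b)).trans
    (Span.hom_desc _ s)

/-- The image of a state of a regular cube. -/
abbrev mapState {m n : ℕ} (δ : BoxHom m n) (a : (regCube m).state) : (regCube n).state :=
  ⟨cubeMap δ a.1, cubeMap_vertex δ a.2⟩

theorem vert_mapState {m n : ℕ} (δ : BoxHom m n) (a : (regCube m).state) :
    vert (mapState δ a) = (vert a).comp δ :=
  (eq_vert _ _ (fun _ => 0) (by rw [BoxHom.cubeMap_comp, cubeMap_vert])).symm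

/-- The image of a face. -/
def Span.map {m n : ℕ} (δ : BoxHom m n) {a b : (regCube m).state} (s : Span a b) :
    Span (mapState δ a) (mapState δ b) :=
  ⟨s.dim, s.hom.comp δ, (BoxHom.cubeMap_comp _ _ _).trans (congrArg _ s.bot),
    (BoxHom.cubeMap_comp _ _ _).trans (congrArg _ s.top)⟩

/-- The map of Moore flows associated with a map of the box category. -/
abbrev flowMap {m n : ℕ} (δ : BoxHom m n) : (regCube m).moore ⟶ (regCube n).moore :=
  regCubeFlow.map (X := (⟨m⟩ : Box)) (Y := ⟨n⟩) δ

/-- A face of a face is a face with the same natural paths, so the parametrization is carried along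
with no change of arc length. -/
theorem Span.iso_flowMap {m n : ℕ} (δ : BoxHom m n) {a b : (regCube m).state} (s : Span a b) :
    s.iso.hom ≫ MooreFlow.Hom.castP (flowMap δ) a b (α := mapState δ a) (β := mapState δ b)
      rfl rfl = (s.map δ).iso.hom := by
  refine (congrArg (s.iso.hom ≫ ·) (MooreFlow.Hom.castP_rfl (flowMap δ) a b)).trans ?_
  ext l x
  exact congrArg KD.mk (Subtype.ext (ContinuousMap.ext fun t =>
    (BoxHom.cubeMap_comp s.hom δ (x.val.2.val.1 (x.val.1 t))).symm))

/-- On the natural paths of a face, both composites are the inclusion of the one-cube chain given by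
the image of that face under `δ`. -/
theorem flowMap_unitApp {m n : ℕ} (δ : BoxHom m n) :
    flowMap δ ≫ unitApp n = unitApp m ≫ doubleBar.map (ymap δ) := by
  refine MooreFlow.hom_ext_castP (fun a => vert_mapState δ a) fun a b => ?_
  refine Span.hom_ext fun s => ?_
  have e₁ : s.iso.hom ≫ MooreFlow.Hom.castP (flowMap δ ≫ unitApp n) a b (vert_mapState δ a)
      (vert_mapState δ b) = inclW (PSeq.one s.dim) (ymap (s.hom.comp δ))
        ((yonedaEquiv_vtx_comp _ _ false (s.map δ).bot).trans (vert_mapState δ a))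
        ((yonedaEquiv_vtx_comp _ _ true (s.map δ).top).trans (vert_mapState δ b)) := by
    refine (congrArg (s.iso.hom ≫ ·) (MooreFlow.Hom.castP_comp (flowMap δ) (unitApp n)
      (v := a) (w := b) (α := mapState δ a) (β := mapState δ b) rfl rfl (vert_mapState δ a)
      (vert_mapState δ b) _ _)).trans ((Category.assoc _ _ _).symm.trans ?_)
    exact (congrArg (· ≫ _) (s.iso_flowMap δ)).trans ((s.map δ).iso_unitApp _ _ _ _)
  refine e₁.trans (Eq.symm ?_)
  refine (congrArg (s.iso.hom ≫ ·) (MooreFlow.Hom.castP_rfl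
    (unitApp m ≫ doubleBar.map (ymap δ)) a b).symm).trans ?_
  refine (congrArg (s.iso.hom ≫ ·) (MooreFlow.Hom.castP_comp (unitApp m)
    (doubleBar.map (ymap δ)) (v := a) (w := b) rfl rfl rfl rfl rfl rfl)).trans
      ((Category.assoc _ _ _).symm.trans ?_)
  refine (congrArg (· ≫ _) (s.iso_unitApp rfl rfl (yonedaEquiv_vtx_comp _ _ false s.bot)
    (yonedaEquiv_vtx_comp _ _ true s.top))).trans ?_
  have e₂ : ymap (s.hom.comp δ) = ymap s.hom ≫ ymap δ := ymap_comp _ _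
  refine (doubleBar_map_castP (ymap δ) (PSeq.one s.dim) (ymap s.hom) _ _ rfl rfl ?_ ?_).trans ?_
  · refine (congrArg (fun k => yonedaEquiv (vtx s.dim false ≫ k)) e₂).symm.trans ?_
    exact (yonedaEquiv_vtx_comp _ _ false (s.map δ).bot).trans (vert_mapState δ a)
  · refine (congrArg (fun k => yonedaEquiv (vtx s.dim true ≫ k)) e₂).symm.trans ?_
    exact (yonedaEquiv_vtx_comp _ _ true (s.map δ).top).trans (vert_mapState δ b)
  · congr 1
    exact e₂.symm

/-- The cocubical Moore flow `𝕄^𝒢 |□[*]|ᵗ_reg` maps to `‖□[*]‖^𝒢`. -/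
def unit : regCubeFlow ⟶ (yoneda : Box ⥤ PrecubicalSet) ⋙ doubleBar where
  app n := unitApp n.dim
  naturality _ _ δ := flowMap_unitApp δ

/-! ### Maps out of `‖K‖^𝒢` -/

/-- The associativity law of `Z` for generalized elements `e`, `f`, `g` of its path spaces, which is
the form in which evaluations of chains are reassociated. -/
theorem MooreFlow.tensorMap_assoc (Z : MooreFlow) {D E F : GSpace} {α β γ δ : Z.state}
    (e : D ⟶ Z.P α β) (f : E ⟶ Z.P β γ) (g : F ⟶ Z.P γ δ) :
    tensorMap (tensorMap e f ≫ Z.comp α β γ) g ≫ Z.comp α γ δ =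
      (GSpace.assoc D E F).hom ≫ tensorMap e (tensorMap f g ≫ Z.comp β γ δ) ≫ Z.comp α β δ := by
  refine tensorL_hom_ext fun a b c x y z => ?_
  have h := congrArg (fun k => Hom.app k _ (tmk (tmk (e.app a x) (f.app b y)) (g.app c z)))
    (Z.assoc α β γ δ)
  simpa only [comp_app, tensorMap_tmk, assoc_hom_tmk, id_app, Hom.naturality] using h

theorem GSpace.tensorMap_id_comp {D E E' D' X : GSpace} (f : E ⟶ E') (e : D ⟶ D') (g : E' ⟶ X) :
    tensorMap (𝟙 D) f ≫ tensorMap e g = tensorMap e (f ≫ g) := by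
  rw [← tensorMap_comp, Category.id_comp]

theorem GSpace.tensorMap_comp_id {D D' E E' X : GSpace} (f : D ⟶ D') (e : D' ⟶ X) (g : E ⟶ E') :
    tensorMap f (𝟙 E) ≫ tensorMap e g = tensorMap (f ≫ e) g := by
  rw [← tensorMap_comp, Category.id_comp]

theorem GSpace.tensorMap_comp_assoc {D D' D'' E E' E'' X : GSpace} (f : D ⟶ D') (g : E ⟶ E')
    (f' : D' ⟶ D'') (g' : E' ⟶ E'') (k : tensor D'' E'' ⟶ X) :
    tensorMap f g ≫ tensorMap f' g' ≫ k = tensorMap (f ≫ f') (g ≫ g') ≫ k := by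
  rw [tensorMap_comp, Category.assoc]

/-- The vertex `(b, …, b)` of the regular cube. -/
def corner (n : ℕ) (b : Bool) : (regCube n).state :=
  ⟨fun _ => bit b, fun _ => by cases b; exacts [Or.inl rfl, Or.inr rfl]⟩

/-- The top-dimensional face of the cube. -/
def topSpan (n : ℕ+) : Span (corner n false) (corner n true) := ⟨n, BoxHom.id n, rfl, rfl⟩

/-- Every face is the image of the top face of its own cube. This reduces evaluation on faces to
evaluation on whole cubes. -/
theorem topSpan_flowMap {n : ℕ} {a b : (regCube n).state} (s : Span a b)
    (ha : (flowMap s.hom).st (corner s.dim false) = a)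
    (hb : (flowMap s.hom).st (corner s.dim true) = b) :
    (topSpan s.dim).iso.hom ≫ MooreFlow.Hom.castP (flowMap s.hom) (corner s.dim false)
      (corner s.dim true) ha hb = s.iso.hom := by
  obtain ⟨m, δ, h, h'⟩ := s
  dsimp only at ha hb
  subst ha hb
  exact congrArg ((topSpan m).iso.hom ≫ ·) (MooreFlow.Hom.castP_rfl (flowMap δ) _ _)

theorem unitApp_map_st {K : PrecubicalSet} {n : ℕ} (x : cubeSet n ⟶ K) (a : (regCube n).state)
    (ε : BoxHom 0 n) (h : cubeMap ε (fun _ => 0) = a.1) :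
    MooreFlow.Hom.st (unitApp n ≫ doubleBar.map x) a = yonedaEquiv (ymap ε ≫ x) := by
  refine Eq.symm ((yonedaEquiv_comp (ymap ε) x).trans ?_)
  exact congrArg (x.app (op ⟨0⟩)) ((yonedaEquiv_ymap ε).trans (eq_vert a ε _ h))

theorem unitApp_map_st_of_face {K : PrecubicalSet} {m n : ℕ} (x : cubeSet n ⟶ K) (δ : BoxHom m n)
    (a : (regCube n).state) (b : Bool) (h : cubeMap δ (fun _ => bit b) = a.1) :
    yonedaEquiv (vtx m b ≫ ymap δ ≫ x) =
      MooreFlow.Hom.st (unitApp n ≫ doubleBar.map x) a := by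
  rw [← Category.assoc, vtx_comp_ymap δ a b h]
  exact (unitApp_map_st x a (vert a) (cubeMap_vert a _)).symm

theorem Span.iso_unitApp_map {K : PrecubicalSet} {n : ℕ} {a b : (regCube n).state} (s : Span a b)
    (x : cubeSet n ⟶ K) {α β : Vert K}
    (ha : MooreFlow.Hom.st (unitApp n ≫ doubleBar.map x) a = α)
    (hb : MooreFlow.Hom.st (unitApp n ≫ doubleBar.map x) b = β)
    (hα : yonedaEquiv (vtx s.dim false ≫ ymap s.hom ≫ x) = α)
    (hβ : yonedaEquiv (vtx s.dim true ≫ ymap s.hom ≫ x) = β) :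
    s.iso.hom ≫ MooreFlow.Hom.castP (unitApp n ≫ doubleBar.map x) a b ha hb =
      inclW (PSeq.one s.dim) (ymap s.hom ≫ x) hα hβ := by
  refine (congrArg (s.iso.hom ≫ ·) (MooreFlow.Hom.castP_comp (unitApp n)
    (doubleBar.map x) (v := a) (w := b) rfl rfl ha hb ha hb)).trans
      ((Category.assoc _ _ _).symm.trans ?_)
  refine (congrArg (· ≫ _) (s.iso_unitApp rfl rfl (yonedaEquiv_vtx_comp _ _ false s.bot)
    (yonedaEquiv_vtx_comp _ _ true s.top))).trans ?_
  exact doubleBar_map_castP x (PSeq.one s.dim) (ymap s.hom) _ _ ha hb hα hβ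

/-- A compatible family of maps from the flows of the cubes of `K`. -/
structure CubeCocone (K : PrecubicalSet) (Z : MooreFlow) where
  f : ∀ {n : ℕ}, (cubeSet n ⟶ K) → ((regCube n).moore ⟶ Z)
  w : ∀ {m n : ℕ} (δ : BoxHom m n) (x : cubeSet n ⟶ K), flowMap δ ≫ f x = f (ymap δ ≫ x)

namespace CubeCocone

variable {K : PrecubicalSet} {Z : MooreFlow} (c : CubeCocone K Z)

/-- The map induced on states. -/
def st (α : Vert K) : Z.state := (c.f (yonedaEquiv.symm α)).st (corner 0 false)

/-- A vertex of a cube is one of its 0-dimensional faces, so compatibility of the family with `ε`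
determines the value at that vertex from the corresponding vertex of `K`. -/
theorem f_st {n : ℕ} (x : cubeSet n ⟶ K) (ε : BoxHom 0 n) (a : (regCube n).state)
    (h : cubeMap ε (fun _ => 0) = a.1) : (c.f x).st a = c.st (yonedaEquiv (ymap ε ≫ x)) := by
  rw [st, Equiv.symm_apply_apply, ← c.w]
  exact congrArg (c.f x).st (Subtype.ext h.symm)

theorem f_corner {n : ℕ} (x : cubeSet n ⟶ K) (b : Bool) {α : Vert K}
    (h : yonedaEquiv (vtx n b ≫ x) = α) : (c.f x).st (corner n b) = c.st α :=
  (c.f_st x (constHom n b) _ rfl).trans (congrArg c.st h)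

/-- The map induced on the natural paths of a cube. -/
def evalCube {n : ℕ+} (x : cubeSet n ⟶ K) {α β : Vert K} (hα : yonedaEquiv (vtx n false ≫ x) = α)
    (hβ : yonedaEquiv (vtx n true ≫ x) = β) : FN n ⟶ Z.P (c.st α) (c.st β) :=
  (topSpan n).iso.hom ≫ MooreFlow.Hom.castP (c.f x) (corner n false) (corner n true)
    (c.f_corner x false hα) (c.f_corner x true hβ)

/-- The face can be evaluated as a cube of `K` in its own right or inside the ambient cube `x`. The
two agree by the cocone condition `w` and `topSpan_flowMap`. -/
theorem evalCube_face {n : ℕ} {a b : (regCube n).state} (s : Span a b) (x : cubeSet n ⟶ K)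
    {α β : Vert K} (hα : yonedaEquiv (vtx s.dim false ≫ ymap s.hom ≫ x) = α)
    (hβ : yonedaEquiv (vtx s.dim true ≫ ymap s.hom ≫ x) = β) (ha : (c.f x).st a = c.st α)
    (hb : (c.f x).st b = c.st β) :
    c.evalCube (ymap s.hom ≫ x) hα hβ = s.iso.hom ≫ MooreFlow.Hom.castP (c.f x) a b ha hb := by
  have sa : (flowMap s.hom).st (corner s.dim false) = a := Subtype.ext s.bot
  have sb : (flowMap s.hom).st (corner s.dim true) = b := Subtype.ext s.top
  have ha' : MooreFlow.Hom.st (flowMap s.hom ≫ c.f x) (corner s.dim false) = c.st α :=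
    (congrArg (c.f x).st sa).trans ha
  have hb' : MooreFlow.Hom.st (flowMap s.hom ≫ c.f x) (corner s.dim true) = c.st β :=
    (congrArg (c.f x).st sb).trans hb
  rw [evalCube, MooreFlow.Hom.castP_congr (c.w s.hom x).symm _ _ ha' hb',
    MooreFlow.Hom.castP_comp (flowMap s.hom) (c.f x) sa sb ha hb]
  exact (Category.assoc _ _ _).symm.trans (congrArg (· ≫ _) (topSpan_flowMap s sa sb))

/-- The two subfaces are evaluated inside the common cube `x`. There `c.f x` preserves composition,
and Moore composition of natural paths is `π.merge`. This is where the relations imposed by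
`φ_{A,B}` are seen to hold in any cocone. -/
theorem merge_evalCube {m₁ m₂ n : ℕ+} (π : Part m₁ m₂ n) (x : cubeSet n ⟶ K) {α β γ : Vert K}
    (hα : yonedaEquiv (vtx n false ≫ x) = α) (hγ : yonedaEquiv (vtx n true ≫ x) = γ)
    (hα' : yonedaEquiv (vtx m₁ false ≫ π.inA ≫ x) = α)
    (hβ : yonedaEquiv (vtx m₁ true ≫ π.inA ≫ x) = β)
    (hβ' : yonedaEquiv (vtx m₂ false ≫ π.inB ≫ x) = β)
    (hγ' : yonedaEquiv (vtx m₂ true ≫ π.inB ≫ x) = γ) :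
    π.merge ≫ c.evalCube x hα hγ =
      tensorMap (c.evalCube (π.inA ≫ x) hα' hβ) (c.evalCube (π.inB ≫ x) hβ' hγ') ≫
        Z.comp _ _ _ := by
  -- The vertex where the `A`-face ends and the `B`-face begins.
  let mid : (regCube n).state := mapState π.faceA (corner m₁ true)
  let s : Span (corner n false) mid := ⟨m₁, π.faceA, face_zero _ _, rfl⟩
  let t : Span mid (corner n true) := ⟨m₂, π.faceB, π.meet.symm, face_one _ _⟩
  have hmid : (c.f x).st mid = c.st β := by
    have : vtx m₁ true ≫ π.inA ≫ x = ymap (vert mid) ≫ x := by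
      rw [← Category.assoc]
      exact congrArg (· ≫ x) (vtx_comp_ymap π.faceA mid true rfl)
    rw [this] at hβ
    exact (c.f_st x (vert mid) mid (cubeMap_vert mid _)).trans (congrArg c.st hβ)
  have e₁ := c.evalCube_face s x hα' hβ (c.f_corner x false hα) hmid
  have e₂ := c.evalCube_face t x hβ' hγ' hmid (c.f_corner x true hγ)
  refine Eq.trans ?_ (congrArg₂ (fun f g => tensorMap f g ≫ Z.comp _ _ _) e₁ e₂).symm
  refine Eq.trans ?_ (tensorMap_comp_assoc _ _ _ _ _)
  refine Eq.trans ?_ (congrArg (tensorMap s.iso.hom t.iso.hom ≫ ·)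
    (MooreFlow.Hom.comp_castP (c.f x) (c.f_corner x false hα) hmid (c.f_corner x true hγ)))
  refine Eq.trans ?_ (Category.assoc _ _ _)
  refine Eq.trans ?_ (congrArg (· ≫ _) (Span.merge_iso s t (topSpan n) π rfl rfl).symm)
  exact (Category.assoc _ _ _).symm

theorem init_inl {n : ℕ+} {s : PSeq} (x : W (PSeq.cons n s) ⟶ K) :
    W.init (PSeq.cons n s) ≫ x = vtx n false ≫ W.inl n s ≫ x := Category.assoc _ _ _

theorem final_inl {n : ℕ+} {s : PSeq} (x : W (PSeq.cons n s) ⟶ K) :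
    vtx n true ≫ W.inl n s ≫ x = W.init s ≫ W.inr n s ≫ x := by
  rw [← Category.assoc, W.condition, Category.assoc]

theorem final_inr {n : ℕ+} {s : PSeq} (x : W (PSeq.cons n s) ⟶ K) :
    W.final (PSeq.cons n s) ≫ x = W.final s ≫ W.inr n s ≫ x := Category.assoc _ _ _

/-- The map induced on the `𝒢`-space of a cube chain. -/
def eval : ∀ (s : PSeq) (x : W s ⟶ K) (α β : Vert K), yonedaEquiv (W.init s ≫ x) = α →
    yonedaEquiv (W.final s ≫ x) = β → (T s ⟶ Z.P (c.st α) (c.st β))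
  | PSeq.one _, x, _, _, hα, hβ => c.evalCube x hα hβ
  | PSeq.cons n s, x, α, β, hα, hβ =>
    -- The intermediate vertex is read off from the tail, so its equation there is `rfl`; for the
    -- first cube it is the pushout condition.
    tensorMap (c.evalCube (W.inl n s ≫ x) (α := α)
        (β := yonedaEquiv (W.init s ≫ W.inr n s ≫ x))
        ((congrArg yonedaEquiv (init_inl x)).symm.trans hα) (congrArg yonedaEquiv (final_inl x)))
      (eval s (W.inr n s ≫ x) _ β rfl ((congrArg yonedaEquiv (final_inr x)).symm.trans hβ)) ≫
        Z.comp _ _ _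

/-- The restrictions `y`, `z` and the intermediate vertex `β` are left free, since in applications
they are only propositionally equal to those chosen in `eval`. -/
theorem eval_cons {n : ℕ+} {s : PSeq} (x : W (PSeq.cons n s) ⟶ K) {α β γ : Vert K}
    (hα : yonedaEquiv (W.init (PSeq.cons n s) ≫ x) = α)
    (hγ : yonedaEquiv (W.final (PSeq.cons n s) ≫ x) = γ)
    {y : cubeSet n ⟶ K} {z : W s ⟶ K} (hy : W.inl n s ≫ x = y) (hz : W.inr n s ≫ x = z)
    (h₁ : yonedaEquiv (vtx n false ≫ y) = α) (h₂ : yonedaEquiv (vtx n true ≫ y) = β)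
    (h₃ : yonedaEquiv (W.init s ≫ z) = β) (h₄ : yonedaEquiv (W.final s ≫ z) = γ) :
    c.eval (PSeq.cons n s) x α γ hα hγ =
      tensorMap (c.evalCube y h₁ h₂) (c.eval s z β γ h₃ h₄) ≫ Z.comp _ _ _ := by
  subst hy hz h₃
  rfl

/-- When `φ_{A,B}` stands alone this is `merge_evalCube`. In front of further cubes one also uses
associativity in `Z`, and deeper in the chain one inducts on the tail. -/
theorem tmap_eval {s s' : PSeq} (g : Gen s s') (x : W s' ⟶ K) (α β : Vert K)
    (hα : yonedaEquiv (W.init s' ≫ x) = α) (hβ : yonedaEquiv (W.final s' ≫ x) = β)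
    (hα' : yonedaEquiv (W.init s ≫ g.wmap ≫ x) = α)
    (hβ' : yonedaEquiv (W.final s ≫ g.wmap ≫ x) = β) :
    g.tmap ≫ c.eval s' x α β hα hβ = c.eval s (g.wmap ≫ x) α β hα' hβ' := by
  induction g generalizing α β with
  | @last m₁ m₂ n π =>
    have hy : W.inl m₁ (PSeq.one m₂) ≫ (Gen.last π).wmap ≫ x = π.inA ≫ x :=
      W.inl_desc_assoc (s := PSeq.one _) _ _ _ x
    have hz : W.inr m₁ (PSeq.one m₂) ≫ (Gen.last π).wmap ≫ x = π.inB ≫ x :=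
      W.inr_desc_assoc (s := PSeq.one _) _ _ _ x
    have h₁ : yonedaEquiv (vtx m₁ false ≫ π.inA ≫ x) = α := by
      rw [← hα', init_inl, hy]
    have h₄ : yonedaEquiv (vtx m₂ true ≫ π.inB ≫ x) = β := by
      rw [← hβ', final_inr, hz]; rfl
    have h₂ : vtx m₁ true ≫ π.inA ≫ x = vtx m₂ false ≫ π.inB ≫ x := by
      exact (Category.assoc _ _ _).symm.trans ((congrArg (· ≫ x) π.vtx_meet).trans
        (Category.assoc _ _ _))
    refine (c.merge_evalCube π x hα hβ h₁ (congrArg yonedaEquiv h₂) rfl h₄).trans ?_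
    exact (c.eval_cons (s := PSeq.one m₂) _ hα' hβ' hy hz h₁ _ _ h₄).symm
  | @head m₁ m₂ n π s =>
    have hy : W.inl m₁ (PSeq.cons m₂ s) ≫ (Gen.head π s).wmap ≫ x = π.inA ≫ W.inl n s ≫ x :=
      (W.inl_desc_assoc _ _ _ x).trans (Category.assoc _ _ _)
    have hz : W.inr m₁ (PSeq.cons m₂ s) ≫ (Gen.head π s).wmap ≫ x =
        W.desc (π.inB ≫ W.inl _ s) (W.inr _ s) (by
          rw [← Category.assoc, π.vtx_inB, W.condition]) ≫ x := W.inr_desc_assoc _ _ _ x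
    have hz₁ := (W.inl_desc_assoc (π.inB ≫ W.inl _ s) (W.inr _ s) (by
      rw [← Category.assoc, π.vtx_inB, W.condition]) x).trans (Category.assoc _ _ _)
    have hz₂ := W.inr_desc_assoc (π.inB ≫ W.inl _ s) (W.inr _ s) (by
      rw [← Category.assoc, π.vtx_inB, W.condition]) x
    have h₁ : yonedaEquiv (vtx n false ≫ W.inl n s ≫ x) = α := by rw [← hα, init_inl]
    have h₂ : yonedaEquiv (W.final s ≫ W.inr n s ≫ x) = β := by rw [← hβ, final_inr]
    have h₃ : yonedaEquiv (vtx m₁ false ≫ π.inA ≫ W.inl n s ≫ x) = α := by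
      rw [← h₁, ← Category.assoc, π.vtx_inA]
    have h₄ : vtx m₁ true ≫ π.inA ≫ W.inl n s ≫ x = vtx m₂ false ≫ π.inB ≫ W.inl n s ≫ x := by
      rw [← Category.assoc, π.vtx_meet, Category.assoc]
    have h₅ : vtx m₂ true ≫ π.inB ≫ W.inl n s ≫ x = W.init s ≫ W.inr n s ≫ x := by
      rw [← Category.assoc, π.vtx_inB, final_inl]
    have e₁ := c.eval_cons x hα hβ rfl rfl h₁ (congrArg yonedaEquiv (final_inl x)) rfl h₂
    have e₂ := c.eval_cons ((Gen.head π s).wmap ≫ x) hα' hβ' hy hz h₃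
      (congrArg yonedaEquiv h₄) (by rw [init_inl, hz₁]) (by rw [final_inr, hz₂, h₂])
    have e₃ := c.eval_cons (W.desc (π.inB ≫ W.inl _ s) (W.inr _ s) (by
      rw [← Category.assoc, π.vtx_inB, W.condition]) ≫ x)
      (α := yonedaEquiv (vtx m₂ false ≫ π.inB ≫ W.inl n s ≫ x)) (by rw [init_inl, hz₁])
      (by rw [final_inr, hz₂, h₂]) hz₁ hz₂ rfl (congrArg yonedaEquiv h₅) rfl h₂
    rw [e₁, e₂, e₃]
    have e₄ := c.merge_evalCube π (W.inl n s ≫ x) h₁ (congrArg yonedaEquiv (final_inl x)) h₃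
      (congrArg yonedaEquiv h₄) rfl (congrArg yonedaEquiv h₅)
    -- `Gen.tmap` brackets the first two cubes together, whereas `eval` is bracketed to the right.
    -- The inverse associator is moved across, and the associativity of `Z` compares the two
    -- bracketings.
    refine (Category.assoc _ _ _).trans ((Iso.inv_comp_eq _).2 ?_)
    refine Eq.trans ?_ (MooreFlow.tensorMap_assoc _ _ _ _)
    rw [← e₄, ← tensorMap_comp_id, Category.assoc]
    rfl
  | @tail n s s' g ih =>
    have hy : W.inl n s ≫ (Gen.tail n g).wmap ≫ x = W.inl n s' ≫ x := W.inl_desc_assoc _ _ _ x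
    have hz : W.inr n s ≫ (Gen.tail n g).wmap ≫ x = g.wmap ≫ W.inr n s' ≫ x :=
      (W.inr_desc_assoc _ _ _ x).trans (Category.assoc _ _ _)
    have h₁ : yonedaEquiv (vtx n false ≫ W.inl n s' ≫ x) = α := by rw [← hα, init_inl]
    have h₂ : yonedaEquiv (W.final s' ≫ W.inr n s' ≫ x) = β := by rw [← hβ, final_inr]
    have h₃ : yonedaEquiv (W.init s ≫ g.wmap ≫ W.inr n s' ≫ x) =
        yonedaEquiv (W.init s' ≫ W.inr n s' ≫ x) := by rw [← Category.assoc, g.init_wmap]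
    have h₄ : yonedaEquiv (W.final s ≫ g.wmap ≫ W.inr n s' ≫ x) = β := by
      rw [← Category.assoc, g.final_wmap, h₂]
    have e₁ := c.eval_cons x hα hβ rfl rfl h₁ (congrArg yonedaEquiv (final_inl x)) rfl h₂
    have e₂ := c.eval_cons ((Gen.tail n g).wmap ≫ x) hα' hβ' hy hz h₁
      (congrArg yonedaEquiv (final_inl x)) h₃ h₄
    -- The first cube is untouched, so only the tail factor changes and the induction hypothesis
    -- applies to it.
    rw [e₁, e₂, ← ih _ _ _ rfl h₂ h₃ h₄, ← tensorMap_id_comp, Category.assoc]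
    rfl

theorem path_tmap_eval {s s' : PSeq} (p : GPath s s') (x : W s' ⟶ K) {y : W s ⟶ K}
    (e : p.wmap ≫ x = y) (α β : Vert K)
    (hα : yonedaEquiv (W.init s' ≫ x) = α) (hβ : yonedaEquiv (W.final s' ≫ x) = β)
    (hα' : yonedaEquiv (W.init s ≫ y) = α) (hβ' : yonedaEquiv (W.final s ≫ y) = β) :
    p.tmap ≫ c.eval s' x α β hα hβ = c.eval s y α β hα' hβ' := by
  induction p with
  | nil s =>
    obtain rfl : x = y := (Category.id_comp x).symm.trans e
    exact Category.id_comp _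
  | cons g p ih =>
    have e' : g.wmap ≫ p.wmap ≫ x = y := (Category.assoc _ _ _).symm.trans e
    subst e'
    refine (Category.assoc _ _ _).trans ((congrArg (g.tmap ≫ ·) (ih x rfl hα hβ ?_ ?_)).trans
      (c.tmap_eval g _ α β _ _ _ _))
    · rw [← Category.assoc, p.init_wmap, hα]
    · rw [← Category.assoc, p.final_wmap, hβ]

/-- Evaluation is an iterated composition, so it turns concatenation into composition. This makes
the induced map on path spaces compatible with the composition law. -/
theorem cat_eval {t : PSeq} (y : W t ⟶ K) (s : PSeq) (x : W s ⟶ K) (α β γ : Vert K)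
    (h : W.final s ≫ x = W.init t ≫ y)
    (hα : yonedaEquiv (W.init s ≫ x) = α) (hβ : yonedaEquiv (W.final s ≫ x) = β)
    (hβ' : yonedaEquiv (W.init t ≫ y) = β) (hγ : yonedaEquiv (W.final t ≫ y) = γ)
    (h₁ : yonedaEquiv (W.init (s.append t) ≫ (catW y s x h).1) = α)
    (h₂ : yonedaEquiv (W.final (s.append t) ≫ (catW y s x h).1) = γ) :
    cat s t ≫ c.eval (s.append t) (catW y s x h).1 α γ h₁ h₂ =
      tensorMap (c.eval s x α β hα hβ) (c.eval t y β γ hβ' hγ) ≫ Z.comp _ _ _ := by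
  induction s generalizing α with
  | one n =>
    exact (Category.id_comp _).trans (c.eval_cons (n := n) (s := t) _ h₁ h₂
      (W.inl_desc _ _ _) (W.inr_desc _ _ _) hα hβ hβ' hγ)
  | cons n s ih =>
    have h₃ : W.final s ≫ W.inr n s ≫ x = W.init t ≫ y := (Category.assoc _ _ _).symm.trans h
    have h₄ : yonedaEquiv (W.init (s.append t) ≫ (catW y s (W.inr n s ≫ x) h₃).1) =
        yonedaEquiv (W.init s ≫ W.inr n s ≫ x) := by rw [(catW y s _ _).2]
    have h₅ : yonedaEquiv (W.final (s.append t) ≫ (catW y s (W.inr n s ≫ x) h₃).1) = γ := by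
      rw [final_catW, hγ]
    have h₆ : yonedaEquiv (vtx n false ≫ W.inl n s ≫ x) = α := by rw [← hα, init_inl]
    have h₇ : yonedaEquiv (W.final s ≫ W.inr n s ≫ x) = β := by rw [← hβ, final_inr]
    have e₁ := c.eval_cons (n := n) (s := s.append t) _ h₁ h₂ (W.inl_desc _ _ _)
      (W.inr_desc _ _ _) h₆ (congrArg yonedaEquiv (final_inl x)) h₄ h₅
    have e₂ := c.eval_cons x hα hβ rfl rfl h₆ (congrArg yonedaEquiv (final_inl x)) rfl h₇
    rw [e₂]
    -- Associativity in `Z` separates the first cube from the rest of the first chain; that rest,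
    -- concatenated with the second chain, is handled by induction.
    refine Eq.trans ?_ (MooreFlow.tensorMap_assoc _ _ _ _).symm
    rw [← ih _ _ h₃ rfl h₇ h₄ h₅, ← tensorMap_id_comp, Category.assoc]
    exact (congrArg (cat (PSeq.cons n s) t ≫ ·) e₁).trans (Category.assoc _ _ _)

/-- The map of `𝒢`-spaces induced on `ℙ_{α,β} ‖K‖^𝒢`. -/
def descP (α β : Vert K) : PG K α β ⟶ Z.P (c.st α) (c.st β) :=
  Chain.desc (fun _ a => c.eval a.s a.x α β a.init a.final) fun _ a b p e =>
    c.path_tmap_eval p b.x e α β b.init b.final a.init a.final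

/-- The map of Moore flows out of `‖K‖^𝒢`. -/
def desc : doubleBarObj K ⟶ Z where
  st := c.st
  P := c.descP
  map_comp α β γ := by
    refine Chain.hom_ext₂ fun m n a b => ?_
    refine (Category.assoc _ _ _).symm.trans ((congrArg (· ≫ c.descP α γ)
      (Chain.incl_compPG a b)).trans ((Category.assoc _ _ _).trans ?_))
    refine Eq.trans ?_ (tensorMap_comp_assoc a.incl b.incl (c.descP α β) (c.descP β γ)
      (Z.comp _ _ _)).symm
    exact c.cat_eval b.x a.s a.x α β γ (Chain.meet a b) a.init a.final b.init b.final
      (Chain.concat a b).init (Chain.concat a b).final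

/-- States are handled by `f_st`. A path of a face goes to the one-cube chain of that face, whose
evaluation is by `evalCube_face` the restriction of `c.f x`. -/
theorem fac {n : ℕ} (x : cubeSet n ⟶ K) : unitApp n ≫ doubleBar.map x ≫ c.desc = c.f x := by
  have hst : ∀ a : (regCube n).state,
      (c.f x).st a = c.st (MooreFlow.Hom.st (unitApp n ≫ doubleBar.map x) a) := fun a =>
    (c.f_st x (vert a) a (cubeMap_vert a _)).trans
      (congrArg c.st (unitApp_map_st x a (vert a) (cubeMap_vert a _)).symm)
  refine (MooreFlow.hom_ext_castP hst fun a b => Span.hom_ext fun s => ?_).symm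
  have hα := unitApp_map_st_of_face x s.hom a false s.bot
  have hβ := unitApp_map_st_of_face x s.hom b true s.top
  refine (c.evalCube_face s x hα hβ (hst a) (hst b)).symm.trans (Eq.symm ?_)
  have e := s.iso_unitApp_map x rfl rfl hα hβ
  refine Eq.trans ?_ (congrArg (· ≫ c.descP _ _) e)
  exact ((Category.assoc _ _ _).trans (congrArg (s.iso.hom ≫ ·) (congrArg (· ≫ c.descP _ _)
    (MooreFlow.Hom.castP_rfl (unitApp n ≫ doubleBar.map x) a b)))).symm

end CubeCocone

/-! ### Generation of `‖K‖^𝒢` by its cubes, which gives uniqueness of maps out of it. -/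

theorem inclW_cons {K : PrecubicalSet} {n : ℕ+} {s : PSeq} (x : W (PSeq.cons n s) ⟶ K)
    {α β γ : Vert K} (hα : yonedaEquiv (W.init (PSeq.cons n s) ≫ x) = α)
    (hγ : yonedaEquiv (W.final (PSeq.cons n s) ≫ x) = γ)
    (h₁ : yonedaEquiv (vtx n false ≫ W.inl n s ≫ x) = α)
    (h₂ : yonedaEquiv (vtx n true ≫ W.inl n s ≫ x) = β)
    (h₃ : yonedaEquiv (W.init s ≫ W.inr n s ≫ x) = β)
    (h₄ : yonedaEquiv (W.final s ≫ W.inr n s ≫ x) = γ) :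
    inclW (PSeq.cons n s) x hα hγ = tensorMap (inclW (PSeq.one n) (W.inl n s ≫ x) h₁ h₂)
      (inclW s (W.inr n s ≫ x) h₃ h₄) ≫ Chain.compPG K α β γ := by
  have h : W.final (PSeq.one n) ≫ W.inl n s ≫ x = W.init s ≫ W.inr n s ≫ x :=
    CubeCocone.final_inl x
  -- By uniqueness of maps out of the pushout, a chain is the concatenation of its first cube and
  -- the remaining ones.
  have e : (catW (W.inr n s ≫ x) (PSeq.one n) (W.inl n s ≫ x) h).1 = x :=
    W.hom_ext (W.inl_desc _ _ _) (W.inr_desc _ _ _)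
  refine Eq.symm ((inclW_comp _ _ _ _ _ _ h (by rw [e]; exact hα) (by rw [e]; exact hγ)).trans
    ((Category.id_comp _).trans ?_))
  congr 1

/-- A one-cube chain is the image under the canonical map of the natural paths of the top face, so
it is seen by the restriction to the cube `x`. -/
theorem inclW_one {K : PrecubicalSet} {n : ℕ+} (x : cubeSet n ⟶ K) {α β : Vert K}
    (hα : yonedaEquiv (vtx n false ≫ x) = α) (hβ : yonedaEquiv (vtx n true ≫ x) = β)
    (ha : MooreFlow.Hom.st (unitApp n ≫ doubleBar.map x) (corner n false) = α)
    (hb : MooreFlow.Hom.st (unitApp n ≫ doubleBar.map x) (corner n true) = β) :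
    inclW (PSeq.one n) x hα hβ = (topSpan n).iso.hom ≫
      MooreFlow.Hom.castP (unitApp n ≫ doubleBar.map x) (corner n false) (corner n true) ha hb := by
  have hx : ymap (BoxHom.id n) ≫ x = x :=
    (congrArg (· ≫ x) (yoneda.map_id (⟨n⟩ : Box))).trans (Category.id_comp x)
  refine Eq.symm (((topSpan n).iso_unitApp_map x ha hb ?_ ?_).trans ?_)
  · exact (congrArg (fun k => yonedaEquiv (vtx n false ≫ k)) hx).trans hα
  · exact (congrArg (fun k => yonedaEquiv (vtx n true ≫ k)) hx).trans hβ
  · show inclW (PSeq.one n) (ymap (BoxHom.id n) ≫ x) _ _ = _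
    congr 1

/-- Maps out of `‖K‖^𝒢` are determined by their restrictions to the cubes. -/
theorem doubleBarObj_hom_ext {K : PrecubicalSet} {Z : MooreFlow} {f g : doubleBarObj K ⟶ Z}
    (h : ∀ {n : ℕ} (x : cubeSet n ⟶ K),
      unitApp n ≫ doubleBar.map x ≫ f = unitApp n ≫ doubleBar.map x ≫ g) : f = g := by
  -- Each vertex of `K` is the image of the only state of a 0-cube.
  have hst : ∀ α, f.st α = g.st α := fun α => by
    have e := congrArg (fun k => MooreFlow.Hom.st k (corner 0 false)) (h (yonedaEquiv.symm α))
    have e' : (doubleBar.map (yonedaEquiv.symm α)).st ((unitApp 0).st (corner 0 false)) = α := by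
      have : vert (corner 0 false) = BoxHom.id 0 :=
        (eq_vert _ _ (fun _ => 0) (Subsingleton.elim _ _)).symm
      refine (congrArg (doubleBar.map (yonedaEquiv.symm α)).st this).trans ?_
      exact yonedaEquiv.apply_symm_apply α
    exact (congrArg f.st e').symm.trans (Eq.trans e (congrArg g.st e'))
  -- Chains with one cube: both maps agree after the canonical map of that cube, through which the
  -- inclusion factors by `inclW_one`.
  have cube : ∀ {n : ℕ+} (x : cubeSet n ⟶ K) (α β : Vert K)
      (hα : yonedaEquiv (vtx n false ≫ x) = α) (hβ : yonedaEquiv (vtx n true ≫ x) = β),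
      inclW (PSeq.one n) x hα hβ ≫ MooreFlow.Hom.castP f α β (hst α) (hst β) =
        inclW (PSeq.one n) x hα hβ ≫ MooreFlow.Hom.castP g α β rfl rfl := by
    intro n x α β hα hβ
    have ha : MooreFlow.Hom.st (unitApp n ≫ doubleBar.map x) (corner n false) = α :=
      (unitApp_map_st x _ (constHom n false) rfl).trans hα
    have hb : MooreFlow.Hom.st (unitApp n ≫ doubleBar.map x) (corner n true) = β :=
      (unitApp_map_st x _ (constHom n true) rfl).trans hβ
    have h' : (unitApp n ≫ doubleBar.map x) ≫ f = (unitApp n ≫ doubleBar.map x) ≫ g :=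
      (Category.assoc _ _ _).trans ((h x).trans (Category.assoc _ _ _).symm)
    have e : MooreFlow.Hom.castP (unitApp n ≫ doubleBar.map x) (corner n false)
        (corner n true) ha hb ≫ MooreFlow.Hom.castP f α β (hst α) (hst β) =
        MooreFlow.Hom.castP (unitApp n ≫ doubleBar.map x) (corner n false)
        (corner n true) ha hb ≫ MooreFlow.Hom.castP g α β rfl rfl := by
      refine (MooreFlow.Hom.castP_comp _ f ha hb (hst α) (hst β)
        ((congrArg f.st ha).trans (hst α)) ((congrArg f.st hb).trans (hst β))).symm.trans ?_
      refine (MooreFlow.Hom.castP_congr h' _ _ (congrArg g.st ha) (congrArg g.st hb)).trans ?_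
      exact MooreFlow.Hom.castP_comp _ g ha hb rfl rfl _ _
    refine (congrArg (· ≫ _) (inclW_one x hα hβ ha hb)).trans ((Category.assoc _ _ _).trans
      ((congrArg ((topSpan n).iso.hom ≫ ·) e).trans (Eq.symm ?_)))
    exact (congrArg (· ≫ _) (inclW_one x hα hβ ha hb)).trans (Category.assoc _ _ _)
  -- All chains, by induction: both maps preserve composition and a chain is the composite of its
  -- first cube and its tail.
  have key : ∀ (s : PSeq) (x : W s ⟶ K) (α β : Vert K) (hα : yonedaEquiv (W.init s ≫ x) = α)
      (hβ : yonedaEquiv (W.final s ≫ x) = β),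
      inclW s x hα hβ ≫ MooreFlow.Hom.castP f α β (hst α) (hst β) =
        inclW s x hα hβ ≫ MooreFlow.Hom.castP g α β rfl rfl := by
    intro s
    induction s with
    | one n => exact cube
    | cons n s ih =>
      intro x α γ hα hγ
      have e := inclW_cons x hα hγ ((congrArg yonedaEquiv (CubeCocone.init_inl x)).symm.trans hα)
        (congrArg yonedaEquiv (CubeCocone.final_inl x)) rfl
        ((congrArg yonedaEquiv (CubeCocone.final_inr x)).symm.trans hγ)
      have hf := MooreFlow.Hom.comp_castP f (hst α)
        (hst (yonedaEquiv (W.init s ≫ W.inr n s ≫ x))) (hst γ)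
      have hg := MooreFlow.Hom.comp_castP g (u := α)
        (v := yonedaEquiv (W.init s ≫ W.inr n s ≫ x)) (w := γ) rfl rfl rfl
      rw [e]
      refine (Category.assoc _ _ _).trans (Eq.trans ?_ (Category.assoc _ _ _).symm)
      refine (congrArg (tensorMap _ _ ≫ ·) hf).trans
        (Eq.trans ?_ (congrArg (tensorMap _ _ ≫ ·) hg).symm)
      refine (tensorMap_comp_assoc _ _ _ _ _).trans
        (Eq.trans ?_ (tensorMap_comp_assoc _ _ _ _ _).symm)
      exact congrArg₂ (fun k l => tensorMap k l ≫ Z.comp _ _ _) (cube _ _ _ _ _) (ih _ _ _ _ _)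
  refine MooreFlow.hom_ext_castP hst fun α β => PG_hom_ext fun s x hα hβ => ?_
  exact (key s x α β hα hβ).trans
    (congrArg (inclW s x hα hβ ≫ ·) (MooreFlow.Hom.castP_rfl g α β))

/-! ### The universal property -/

/-- The functor `K ↦ ‖K‖^𝒢` as an extension of the cocubical Moore flow of regular cubes. -/
def doubleBarExtension : (yoneda : Box ⥤ PrecubicalSet).LeftExtension regCubeFlow :=
  Functor.LeftExtension.mk doubleBar unit

/-- The compatible family of maps given by a cocone on the category of cubes of `K`. -/
def CubeCocone.ofCocone {K : PrecubicalSet}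
    (s : Limits.Cocone (CostructuredArrow.proj (yoneda : Box ⥤ PrecubicalSet) K ⋙ regCubeFlow)) :
    CubeCocone K s.pt where
  f x := s.ι.app (CostructuredArrow.mk (S := yoneda) (Y := (⟨_⟩ : Box)) x)
  w {m n} δ x := by
    -- The box map `δ`, seen as a morphism of the category of cubes of `K` from the face of `x` to
    -- `x`.
    have := s.w (CostructuredArrow.homMk
      (f := CostructuredArrow.mk (S := yoneda) (Y := (⟨m⟩ : Box)) (ymap δ ≫ x))
      (f' := CostructuredArrow.mk (S := yoneda) (Y := (⟨n⟩ : Box)) x) δ rfl)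
    exact this

/-- The Moore flow `‖K‖^𝒢` is the colimit of the Moore flows of the cubes of `K`. -/
def doubleBarIsPointwise : doubleBarExtension.IsPointwiseLeftKanExtension := fun _ =>
  { desc := fun s => (CubeCocone.ofCocone s).desc
    fac := fun s j => (Category.assoc _ _ _).trans
      ((CubeCocone.ofCocone s).fac (n := j.left.dim) j.hom)
    uniq := fun s _ hm => doubleBarObj_hom_ext fun {n} x =>
      ((Category.assoc _ _ _).symm.trans
        (hm (CostructuredArrow.mk (S := yoneda) (Y := (⟨n⟩ : Box)) x))).trans
          ((CubeCocone.ofCocone s).fac x).symm }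

end

end MooreFlows

/-- The value at `K` of the pointwise left Kan extension along the Yoneda embedding is the colimit
of `regCubeFlow` over the category of cubes of `K`, that is `[K]_reg`. The first component says that
these colimits exist. An isomorphism of functors is an isomorphism natural in `K`, and it comes from
uniqueness of left Kan extensions. -/
theorem mainTheorem8 :
    ∃ _ : (CategoryTheory.yoneda : MooreFlows.Box ⥤
        MooreFlows.PrecubicalSet).HasPointwiseLeftKanExtension MooreFlows.regCubeFlow,
      Nonempty ((CategoryTheory.yoneda : MooreFlows.Box ⥤
        MooreFlows.PrecubicalSet).pointwiseLeftKanExtension MooreFlows.regCubeFlow ≅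
          MooreFlows.doubleBar) := by
  have h := MooreFlows.doubleBarIsPointwise.hasPointwiseLeftKanExtension
  have h' : MooreFlows.doubleBar.IsLeftKanExtension MooreFlows.unit :=
    MooreFlows.doubleBarIsPointwise.isLeftKanExtension
  exact ⟨h, ⟨Functor.leftKanExtensionUnique _ (Functor.pointwiseLeftKanExtensionUnit _ _) _
    MooreFlows.unit⟩⟩
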